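/- **Setting.** Write $[m]=\{1,\dots,m\}$. Identify $SO(2)$ with the circle $S^1=\mathbb R/2\pi\mathbb Z$, with the normalized measure $\int_{S^1}(\cdots)\,d\alpha=\frac1{2\pi}\int_0^{2\pi}(\cdots)\,d\alpha$, and let $\Theta_t$ be the linear rotation of $\mathbb R^2$ by the angle $t$. *Bases.* Let $\{\varphi_m\}_{m\in\mathbb Z}$ be the real Fourier basis of $L^2(S^1)$: $\varphi_0=1$, $\varphi_m(\beta)=\sqrt2\cos(m\beta)$ for $m>0$, $\varphi_m(\beta)=\sqrt2\sin(|m|\beta)$ for $m<0$. Let $\{\psi_k\}_k$ be the real Fourier–Bessel basis of the unit disk: the index is a pair $k=(n,R)$ with $n\in\mathbb Z$ and $R>0$ a zero of the Bessel function $J_{|n|}$, and $\psi_k(r,\theta)=c_kJ_{|n|}(Rr)\varphi_n(\theta)$ for $r\le1$, $\psi_k=0$ for $r>1$, where $c_k>0$ is such that $\int\psi_k^2=\pi$. Let $\mu_k=R^2$ be the corresponding Dirichlet Laplacian eigenvalue of the unit disk. For $j\in\mathbb R$ put $\psi_{j,k}(v)=2^{-2j}\psi_k(2^{-j}v)$.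 *Network.* A RotDCF net has channel numbers $M_0,M_1,\dots\ge1$, an activation $\sigma:\mathbb R\to\mathbb R$, scales $j_l\in\mathbb R$, biases $b^{(l)}(\lambda)\in\mathbb R$ and real coefficients $a^{(l)}_{\lambda',\lambda}$ ($l\ge1$, $\lambda'\in[M_{l-1}]$, $\lambda\in[M_l]$), which give the filters $$W^{(1)}_{\lambda',\lambda}(v)=\sum_k a^{(1)}_{\lambda',\lambda}(k)\,\psi_{j_1,k}(v),\qquad W^{(l)}_{\lambda',\lambda}(v,\beta)=\sum_{k,m}a^{(l)}_{\lambda',\lambda}(k,m)\,\psi_{j_l,k}(v)\,\varphi_m(\beta)\quad(l>1),$$ the sums being finite or, more generally, convergent in $L^2$. From an input $x^{(0)}(u,\lambda)$, $u\in\mathbb R^2$, $\lambda\in[M_0]$, the layers $x^{(l)}=x^{(l)}[x^{(0)}]$ are $$x^{(1)}(u,\alpha,\lambda)=\sigma\Big(\sum_{\lambda'}\int_{\mathbb R^2}x^{(0)}(u+v',\lambda')W^{(1)}_{\lambda',\lambda}(\Theta_\alpha v')\,dv'+b^{(1)}(\lambda)\Big),$$ $$x^{(l)}(u,\alpha,\lambda)=\sigma\Big(\sum_{\lambda'}\int_{S^1}\int_{\mathbb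 R^2}x^{(l-1)}(u+v',\alpha',\lambda')W^{(l)}_{\lambda',\lambda}(\Theta_\alpha v',\alpha'-\alpha)\,dv'\,d\alpha'+b^{(l)}(\lambda)\Big),\quad l>1.$$ *Norms.* Fix $\Omega\subset\mathbb R^2$ with $0<|\Omega|<\infty$ and put $\|x^{(0)}\|^2=\frac1{M_0}\sum_\lambda\frac1{|\Omega|}\int_{\mathbb R^2}x^{(0)}(u,\lambda)^2\,du$ and, for $l\ge1$, $\|x^{(l)}\|^2=\frac1{M_l}\sum_\lambda\frac1{|\Omega|}\int_{\mathbb R^2}\int_{S^1}x^{(l)}(u,\alpha,\lambda)^2\,d\alpha\,du$. Let $\|a^{(1)}_{\lambda',\lambda}\|_{FB}^2=\sum_k\mu_k\,a^{(1)}_{\lambda',\lambda}(k)^2$, $\|a^{(l)}_{\lambda',\lambda}\|_{FB}^2=\sum_{k,m}\mu_k\,a^{(l)}_{\lambda',\lambda}(k,m)^2$ for $l>1$, and $$A_l=\pi\max\Big\{\sup_\lambda\sum_{\lambda'=1}^{M_{l-1}}\|a^{(l)}_{\lambda',\lambda}\|_{FB},\ \sup_{\lambda'}\frac{M_{l-1}}{M_l}\sum_{\lambda=1}^{M_l}\|a^{(l)}_{\lambda',\lambda}\|_{FB}\Big\}.$$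 *Transformations.* For $\tau:\mathbb R^2\to\mathbb R^2$ of class $C^2$ let $D_\tau x^{(0)}(u,\lambda)=x^{(0)}(u-\tau(u),\lambda)$, $|\tau|_\infty=\sup_u|\tau(u)|\in[0,\infty]$, and $|\nabla\tau|_\infty=\sup_u\|\nabla\tau(u)\|$ (operator norm). For $u_0\in\mathbb R^2$ and $t\in S^1$ let $\rho u=\rho_{u_0,t}u=u_0+\Theta_t(u-u_0)$, $D_\rho x^{(0)}(u,\lambda)=x^{(0)}(\rho u,\lambda)$ and $T_\rho x^{(l)}(u,\alpha,\lambda)=x^{(l)}(\rho u,\alpha-t,\lambda)$. **Theorem.** Let $L\ge1$ and assume - (A1) $\sigma$ is non-expansive: $|\sigma(s)-\sigma(s')|\le|s-s'|$ for all $s,s'\in\mathbb R$; - (A2) $A_l\le1$ for $1\le l\le L$; - (A3) $|\nabla\tau|_\infty<\frac15$. Then for every rotation $\rho=\rho_{u_0,t}$ and every input $x^{(0)}$ whose channels are in $L^2(\mathbb R^2)$, $$\big\|x^{(L)}[D_\rho\circ D_\tau x^{(0)}]-T_\rho x^{(L)}[x^{(0)}]\big\|\le\big(2c_1L\,|\nabla\tau|_\infty+c_2\,2^{-j_L}|\tau|_\infty\big)\|x^{(0)}\|,\qquad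 c_1=4,\ c_2=2$$ (both sides in $[0,\infty]$, with $\infty\cdot0=0$). -/

import Mathlib

open MeasureTheory Filter Topology
open scoped Real ENNReal

namespace RotDCF

noncomputable section

instance fact_two_pi_pos : Fact ((0 : ℝ) < 2 * π) := ⟨Real.two_pi_pos⟩

/-- The circle `S¹ = ℝ / 2πℤ ≅ SO(2)`, an element being an angle. -/
abbrev S1 : Type := AddCircle (2 * π)

/-- The normalized measure `dα / 2π` on `S¹`, of total mass one. -/
abbrev dS1 : Measure S1 := AddCircle.haarAddCircle

/- The plane `ℝ²` is `ℂ` with its real structure: `‖·‖` is the Euclidean norm and `volume` is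
the Lebesgue measure. -/

/-- The product of the Lebesgue measure on the plane and the normalized measure on `S¹`. -/
abbrev dPlaneS1 : Measure (ℂ × S1) := (volume : Measure ℂ).prod dS1

/-- The linear rotation `Θ_t` of the plane by the angle `t`. -/
def rot (t : S1) (v : ℂ) : ℂ := (AddCircle.toCircle t : ℂ) * v

/-- The rigid rotation `ρ_{u₀,t}` around the point `u₀` by the angle `t`. -/
def rotAround (u₀ : ℂ) (t : S1) (u : ℂ) : ℂ := u₀ + rot t (u - u₀)

/-! ### Fourier and Fourier-Bessel bases -/

/-- The real Fourier basis of `L²(S¹)`: `1`, `√2 cos (m β)` for `m > 0`, and `√2 sin (|m| β)`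
for `m < 0`. (Mathlib's `fourier m β` is `exp (i m β)`.) -/
def fourierReal (m : ℤ) (β : S1) : ℝ :=
  if m = 0 then 1
  else if 0 < m then √2 * (fourier m β).re
  else √2 * (fourier (-m) β).im

/-- The Bessel function of the first kind `J_n`, for an order `n ∈ ℕ`. -/
def besselJ (n : ℕ) (x : ℝ) : ℝ :=
  ∑' k : ℕ, (-1) ^ k / ((k.factorial : ℝ) * ((n + k).factorial : ℝ)) * (x / 2) ^ (2 * k + n)

/-- Indices of the real Fourier-Bessel basis of the unit disk: an angular frequency `n ∈ ℤ`
(cosine modes for `n ≥ 0`, sine modes for `n < 0`) and a positive zero `R` of `J_{|n|}`. -/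
abbrev FBIndex : Type := {p : ℤ × ℝ // 0 < p.2 ∧ besselJ p.1.natAbs p.2 = 0}

/-- The Dirichlet Laplacian eigenvalue `μ_k = R²` of the unit disk that belongs to the
eigenfunction with index `k = (n, R)`. -/
def FBIndex.mu (k : FBIndex) : ℝ := k.1.2 ^ 2

/-- The Fourier-Bessel function `ψ_k(r, θ) = c_k J_{|n|}(R r) φ_n(θ)` on the unit disk, extended
by zero. The constant `c_k = (2 ∫₀¹ J_{|n|}(R r)² r dr)^{-1/2}` is the one for which the mean
square of `ψ_k` over the unit disk is one, i.e. `∫ ψ_k² = π`. -/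
def psi (k : FBIndex) (v : ℂ) : ℝ :=
  if ‖v‖ ≤ 1 then
    (√(2 * ∫ r in (0 : ℝ)..1, besselJ k.1.1.natAbs (k.1.2 * r) ^ 2 * r))⁻¹
      * besselJ k.1.1.natAbs (k.1.2 * ‖v‖) * fourierReal k.1.1 (v.arg : S1)
  else 0

/-- The rescaled function `ψ_{j,k}(v) = 2^{-2j} ψ_k(2^{-j} v)`, supported on the disk of
radius `2^j`. -/
def psiScaled (j : ℝ) (k : FBIndex) (v : ℂ) : ℝ :=
  (2 : ℝ) ^ (-2 * j) * psi k ((2 : ℝ) ^ (-j) • v)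

/-- The joint basis `ψ_{j,k}(v) φ_m(β)` of functions on `ℝ² × S¹`. -/
def psiJoint (j : ℝ) (q : FBIndex × ℤ) (p : ℂ × S1) : ℝ :=
  psiScaled j q.1 p.1 * fourierReal q.2 p.2

/-- `W = ∑_i a_i e_i`, as an unconditionally convergent sum in `L²(ν)`. If only finitely many
`a_i` are nonzero, this says that `W` is the finite sum, almost everywhere. -/
def IsL2Expansion {X ι : Type*} [MeasurableSpace X] (ν : Measure X) (a : ι → ℝ)
    (e : ι → X → ℝ) (W : X → ℝ) : Prop :=
  MemLp W 2 ν ∧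
    Tendsto (fun s : Finset ι => eLpNorm (fun x => W x - ∑ i ∈ s, a i * e i x) 2 ν) atTop (𝓝 0)

/-- The weighted norm `(∑_k μ_k a(k)²)^{1/2} ∈ [0, ∞]`. -/
def fbNorm (a : FBIndex → ℝ) : ℝ≥0∞ :=
  (∑' k : FBIndex, ENNReal.ofReal (k.mu * a k ^ 2)) ^ (1 / 2 : ℝ)

/-- The weighted norm `(∑_k ∑_m μ_k a(k,m)²)^{1/2} ∈ [0, ∞]`. -/
def fbNormJoint (a : FBIndex × ℤ → ℝ) : ℝ≥0∞ :=
  (∑' k : FBIndex, ∑' m : ℤ, ENNReal.ofReal (k.mu * a (k, m) ^ 2)) ^ (1 / 2 : ℝ)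

/-! ### The network -/

/-- A RotDCF net with channel numbers `M_0, M_1, …`, scales `j_1, j_2, …`, biases, activation
`σ`, and filters given by their Fourier-Bessel coefficients. The first filter lives on `ℝ²`, the
others live on `ℝ² × S¹`. The fields `a n`, `W n` belong to the layer `n + 2`; the values `j 0`
and `b 0` are not used. -/
structure Net where
  /-- The number `M_l` of unstructured channels of layer `l`. -/
  M : ℕ → ℕ
  M_pos : ∀ l, 0 < M l
  /-- The activation. -/
  σ : ℝ → ℝ
  /-- The scale `j_l` of the filters of layer `l`. -/
  j : ℕ → ℝ
  /-- The biases of layer `l`. -/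
  b : (l : ℕ) → Fin (M l) → ℝ
  /-- The coefficients `a^{(1)}_{λ',λ}(k)`. -/
  a₁ : Fin (M 0) → Fin (M 1) → FBIndex → ℝ
  /-- The filters `W^{(1)}_{λ',λ}(v)`. -/
  W₁ : Fin (M 0) → Fin (M 1) → ℂ → ℝ
  W₁_eq : ∀ c' c, IsL2Expansion volume (a₁ c' c) (psiScaled (j 1)) (W₁ c' c)
  /-- The coefficients `a^{(n+2)}_{λ',λ}(k,m)`. -/
  a : (n : ℕ) → Fin (M (n + 1)) → Fin (M (n + 2)) → FBIndex × ℤ → ℝ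
  /-- The filters `W^{(n+2)}_{λ',λ}(v,β)`. -/
  W : (n : ℕ) → Fin (M (n + 1)) → Fin (M (n + 2)) → ℂ × S1 → ℝ
  W_eq : ∀ n c' c, IsL2Expansion dPlaneS1 (a n c' c) (psiJoint (j (n + 2))) (W n c' c)

/-- The first layer, applied to an input `x(u, λ')`. -/
def Net.firstLayer (N : Net) (x : ℂ → Fin (N.M 0) → ℝ) : ℂ → S1 → Fin (N.M 1) → ℝ :=
  fun u α c => N.σ ((∑ c', ∫ v : ℂ, x (u + v) c' * N.W₁ c' c (rot α v)) + N.b 1 c)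

/-- The layer `n + 2`, a joint convolution over `ℝ² × S¹`, applied to `x(u, α, λ')`. -/
def Net.jointLayer (N : Net) (n : ℕ) (x : ℂ → S1 → Fin (N.M (n + 1)) → ℝ) :
    ℂ → S1 → Fin (N.M (n + 2)) → ℝ :=
  fun u α c => N.σ ((∑ c', ∫ p : ℂ × S1,
    x (u + p.1) p.2 c' * N.W n c' c (rot α p.1, p.2 - α) ∂dPlaneS1) + N.b (n + 2) c)

/-- The output `x^{(l)}[x]` of layer `l` from the input `x`. For `l = 0` it is the input, as a
function that does not depend on the angle. -/
def Net.output (N : Net) (x : ℂ → Fin (N.M 0) → ℝ) : (l : ℕ) → ℂ → S1 → Fin (N.M l) → ℝ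
  | 0 => fun u _ c => x u c
  | 1 => N.firstLayer x
  | n + 2 => N.jointLayer n (N.output x (n + 1))

/-- `π max {sup_λ ∑_{λ'} w_{λ',λ}, sup_{λ'} (M'/M) ∑_λ w_{λ',λ}}`, for `λ' ∈ [M']`, `λ ∈ [M]`. -/
def boundOf {M' M : ℕ} (w : Fin M' → Fin M → ℝ≥0∞) : ℝ≥0∞ :=
  ENNReal.ofReal π *
    max (⨆ c, ∑ c', w c' c) (⨆ c', ((M' : ℝ≥0∞) / (M : ℝ≥0∞)) * ∑ c, w c' c)

/-- The quantity `A_l ∈ [0, ∞]` of the layer `l ≥ 1` (there is no layer `0`). -/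
def Net.A (N : Net) : ℕ → ℝ≥0∞
  | 0 => 0
  | 1 => boundOf fun c' c => fbNorm (N.a₁ c' c)
  | n + 2 => boundOf fun c' c => fbNormJoint (N.a n c' c)

/-! ### Norms and transformations -/

/-- The normalized `L²` norm of an input `x(u, λ)`, with values in `[0, ∞]`. -/
def inputNorm (Ω : Set ℂ) {M : ℕ} (x : ℂ → Fin M → ℝ) : ℝ≥0∞ :=
  ((M : ℝ≥0∞)⁻¹ * ∑ c, (volume Ω)⁻¹ * ∫⁻ u, ‖x u c‖ₑ ^ 2) ^ (1 / 2 : ℝ)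

/-- The normalized `L²` norm of a feature map `x(u, α, λ)`, with values in `[0, ∞]`. -/
def featureNorm (Ω : Set ℂ) {M : ℕ} (x : ℂ → S1 → Fin M → ℝ) : ℝ≥0∞ :=
  ((M : ℝ≥0∞)⁻¹ * ∑ c, (volume Ω)⁻¹ * ∫⁻ p : ℂ × S1, ‖x p.1 p.2 c‖ₑ ^ 2 ∂dPlaneS1) ^ (1 / 2 : ℝ)

/-- `D_ρ x(u, λ) = x(ρ u, λ)` for `ρ = ρ_{u₀,t}`. -/
def Drho (u₀ : ℂ) (t : S1) {M : ℕ} (x : ℂ → Fin M → ℝ) : ℂ → Fin M → ℝ :=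
  fun u c => x (rotAround u₀ t u) c

/-- `D_τ x(u, λ) = x(u - τ(u), λ)`. -/
def Dtau (τ : ℂ → ℂ) {M : ℕ} (x : ℂ → Fin M → ℝ) : ℂ → Fin M → ℝ :=
  fun u c => x (u - τ u) c

/-- `T_ρ x(u, α, λ) = x(ρ u, α - t, λ)` for `ρ = ρ_{u₀,t}`. -/
def Trho (u₀ : ℂ) (t : S1) {M : ℕ} (x : ℂ → S1 → Fin M → ℝ) : ℂ → S1 → Fin M → ℝ :=
  fun u α c => x (rotAround u₀ t u) (α - t) c

/-- `|τ|_∞ = sup_u |τ(u)| ∈ [0, ∞]`. -/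
def supNorm (τ : ℂ → ℂ) : ℝ≥0∞ := ⨆ u, ‖τ u‖ₑ

/-- `|∇τ|_∞ = sup_u ‖∇τ(u)‖ ∈ [0, ∞]`, with the operator norm of the real derivative. -/
def supGrad (τ : ℂ → ℂ) : ℝ≥0∞ := ⨆ u, ‖fderiv ℝ τ u‖ₑ

end

end RotDCF

namespace RotDCF

/-! ### Bessel functions -/

/-- The `k`-th coefficient of `besselG n`. -/
noncomputable def besselCoeff (n k : ℕ) : ℝ :=
  (-1) ^ k / ((k.factorial : ℝ) * ((n + k).factorial : ℝ))

/-- The entire function `G_n` with `J_n(x) = (x/2)^n G_n(x²/4)`. -/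
noncomputable def besselG (n : ℕ) (y : ℝ) : ℝ := ∑' k : ℕ, besselCoeff n k * y ^ k

lemma abs_besselCoeff_le (n k : ℕ) : |besselCoeff n k| ≤ 1 / k.factorial := by
  rw [besselCoeff, abs_div, abs_pow, abs_neg, abs_one, one_pow, abs_of_pos (by positivity)]
  gcongr
  have : (1 : ℝ) ≤ (n + k).factorial := by exact_mod_cast Nat.factorial_pos _
  nlinarith [(by positivity : (0 : ℝ) < k.factorial)]

lemma abs_besselCoeff_mul_le (n k : ℕ) : |besselCoeff n k| * k ≤ 1 / k.factorial := by
  rw [besselCoeff, abs_div, abs_pow, abs_neg, abs_one, one_pow, abs_of_pos (by positivity),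
    div_mul_eq_mul_div, one_mul, div_le_div_iff₀ (by positivity) (by positivity), one_mul]
  have : (k : ℝ) ≤ (n + k).factorial := by
    exact_mod_cast (Nat.self_le_factorial k).trans (Nat.factorial_le (Nat.le_add_left k n))
  nlinarith [(by positivity : (0 : ℝ) < k.factorial)]

lemma summable_besselG (n : ℕ) (y : ℝ) : Summable fun k => besselCoeff n k * y ^ k := by
  refine Summable.of_norm_bounded (Real.summable_pow_div_factorial |y|) fun k => ?_
  rw [Real.norm_eq_abs, abs_mul, abs_pow, div_eq_mul_one_div, mul_comm]
  gcongr
  exact abs_besselCoeff_le n k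

lemma besselCoeff_succ_mul (n k : ℕ) :
    besselCoeff n (k + 1) * (k + 1 : ℕ) = -besselCoeff (n + 1) k := by
  simp only [besselCoeff, Nat.factorial_succ, pow_succ, show n + (k + 1) = n + 1 + k by ring]
  push_cast
  field_simp

lemma hasDerivAt_besselG (n : ℕ) (y : ℝ) : HasDerivAt (besselG n) (-besselG (n + 1) y) y := by
  have key : HasDerivAt (fun z => ∑' k, besselCoeff n k * z ^ k)
      (∑' k, besselCoeff n k * (k * y ^ (k - 1))) y := by
    refine hasDerivAt_tsum_of_isPreconnected (t := Metric.ball (0 : ℝ) (|y| + 1))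
      (g' := fun (k : ℕ) z => besselCoeff n k * (k * z ^ (k - 1)))
      (Real.summable_pow_div_factorial (|y| + 1)) Metric.isOpen_ball
      (convex_ball _ _).isPreconnected (fun k z _ => (hasDerivAt_pow k z).const_mul _) ?_
      (y₀ := y) ?_ (summable_besselG n y) ?_
    · intro k z hz
      have hz' : |z| ≤ |y| + 1 := by simpa using (Metric.mem_ball.1 hz).le
      rw [Real.norm_eq_abs, abs_mul, abs_mul, abs_pow, Nat.abs_cast, ← mul_assoc,
        div_eq_mul_one_div, mul_comm ((|y| + 1) ^ k)]
      refine mul_le_mul (abs_besselCoeff_mul_le n k) ?_ (by positivity) (by positivity)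
      calc |z| ^ (k - 1) ≤ (|y| + 1) ^ (k - 1) := by gcongr
        _ ≤ (|y| + 1) ^ k := pow_le_pow_right₀ (by linarith [abs_nonneg y]) (Nat.sub_le k 1)
    · simp
    · simp
  refine HasDerivAt.congr_deriv key ?_
  have hs : Summable fun k : ℕ => besselCoeff n k * (k * y ^ (k - 1)) := by
    rw [← summable_nat_add_iff 1]
    refine (summable_besselG (n + 1) y).neg.congr fun k => ?_
    rw [← mul_assoc, besselCoeff_succ_mul, Nat.add_sub_cancel, neg_mul]
  rw [hs.tsum_eq_zero_add, besselG, ← tsum_neg]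
  simp only [Nat.cast_zero, zero_mul, mul_zero, zero_add]
  refine tsum_congr fun k => ?_
  rw [← mul_assoc, besselCoeff_succ_mul, Nat.add_sub_cancel, neg_mul]

lemma besselG_recurrence (n : ℕ) (y : ℝ) :
    besselG n y = (n + 1) * besselG (n + 1) y - y * besselG (n + 2) y := by
  have h1 := (summable_besselG (n + 1) y).mul_left ((n : ℝ) + 1)
  have h2 := h1.sub (summable_besselG n y)
  have : (n + 1) * besselG (n + 1) y - besselG n y = y * besselG (n + 2) y := by
    rw [besselG, ← tsum_mul_left, besselG, ← h1.tsum_sub (summable_besselG n y),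
      h2.tsum_eq_zero_add, besselG, ← tsum_mul_left]
    have h0 : ((n : ℝ) + 1) * (besselCoeff (n + 1) 0 * y ^ 0) - besselCoeff n 0 * y ^ 0 = 0 := by
      simp only [besselCoeff, add_zero, Nat.factorial_succ, Nat.factorial_zero]
      push_cast
      field_simp
      simp
    rw [h0, zero_add]
    refine tsum_congr fun k => ?_
    simp only [besselCoeff, Nat.factorial_succ, show n + (k + 1) = n + k + 1 by ring,
      show n + 1 + (k + 1) = n + k + 1 + 1 by ring, show n + 2 + k = n + k + 1 + 1 by ring,
      pow_succ]
    push_cast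
    field_simp
    ring
  linarith

lemma besselJ_eq (n : ℕ) (x : ℝ) : besselJ n x = (x / 2) ^ n * besselG n (x ^ 2 / 4) := by
  rw [besselJ, besselG, ← tsum_mul_left]
  refine tsum_congr fun k => ?_
  rw [besselCoeff, pow_add, pow_mul, show (x / 2) ^ 2 = x ^ 2 / 4 by ring]
  ring

/-- The derivative of `besselJ n`. -/
noncomputable def besselD : ℕ → ℝ → ℝ
  | 0, x => -besselJ 1 x
  | n + 1, x => (besselJ n x - besselJ (n + 2) x) / 2

/-- The function `n J_n(x) / x`, without its removable singularity. -/
noncomputable def besselP (n : ℕ) (x : ℝ) : ℝ := besselD n x + besselJ (n + 1) x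

lemma besselJ_recurrence (n : ℕ) (x : ℝ) :
    x * (besselJ n x + besselJ (n + 2) x) = 2 * (n + 1) * besselJ (n + 1) x := by
  simp only [besselJ_eq]
  rw [besselG_recurrence n (x ^ 2 / 4)]
  ring

lemma hasDerivAt_besselJ (n : ℕ) (x : ℝ) : HasDerivAt (besselJ n) (besselD n x) x := by
  have h1 : HasDerivAt (fun x : ℝ => x ^ 2 / 4) (x / 2) x := by
    refine ((hasDerivAt_pow 2 x).div_const 4).congr_deriv ?_
    norm_num
    ring
  have h2 : HasDerivAt (fun x : ℝ => (x / 2) ^ n) (n * (x / 2) ^ (n - 1) * (1 / 2)) x :=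
    ((hasDerivAt_id x).div_const 2).pow n
  have h3 := h2.mul ((hasDerivAt_besselG n (x ^ 2 / 4)).comp x h1)
  have h4 : besselJ n = fun x => (x / 2) ^ n * besselG n (x ^ 2 / 4) :=
    funext fun x => besselJ_eq n x
  rw [h4]
  refine h3.congr_deriv ?_
  cases n with
  | zero =>
    simp [besselD, besselJ_eq]
    ring
  | succ n =>
    simp only [besselD, besselJ_eq, Function.comp, Nat.add_sub_cancel]
    rw [besselG_recurrence n (x ^ 2 / 4)]
    push_cast
    ring

lemma continuous_besselJ (n : ℕ) : Continuous (besselJ n) :=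
  continuous_iff_continuousAt.2 fun x => (hasDerivAt_besselJ n x).continuousAt

lemma continuous_besselG (n : ℕ) : Continuous (besselG n) :=
  continuous_iff_continuousAt.2 fun x => (hasDerivAt_besselG n x).continuousAt

lemma contDiff_besselG (n : ℕ) : ContDiff ℝ 1 (besselG n) := by
  rw [contDiff_one_iff_deriv]
  refine ⟨fun x => (hasDerivAt_besselG n x).differentiableAt, ?_⟩
  rw [show deriv (besselG n) = fun x => -besselG (n + 1) x from
    funext fun x => (hasDerivAt_besselG n x).deriv]
  exact (continuous_besselG _).neg

lemma continuous_besselD (n : ℕ) : Continuous (besselD n) := by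
  cases n with
  | zero => exact (continuous_besselJ 1).neg
  | succ n => exact ((continuous_besselJ n).sub (continuous_besselJ (n + 2))).div_const 2

lemma continuous_besselP (n : ℕ) : Continuous (besselP n) :=
  (continuous_besselD n).add (continuous_besselJ (n + 1))

lemma besselP_zero (x : ℝ) : besselP 0 x = 0 := by simp [besselP, besselD]

lemma mul_besselP (n : ℕ) (x : ℝ) : x * besselP n x = n * besselJ n x := by
  cases n with
  | zero => simp [besselP_zero]
  | succ n =>
    have := besselJ_recurrence n x
    simp only [besselP, besselD]
    push_cast
    linarith

lemma hasDerivAt_mul_besselD (n : ℕ) (x : ℝ) :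
    HasDerivAt (fun x => x * besselD n x) (n * besselP n x - x * besselJ n x) x := by
  have h : (fun x => x * besselD n x) = fun x => n * besselJ n x - x * besselJ (n + 1) x := by
    funext y
    have := mul_besselP n y
    simp only [besselP] at this
    linarith
  rw [h]
  refine (((hasDerivAt_besselJ n x).const_mul (n : ℝ)).sub
    ((hasDerivAt_id x).mul (hasDerivAt_besselJ (n + 1) x))).congr_deriv ?_
  have := besselJ_recurrence n x
  simp only [besselP, besselD, id]
  linarith

/-- Green's identity for the radial parts of two Dirichlet eigenfunctions of the disk. -/
lemma bessel_green (n : ℕ) (R S : ℝ) (hS : besselJ n S = 0) :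
    ∫ r in (0 : ℝ)..1, (R * besselD n (R * r) * (S * besselD n (S * r))
        + R * besselP n (R * r) * (S * besselP n (S * r))) * r
      = R ^ 2 * ∫ r in (0 : ℝ)..1, besselJ n (R * r) * besselJ n (S * r) * r := by
  have cJ := continuous_besselJ n
  have cD := continuous_besselD n
  have cP := continuous_besselP n
  have hd : ∀ r : ℝ, HasDerivAt (fun r => (R * r) * besselD n (R * r) * besselJ n (S * r))
      ((n * besselP n (R * r) - (R * r) * besselJ n (R * r)) * R * besselJ n (S * r)
        + (R * r) * besselD n (R * r) * (besselD n (S * r) * S)) r := fun r => by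
    have hR : HasDerivAt (fun r : ℝ => R * r) R r := by
      simpa using (hasDerivAt_id r).const_mul R
    have hS : HasDerivAt (fun r : ℝ => S * r) S r := by
      simpa using (hasDerivAt_id r).const_mul S
    exact ((hasDerivAt_mul_besselD n (R * r)).comp r hR).mul
      ((hasDerivAt_besselJ n (S * r)).comp r hS)
  have h := intervalIntegral.integral_eq_sub_of_hasDerivAt (a := 0) (b := 1)
    (fun r _ => hd r) ((by fun_prop : Continuous _).intervalIntegrable _ _)
  simp only [mul_one, hS, mul_zero, zero_mul, sub_zero] at h
  have hc1 : Continuous fun r : ℝ => (R * besselD n (R * r) * (S * besselD n (S * r))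
        + R * besselP n (R * r) * (S * besselP n (S * r))) * r := by fun_prop
  have hc2 : Continuous fun r : ℝ => R ^ 2 * (besselJ n (R * r) * besselJ n (S * r) * r) := by
    fun_prop
  rw [← sub_eq_zero, ← intervalIntegral.integral_const_mul,
    ← intervalIntegral.integral_sub (hc1.intervalIntegrable _ _) (hc2.intervalIntegrable _ _)]
  refine Eq.trans (intervalIntegral.integral_congr fun r _ => ?_) h
  have := mul_besselP n (S * r)
  linear_combination R * besselP n (R * r) * this

lemma bessel_green_eq_zero (n : ℕ) {R S : ℝ} (hR : besselJ n R = 0) (hS : besselJ n S = 0)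
    (hR0 : 0 < R) (hS0 : 0 < S) (hRS : R ≠ S) :
    ∫ r in (0 : ℝ)..1, (R * besselD n (R * r) * (S * besselD n (S * r))
        + R * besselP n (R * r) * (S * besselP n (S * r))) * r = 0 := by
  have h1 := bessel_green n R S hS
  have h2 := bessel_green n S R hR
  have h3 : ∀ r : ℝ, (S * besselD n (S * r) * (R * besselD n (R * r))
        + S * besselP n (S * r) * (R * besselP n (R * r))) * r
      = (R * besselD n (R * r) * (S * besselD n (S * r))
        + R * besselP n (R * r) * (S * besselP n (S * r))) * r := fun r => by ring
  have h4 : ∀ r : ℝ, besselJ n (S * r) * besselJ n (R * r) * r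
      = besselJ n (R * r) * besselJ n (S * r) * r := fun r => by ring
  simp only [h3, h4] at h2
  rw [h1] at h2 ⊢
  have h5 : R ^ 2 - S ^ 2 ≠ 0 := by
    rw [sq_sub_sq]
    exact mul_ne_zero (by linarith) (sub_ne_zero.2 hRS)
  have h6 := mul_eq_zero.1 (show (R ^ 2 - S ^ 2) *
    (∫ r in (0 : ℝ)..1, besselJ n (R * r) * besselJ n (S * r) * r) = 0 by linarith)
  rw [h6.resolve_left h5, mul_zero]

/-! ### The real Fourier basis -/

/-- The constant `c_m` with `φ_m(β) = Re (c_m exp (i |m| β))`. -/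
noncomputable def fourierConst (m : ℤ) : ℂ :=
  if m = 0 then 1 else if 0 < m then (√2 : ℝ) else -((√2 : ℝ) * Complex.I)

lemma fourierReal_eq (m : ℤ) (β : S1) :
    fourierReal m β = (fourierConst m * fourier (m.natAbs : ℤ) β).re := by
  rcases lt_trichotomy m 0 with h | rfl | h
  · have h1 : (m.natAbs : ℤ) = -m := by omega
    simp [fourierReal, fourierConst, h.ne, h.not_gt, h1]
  · simp [fourierReal, fourierConst]
  · have h1 : (m.natAbs : ℤ) = m := by omega
    simp [fourierReal, fourierConst, h.ne', h, h1]

lemma continuous_fourierReal (m : ℤ) : Continuous (fourierReal m) := by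
  have : fourierReal m = fun β => (fourierConst m * fourier (m.natAbs : ℤ) β).re :=
    funext (fourierReal_eq m)
  rw [this]
  fun_prop

lemma integral_fourier (n : ℤ) : ∫ β : S1, fourier n β ∂dS1 = if n = 0 then (1 : ℂ) else 0 := by
  have h := congrFun (fourierCoeff_fourier (T := 2 * π) n) 0
  simp only [fourierCoeff, neg_zero, fourier_zero, one_smul] at h
  rw [h, Pi.single_apply]
  simp [eq_comm]

lemma re_mul_re (z w : ℂ) :
    z.re * w.re = ((z * w).re + (z * (starRingEnd ℂ) w).re) / 2 := by
  simp [Complex.mul_re]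

lemma integral_fourierReal_mul (m k : ℤ) :
    ∫ β : S1, fourierReal m β * fourierReal k β ∂dS1 = if m = k then 1 else 0 := by
  have hi : ∀ n : ℤ, ∀ c : ℂ, Integrable (fun β : S1 => c * fourier n β) dS1 := fun n c =>
    ((by fun_prop : Continuous fun β : S1 => c * fourier n β).integrable_of_hasCompactSupport
      (HasCompactSupport.of_compactSpace _))
  have hI : ∀ n : ℤ, ∀ c : ℂ, ∫ β : S1, (c * fourier n β).re ∂dS1 = (if n = 0 then c else 0).re := by
    intro n c
    have := integral_re (hi n c)
    simp only [RCLike.re_eq_complex_re] at this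
    rw [this, integral_const_mul, integral_fourier]
    split_ifs <;> simp
  have h : ∀ β : S1, fourierReal m β * fourierReal k β
      = (fourierConst m * fourierConst k * fourier ((m.natAbs : ℤ) + k.natAbs) β).re / 2
        + (fourierConst m * (starRingEnd ℂ) (fourierConst k)
            * fourier ((m.natAbs : ℤ) + -k.natAbs) β).re / 2 := fun β => by
    rw [fourierReal_eq, fourierReal_eq, re_mul_re, fourier_add, fourier_add, fourier_neg, map_mul,
      add_div]
    ring_nf
  simp_rw [h]
  have hr : ∀ n : ℤ, ∀ c : ℂ, Integrable (fun β : S1 => (c * fourier n β).re / 2) dS1 :=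
    fun n c => (hi n c).re.div_const 2
  rw [integral_add (hr _ _) (hr _ _), integral_div, integral_div,
    hI, hI]
  have h2 : (√2 : ℂ) * √2 = 2 := by
    rw [← Complex.ofReal_mul, Real.mul_self_sqrt (by norm_num)]
    norm_num
  by_cases hmk : m = k
  · subst hmk
    rcases lt_trichotomy m 0 with hm | rfl | hm
    · have h1 : ¬ ((m.natAbs : ℤ) + m.natAbs = 0) := by omega
      rw [if_neg h1, if_pos (by ring), if_pos rfl]
      simp [fourierConst, hm.ne, hm.not_gt]
    · norm_num [fourierConst]
    · have h1 : ¬ ((m.natAbs : ℤ) + m.natAbs = 0) := by omega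
      rw [if_neg h1, if_pos (by ring), if_pos rfl]
      simp [fourierConst, hm.ne', hm]
  · have h1 : ¬ ((m.natAbs : ℤ) + k.natAbs = 0) := by omega
    rw [if_neg h1, if_neg hmk]
    split_ifs with h3
    · rcases lt_trichotomy m 0 with hm | rfl | hm
      · have hk : 0 < k := by omega
        simp [fourierConst, hm.ne, hm.not_gt, hk.ne', hk]
      · omega
      · have hk : k < 0 := by omega
        simp [fourierConst, hm.ne', hm, hk.ne, hk.not_gt]
    · simp

lemma intervalIntegral_fourierReal_mul (m k : ℤ) :
    ∫ θ in (-π)..π, fourierReal m (θ : S1) * fourierReal k (θ : S1)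
      = if m = k then 2 * π else 0 := by
  have h := AddCircle.intervalIntegral_preimage (2 * π) (-π)
    (fun β => fourierReal m β * fourierReal k β)
  rw [show -π + 2 * π = π by ring] at h
  have h2 := integral_fourierReal_mul m k
  rw [AddCircle.integral_haarAddCircle, smul_eq_mul, inv_mul_eq_iff_eq_mul₀ Real.two_pi_pos.ne'] at h2
  rw [h, h2]
  split_ifs <;> simp

lemma fourierReal_coe (m : ℤ) (θ : ℝ) :
    fourierReal m (θ : S1) = (fourierConst m * Complex.exp (θ * Complex.I) ^ m.natAbs).re := by
  rw [fourierReal_eq, fourier_coe_apply, ← Complex.exp_nat_mul]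
  congr 3
  have : (π : ℂ) ≠ 0 := by exact_mod_cast Real.pi_ne_zero
  rw [Int.cast_natCast]
  push_cast
  field_simp

lemma hasDerivAt_fourierReal (m : ℤ) (θ : ℝ) :
    HasDerivAt (fun θ : ℝ => fourierReal m (θ : S1)) (-m * fourierReal (-m) (θ : S1)) θ := by
  have h1 : HasDerivAt (fun z : ℂ => fourierConst m * Complex.exp (m.natAbs * (z * Complex.I)))
      (fourierConst m * (Complex.exp (m.natAbs * (θ * Complex.I))
        * (m.natAbs * (1 * Complex.I)))) (θ : ℂ) :=
    ((((hasDerivAt_id (θ : ℂ)).mul_const Complex.I).const_mul _).cexp).const_mul _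
  have h2 := h1.real_of_complex
  have h3 : (fun θ : ℝ => fourierReal m (θ : S1))
      = fun θ : ℝ => (fourierConst m * Complex.exp (m.natAbs * (θ * Complex.I))).re := by
    funext x
    rw [fourierReal_coe, ← Complex.exp_nat_mul]
  rw [h3]
  refine h2.congr_deriv ?_
  rw [fourierReal_coe, ← Complex.exp_nat_mul, Int.natAbs_neg]
  generalize Complex.exp (m.natAbs * (θ * Complex.I)) = e
  rcases lt_trichotomy m 0 with hm | rfl | hm
  · have h1 : |(m : ℝ)| = -m := abs_of_neg (Int.cast_lt_zero.2 hm)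
    simp [fourierConst, hm.ne, hm.not_gt, hm, h1]
    ring
  · simp
  · have h1 : |(m : ℝ)| = m := abs_of_pos (Int.cast_pos.2 hm)
    simp [fourierConst, hm.ne', hm.not_gt, hm, h1]
    ring

/-! ### Gradients of Fourier-Bessel expansions on the unit disk -/

/-- The normalizing constant of `psi k`. -/
noncomputable def psiConst (k : FBIndex) : ℝ :=
  (√(2 * ∫ r in (0 : ℝ)..1, besselJ k.1.1.natAbs (k.1.2 * r) ^ 2 * r))⁻¹

/-- The smooth extension of `psi k` from the unit disk to the plane. -/
noncomputable def psiSmooth (k : FBIndex) (v : ℂ) : ℝ :=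
  psiConst k * ((k.1.2 / 2) ^ k.1.1.natAbs * besselG k.1.1.natAbs (k.1.2 ^ 2 / 4 * ‖v‖ ^ 2))
    * (fourierConst k.1.1 * v ^ k.1.1.natAbs).re

lemma psiConst_sq_mul_le (k : FBIndex) :
    psiConst k ^ 2 * ∫ r in (0 : ℝ)..1, besselJ k.1.1.natAbs (k.1.2 * r) ^ 2 * r ≤ 1 / 2 := by
  set I := ∫ r in (0 : ℝ)..1, besselJ k.1.1.natAbs (k.1.2 * r) ^ 2 * r with hI
  have h0 : 0 ≤ I := intervalIntegral.integral_nonneg zero_le_one fun r hr =>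
    mul_nonneg (sq_nonneg _) hr.1
  rw [psiConst, ← hI, inv_pow, Real.sq_sqrt (by positivity)]
  rcases h0.eq_or_lt with h | h
  · rw [← h]; norm_num
  · rw [mul_inv, mul_assoc, inv_mul_cancel₀ h.ne']; norm_num

lemma psiSmooth_polar (k : FBIndex) (r θ : ℝ) :
    psiSmooth k (r * Complex.exp (θ * Complex.I))
      = psiConst k * besselJ k.1.1.natAbs (k.1.2 * r) * fourierReal k.1.1 (θ : S1) := by
  have h1 : ‖(r : ℂ) * Complex.exp (θ * Complex.I)‖ ^ 2 = r ^ 2 := by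
    rw [norm_mul, Complex.norm_exp_ofReal_mul_I, mul_one, Complex.norm_real, Real.norm_eq_abs,
      sq_abs]
  rw [psiSmooth, h1, besselJ_eq, fourierReal_coe, mul_pow, ← Complex.ofReal_pow,
    mul_left_comm (fourierConst _), Complex.re_ofReal_mul]
  ring_nf

lemma psi_eq_psiSmooth (k : FBIndex) {v : ℂ} (hv : ‖v‖ ≤ 1) : psi k v = psiSmooth k v := by
  conv_rhs => rw [← Complex.norm_mul_exp_arg_mul_I v, psiSmooth_polar]
  rw [psi, if_pos hv]
  rfl

lemma psiSmooth_eq_zero (k : FBIndex) {v : ℂ} (hv : ‖v‖ = 1) : psiSmooth k v = 0 := by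
  rw [← Complex.norm_mul_exp_arg_mul_I v, psiSmooth_polar, hv, mul_one, k.2.2]
  simp

lemma psi_eq_zero (k : FBIndex) {v : ℂ} (hv : 1 ≤ ‖v‖) : psi k v = 0 := by
  rcases hv.eq_or_lt with h | h
  · rw [psi_eq_psiSmooth k h.ge, psiSmooth_eq_zero k h.symm]
  · rw [psi, if_neg h.not_ge]

lemma contDiff_psiSmooth (k : FBIndex) : ContDiff ℝ 1 (psiSmooth k) := by
  have h1 : ContDiff ℝ 1 fun v : ℂ => ‖v‖ ^ 2 := contDiff_norm_sq ℝ
  have h2 : ContDiff ℝ 1 fun v : ℂ => (fourierConst k.1.1 * v ^ k.1.1.natAbs).re :=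
    Complex.reCLM.contDiff.comp (contDiff_const.mul (contDiff_id.pow _))
  exact (contDiff_const.mul (contDiff_const.mul
    ((contDiff_besselG _).comp (contDiff_const.mul h1)))).mul h2

/-- The smooth extension of the finite expansion `∑_{k ∈ s} b_k ψ_k`. -/
noncomputable def expansion (s : Finset FBIndex) (b : FBIndex → ℝ) (v : ℂ) : ℝ :=
  ∑ k ∈ s, b k * psiSmooth k v

lemma contDiff_expansion (s : Finset FBIndex) (b : FBIndex → ℝ) :
    ContDiff ℝ 1 (expansion s b) :=
  ContDiff.sum fun k _ => contDiff_const.mul (contDiff_psiSmooth k)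

/-- The radial derivative of `expansion s b` in polar coordinates. -/
noncomputable def radialDeriv (s : Finset FBIndex) (b : FBIndex → ℝ) (p : ℝ × ℝ) : ℝ :=
  ∑ k ∈ s, b k * psiConst k * (k.1.2 * besselD k.1.1.natAbs (k.1.2 * p.1))
    * fourierReal k.1.1 (p.2 : S1)

/-- The angular derivative of `expansion s b` in polar coordinates, divided by the radius. -/
noncomputable def angularDeriv (s : Finset FBIndex) (b : FBIndex → ℝ) (p : ℝ × ℝ) : ℝ :=
  ∑ k ∈ s, b k * psiConst k * (k.1.2 * besselP k.1.1.natAbs (k.1.2 * p.1))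
    * (-(k.1.1.sign : ℝ)) * fourierReal (-k.1.1) (p.2 : S1)

lemma continuous_radialDeriv (s : Finset FBIndex) (b : FBIndex → ℝ) :
    Continuous (radialDeriv s b) := by
  refine continuous_finsetSum _ fun k _ => ?_
  have h1 := continuous_besselD k.1.1.natAbs
  have h2 : Continuous fun p : ℝ × ℝ => fourierReal k.1.1 (p.2 : S1) :=
    (continuous_fourierReal _).comp ((AddCircle.continuous_mk' _).comp continuous_snd)
  fun_prop

lemma continuous_angularDeriv (s : Finset FBIndex) (b : FBIndex → ℝ) :
    Continuous (angularDeriv s b) := by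
  refine continuous_finsetSum _ fun k _ => ?_
  have h1 := continuous_besselP k.1.1.natAbs
  have h2 : Continuous fun p : ℝ × ℝ => fourierReal (-k.1.1) (p.2 : S1) :=
    (continuous_fourierReal _).comp ((AddCircle.continuous_mk' _).comp continuous_snd)
  fun_prop

lemma fderiv_expansion_radial (s : Finset FBIndex) (b : FBIndex → ℝ) (r θ : ℝ) :
    fderiv ℝ (expansion s b) (r * Complex.exp (θ * Complex.I)) (Complex.exp (θ * Complex.I))
      = radialDeriv s b (r, θ) := by
  have h1 : HasDerivAt (fun r : ℝ => (r : ℂ) * Complex.exp (θ * Complex.I))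
      (Complex.exp (θ * Complex.I)) r := by
    simpa using (Complex.ofRealCLM.hasDerivAt (x := r)).mul_const (Complex.exp (θ * Complex.I))
  have h2 := ((((contDiff_expansion s b).differentiable one_ne_zero)
    (r * Complex.exp (θ * Complex.I))).hasFDerivAt).comp_hasDerivAt r h1
  refine h2.unique ?_
  have h3 : (expansion s b ∘ fun r : ℝ => (r : ℂ) * Complex.exp (θ * Complex.I))
      = fun r : ℝ => ∑ k ∈ s, b k * (psiConst k * besselJ k.1.1.natAbs (k.1.2 * r)
          * fourierReal k.1.1 (θ : S1)) := by
    funext r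
    simp only [Function.comp, expansion, psiSmooth_polar]
  rw [h3]
  refine HasDerivAt.fun_sum fun k _ => ?_
  have h4 : HasDerivAt (fun r : ℝ => k.1.2 * r) k.1.2 r := by
    simpa using (hasDerivAt_id r).const_mul k.1.2
  refine (((((hasDerivAt_besselJ k.1.1.natAbs (k.1.2 * r)).comp r h4).const_mul
    (psiConst k)).mul_const _).const_mul (b k)).congr_deriv ?_
  ring

lemma fderiv_expansion_angular (s : Finset FBIndex) (b : FBIndex → ℝ) {r : ℝ} (hr : r ≠ 0)
    (θ : ℝ) :
    fderiv ℝ (expansion s b) (r * Complex.exp (θ * Complex.I))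
      (Complex.I * Complex.exp (θ * Complex.I)) = angularDeriv s b (r, θ) := by
  have h1 : HasDerivAt (fun θ : ℝ => (r : ℂ) * Complex.exp (θ * Complex.I))
      (r • (Complex.I * Complex.exp (θ * Complex.I))) θ := by
    refine (((Complex.ofRealCLM.hasDerivAt (x := θ)).mul_const Complex.I).cexp.const_mul
      (r : ℂ)).congr_deriv ?_
    simp only [Complex.ofRealCLM_apply, Complex.real_smul, Complex.ofReal_one]
    ring
  have h2 := ((((contDiff_expansion s b).differentiable one_ne_zero)
    (r * Complex.exp (θ * Complex.I))).hasFDerivAt).comp_hasDerivAt θ h1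
  rw [map_smul, smul_eq_mul] at h2
  refine mul_left_cancel₀ hr (h2.unique ?_)
  have h3 : (expansion s b ∘ fun θ : ℝ => (r : ℂ) * Complex.exp (θ * Complex.I))
      = fun θ : ℝ => ∑ k ∈ s, b k * (psiConst k * besselJ k.1.1.natAbs (k.1.2 * r)
          * fourierReal k.1.1 (θ : S1)) := by
    funext r
    simp only [Function.comp, expansion, psiSmooth_polar]
  rw [h3, angularDeriv, Finset.mul_sum]
  refine HasDerivAt.fun_sum fun k _ => ?_
  refine (((hasDerivAt_fourierReal k.1.1 θ).const_mul _).const_mul (b k)).congr_deriv ?_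
  have h4 := mul_besselP k.1.1.natAbs (k.1.2 * r)
  have h5 : (k.1.1 : ℝ) = k.1.1.sign * k.1.1.natAbs := by
    rw [← Int.cast_natCast k.1.1.natAbs, ← Int.cast_mul, Int.sign_mul_natAbs]
  rw [h5]
  linear_combination (b k * psiConst k * fourierReal (-k.1.1) (θ : S1) * (k.1.1.sign : ℝ)) * h4

lemma norm_sq_le_of_orthogonal (f : ℂ →L[ℝ] ℝ) {e : ℂ} (he : ‖e‖ = 1) :
    ‖f‖ ^ 2 ≤ f e ^ 2 + f (Complex.I * e) ^ 2 := by
  have h0 : 0 ≤ f e ^ 2 + f (Complex.I * e) ^ 2 := by positivity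
  have h : ‖f‖ ≤ √(f e ^ 2 + f (Complex.I * e) ^ 2) := by
    refine f.opNorm_le_bound (Real.sqrt_nonneg _) fun v => ?_
    have he0 : e ≠ 0 := norm_ne_zero_iff.1 (by rw [he]; exact one_ne_zero)
    have hv : v = (v / e).re • e + (v / e).im • (Complex.I * e) := by
      rw [Complex.real_smul, Complex.real_smul, ← mul_assoc, ← add_mul, Complex.re_add_im,
        div_mul_cancel₀ v he0]
    have hn : ‖v‖ ^ 2 = (v / e).re ^ 2 + (v / e).im ^ 2 := by
      have : ‖v‖ = ‖v / e‖ := by rw [norm_div, he, div_one]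
      rw [this, Complex.sq_norm, Complex.normSq_apply]
      ring
    rw [Real.norm_eq_abs]
    refine abs_le_of_sq_le_sq ?_ (by positivity)
    rw [mul_pow, Real.sq_sqrt h0, hn]
    conv_lhs => rw [hv]
    rw [map_add, map_smul, map_smul, smul_eq_mul, smul_eq_mul]
    nlinarith [sq_nonneg ((v / e).re * f (Complex.I * e) - (v / e).im * f e)]
  calc ‖f‖ ^ 2 ≤ √(f e ^ 2 + f (Complex.I * e) ^ 2) ^ 2 := by gcongr
    _ = _ := Real.sq_sqrt h0

lemma integral_sum_fourierReal_sq {ι : Type*} (s : Finset ι) (n : ι → ℤ) (x : ι → ℝ) :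
    ∫ θ in (-π)..π, (∑ k ∈ s, x k * fourierReal (n k) (θ : S1)) ^ 2
      = 2 * π * ∑ k ∈ s, ∑ l ∈ s, if n k = n l then x k * x l else 0 := by
  have hc : ∀ m, Continuous fun θ : ℝ => fourierReal m (θ : S1) := fun m =>
    (continuous_fourierReal m).comp (AddCircle.continuous_mk' _)
  simp_rw [sq, Finset.sum_mul_sum]
  have hi : ∀ k l, IntervalIntegrable (fun θ : ℝ => x k * fourierReal (n k) (θ : S1)
      * (x l * fourierReal (n l) (θ : S1))) volume (-π) π := fun k l =>
    ((continuous_const.mul (hc _)).mul (continuous_const.mul (hc _))).intervalIntegrable _ _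
  have hi2 : ∀ k, IntervalIntegrable (fun θ : ℝ => ∑ l ∈ s, x k * fourierReal (n k) (θ : S1)
      * (x l * fourierReal (n l) (θ : S1))) volume (-π) π := fun k =>
    (continuous_finsetSum _ fun l _ => (continuous_const.mul (hc _)).mul
      (continuous_const.mul (hc _))).intervalIntegrable _ _
  rw [intervalIntegral.integral_finsetSum fun k _ => hi2 k, Finset.mul_sum]
  refine Finset.sum_congr rfl fun k _ => ?_
  rw [intervalIntegral.integral_finsetSum fun l _ => hi k l, Finset.mul_sum]
  refine Finset.sum_congr rfl fun l _ => ?_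
  have : ∀ θ : ℝ, x k * fourierReal (n k) (θ : S1) * (x l * fourierReal (n l) (θ : S1))
      = x k * x l * (fourierReal (n k) (θ : S1) * fourierReal (n l) (θ : S1)) := fun θ => by ring
  simp_rw [this]
  rw [intervalIntegral.integral_const_mul, intervalIntegral_fourierReal_mul]
  split_ifs <;> ring

lemma integral_radial_energy_pair (b : FBIndex → ℝ) (k l : FBIndex) :
    ∫ r in (0 : ℝ)..1, ((if k.1.1 = l.1.1 then
        b k * psiConst k * (k.1.2 * besselD k.1.1.natAbs (k.1.2 * r))
          * (b l * psiConst l * (l.1.2 * besselD l.1.1.natAbs (l.1.2 * r))) else 0)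
      + (if -k.1.1 = -l.1.1 then
        b k * psiConst k * (k.1.2 * besselP k.1.1.natAbs (k.1.2 * r)) * (-(k.1.1.sign : ℝ))
          * (b l * psiConst l * (l.1.2 * besselP l.1.1.natAbs (l.1.2 * r)) * (-(l.1.1.sign : ℝ)))
          else 0)) * r
      = if k = l then b k ^ 2 * k.mu * (psiConst k ^ 2
          * ∫ r in (0 : ℝ)..1, besselJ k.1.1.natAbs (k.1.2 * r) ^ 2 * r) else 0 := by
  by_cases hn : k.1.1 = l.1.1
  · have hsign : ∀ x : ℝ, (k.1.1.sign : ℝ) ^ 2 * besselP k.1.1.natAbs x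
        = besselP k.1.1.natAbs x := fun x => by
      by_cases h0 : k.1.1 = 0
      · simp [h0, besselP_zero]
      · have : k.1.1.sign ^ 2 = 1 := by
          rcases lt_or_gt_of_ne h0 with h | h
          · simp [Int.sign_eq_neg_one_of_neg h]
          · simp [Int.sign_eq_one_of_pos h]
        rw [show (k.1.1.sign : ℝ) ^ 2 = ((k.1.1.sign ^ 2 : ℤ) : ℝ) by push_cast; rfl, this]
        simp
    have hint : ∀ r : ℝ, ((if k.1.1 = l.1.1 then
        b k * psiConst k * (k.1.2 * besselD k.1.1.natAbs (k.1.2 * r))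
          * (b l * psiConst l * (l.1.2 * besselD l.1.1.natAbs (l.1.2 * r))) else 0)
      + (if -k.1.1 = -l.1.1 then
        b k * psiConst k * (k.1.2 * besselP k.1.1.natAbs (k.1.2 * r)) * (-(k.1.1.sign : ℝ))
          * (b l * psiConst l * (l.1.2 * besselP l.1.1.natAbs (l.1.2 * r)) * (-(l.1.1.sign : ℝ)))
          else 0)) * r
      = b k * psiConst k * (b l * psiConst l)
        * ((k.1.2 * besselD k.1.1.natAbs (k.1.2 * r) * (l.1.2 * besselD k.1.1.natAbs (l.1.2 * r))
        + k.1.2 * besselP k.1.1.natAbs (k.1.2 * r)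
          * (l.1.2 * besselP k.1.1.natAbs (l.1.2 * r))) * r) := fun r => by
      rw [if_pos hn, if_pos (congrArg _ hn), ← hn]
      linear_combination (b k * psiConst k * (b l * psiConst l) * k.1.2 * l.1.2 * r
        * besselP k.1.1.natAbs (l.1.2 * r)) * hsign (k.1.2 * r)
    simp_rw [hint]
    rw [intervalIntegral.integral_const_mul]
    split_ifs with hkl
    · subst hkl
      rw [bessel_green _ _ _ k.2.2]
      simp_rw [← sq, FBIndex.mu]
      ring
    · have hR : k.1.2 ≠ l.1.2 := fun h => hkl (Subtype.ext (Prod.ext hn h))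
      rw [bessel_green_eq_zero _ k.2.2 (hn ▸ l.2.2) k.2.1 l.2.1 hR, mul_zero]
  · have hkl : k ≠ l := fun h => hn (by rw [h])
    simp [hn, hkl]

/-- The Dirichlet energy of a finite Fourier-Bessel expansion, in polar coordinates. -/
lemma integral_polar_energy_le (s : Finset FBIndex) (b : FBIndex → ℝ) :
    ∫ r in (0 : ℝ)..1, ∫ θ in (-π)..π,
      (radialDeriv s b (r, θ) ^ 2 + angularDeriv s b (r, θ) ^ 2) * r
      ≤ π * ∑ k ∈ s, k.mu * b k ^ 2 := by
  have hin : ∀ r : ℝ, ∫ θ in (-π)..π,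
      (radialDeriv s b (r, θ) ^ 2 + angularDeriv s b (r, θ) ^ 2) * r
      = 2 * π * ∑ k ∈ s, ∑ l ∈ s, ((if k.1.1 = l.1.1 then
        b k * psiConst k * (k.1.2 * besselD k.1.1.natAbs (k.1.2 * r))
          * (b l * psiConst l * (l.1.2 * besselD l.1.1.natAbs (l.1.2 * r))) else 0)
      + (if -k.1.1 = -l.1.1 then
        b k * psiConst k * (k.1.2 * besselP k.1.1.natAbs (k.1.2 * r)) * (-(k.1.1.sign : ℝ))
          * (b l * psiConst l * (l.1.2 * besselP l.1.1.natAbs (l.1.2 * r)) * (-(l.1.1.sign : ℝ)))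
          else 0)) * r := fun r => by
    have c1 := continuous_radialDeriv s b
    have c2 := continuous_angularDeriv s b
    rw [intervalIntegral.integral_mul_const, intervalIntegral.integral_add
      ((by fun_prop : Continuous fun θ : ℝ => radialDeriv s b (r, θ) ^ 2).intervalIntegrable _ _)
      ((by fun_prop : Continuous fun θ : ℝ => angularDeriv s b (r, θ) ^ 2).intervalIntegrable _ _)]
    simp only [radialDeriv, angularDeriv]
    rw [integral_sum_fourierReal_sq s (fun k => k.1.1), integral_sum_fourierReal_sq s
      (fun k => -k.1.1), ← mul_add, ← Finset.sum_add_distrib]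
    simp_rw [← Finset.sum_add_distrib, Finset.mul_sum, Finset.sum_mul]
    refine Finset.sum_congr rfl fun k _ => Finset.sum_congr rfl fun l _ => ?_
    ring
  simp_rw [hin]
  have hi : ∀ k l : FBIndex, Continuous fun r : ℝ => ((if k.1.1 = l.1.1 then
        b k * psiConst k * (k.1.2 * besselD k.1.1.natAbs (k.1.2 * r))
          * (b l * psiConst l * (l.1.2 * besselD l.1.1.natAbs (l.1.2 * r))) else 0)
      + (if -k.1.1 = -l.1.1 then
        b k * psiConst k * (k.1.2 * besselP k.1.1.natAbs (k.1.2 * r)) * (-(k.1.1.sign : ℝ))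
          * (b l * psiConst l * (l.1.2 * besselP l.1.1.natAbs (l.1.2 * r)) * (-(l.1.1.sign : ℝ)))
          else 0)) * r := fun k l => by
    have h1 := continuous_besselD k.1.1.natAbs
    have h2 := continuous_besselD l.1.1.natAbs
    have h3 := continuous_besselP k.1.1.natAbs
    have h4 := continuous_besselP l.1.1.natAbs
    split_ifs <;> fun_prop
  rw [intervalIntegral.integral_const_mul, intervalIntegral.integral_finsetSum fun k _ =>
    (continuous_finsetSum _ fun l _ => hi k l).intervalIntegrable _ _]
  simp_rw [intervalIntegral.integral_finsetSum fun l _ => (hi _ l).intervalIntegrable _ _,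
    integral_radial_energy_pair, Finset.sum_ite_eq]
  rw [mul_comm 2 π, mul_assoc]
  refine mul_le_mul_of_nonneg_left ?_ Real.pi_pos.le
  rw [Finset.mul_sum]
  refine Finset.sum_le_sum fun k hk => ?_
  rw [if_pos hk]
  have h := psiConst_sq_mul_le k
  have h2 : 0 ≤ k.mu * b k ^ 2 := mul_nonneg (sq_nonneg _) (sq_nonneg _)
  nlinarith

/-! ### Changes of variables and Cauchy-Schwarz for lower integrals -/

lemma lintegral_mul_sq_le {X : Type*} [MeasurableSpace X] {μ : Measure X} {f g : X → ℝ≥0∞}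
    (hf : AEMeasurable f μ) (hg : AEMeasurable g μ) :
    (∫⁻ x, f x * g x ∂μ) ^ 2 ≤ (∫⁻ x, f x ^ 2 ∂μ) * ∫⁻ x, g x ^ 2 ∂μ := by
  have h := ENNReal.lintegral_mul_le_Lp_mul_Lq μ Real.HolderConjugate.two_two hf hg
  simp only [Pi.mul_apply, ENNReal.rpow_two] at h
  calc (∫⁻ x, f x * g x ∂μ) ^ 2
      ≤ ((∫⁻ x, f x ^ 2 ∂μ) ^ (1 / 2 : ℝ) * (∫⁻ x, g x ^ 2 ∂μ) ^ (1 / 2 : ℝ)) ^ 2 := by gcongr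
    _ = _ := by
      rw [mul_pow, ← ENNReal.rpow_two, ← ENNReal.rpow_two, ← ENNReal.rpow_mul,
        ← ENNReal.rpow_mul]
      norm_num

lemma lintegral_sq_le_measure_mul {X : Type*} [MeasurableSpace X] {μ : Measure X} {f : X → ℝ≥0∞}
    (hf : AEMeasurable f μ) :
    (∫⁻ x, f x ∂μ) ^ 2 ≤ μ Set.univ * ∫⁻ x, f x ^ 2 ∂μ := by
  have h := lintegral_mul_sq_le (f := fun _ => 1) aemeasurable_const hf
  simpa using h

lemma volume_preimage_le_of_antilipschitz {g : ℂ → ℂ} {K : NNReal} (hg : AntilipschitzWith K g)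
    (s : Set ℂ) : volume (g ⁻¹' s) ≤ (K : ℝ≥0∞) ^ 2 * volume s := by
  have h2 : Module.finrank ℝ ℂ = 2 := Complex.finrank_real_complex
  have hH : Measure.IsAddHaarMeasure (μH[(2 : ℕ)] : Measure ℂ) :=
    h2 ▸ isAddHaarMeasure_hausdorffMeasure (E := ℂ)
  rw [Measure.isAddLeftInvariant_eq_smul (volume : Measure ℂ) (μH[(2 : ℕ)] : Measure ℂ)]
  simp only [Measure.smul_apply]
  have h := hg.hausdorffMeasure_preimage_le (d := ((2 : ℕ) : ℝ)) (by norm_num) s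
  rw [ENNReal.rpow_natCast] at h
  rw [mul_smul_comm]
  gcongr

lemma map_volume_le_of_antilipschitz {g : ℂ → ℂ} {K : NNReal} (hg : AntilipschitzWith K g)
    (hm : Measurable g) : (volume : Measure ℂ).map g ≤ ((K : ℝ≥0∞) ^ 2) • volume := by
  refine Measure.le_iff.2 fun s hs => ?_
  rw [Measure.map_apply hm hs]
  exact volume_preimage_le_of_antilipschitz hg s

lemma lintegral_comp_le_of_antilipschitz {g : ℂ → ℂ} {K : NNReal} (hg : AntilipschitzWith K g)
    (hm : Measurable g) {f : ℂ → ℝ≥0∞} (hf : Measurable f) :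
    ∫⁻ v, f (g v) ≤ (K : ℝ≥0∞) ^ 2 * ∫⁻ v, f v := by
  rw [← lintegral_map hf hm, ← smul_eq_mul, ← lintegral_smul_measure]
  exact lintegral_mono' (map_volume_le_of_antilipschitz hg hm) le_rfl

/-! ### Increments of finite Fourier-Bessel expansions -/

/-- The size of the gradient of `expansion s b` inside the unit disk, and zero outside. -/
noncomputable def gradENorm (s : Finset FBIndex) (b : FBIndex → ℝ) (v : ℂ) : ℝ≥0∞ :=
  (Metric.ball (0 : ℂ) 1).indicator (fun v => ‖fderiv ℝ (expansion s b) v‖ₑ) v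

lemma measurable_gradENorm (s : Finset FBIndex) (b : FBIndex → ℝ) :
    Measurable (gradENorm s b) :=
  Measurable.indicator
    (((contDiff_expansion s b).continuous_fderiv one_ne_zero).enorm.measurable)
    Metric.isOpen_ball.measurableSet

lemma lintegral_gradENorm_sq_le (s : Finset FBIndex) (b : FBIndex → ℝ) :
    ∫⁻ v, gradENorm s b v ^ 2 ≤ ENNReal.ofReal (π * ∑ k ∈ s, k.mu * b k ^ 2) := by
  set H : ℝ × ℝ → ℝ := fun p => (radialDeriv s b p ^ 2 + angularDeriv s b p ^ 2) * p.1 with hH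
  have hHc : Continuous H :=
    (((continuous_radialDeriv s b).pow 2).add ((continuous_angularDeriv s b).pow 2)).mul
      continuous_fst
  have hpt : ∀ p ∈ polarCoord.target,
      ENNReal.ofReal p.1 • gradENorm s b (Complex.polarCoord.symm p) ^ 2
      ≤ (Set.Ioc (0 : ℝ) 1 ×ˢ Set.Ioc (-π) π).indicator (fun p => ENNReal.ofReal (H p)) p := by
    rintro ⟨r, θ⟩ ⟨hr, hθ⟩
    simp only [Set.mem_Ioi] at hr
    have hv : Complex.polarCoord.symm (r, θ) = r * Complex.exp (θ * Complex.I) := by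
      rw [Complex.polarCoord_symm_apply, Complex.exp_mul_I]
      simp
    have hnorm : ‖(r : ℂ) * Complex.exp (θ * Complex.I)‖ = r := by
      rw [norm_mul, Complex.norm_exp_ofReal_mul_I, mul_one, Complex.norm_real, Real.norm_eq_abs,
        abs_of_pos hr]
    rw [hv, gradENorm]
    by_cases h1 : r < 1
    · rw [Set.indicator_of_mem (by rwa [Metric.mem_ball, dist_zero_right, hnorm]),
        Set.indicator_of_mem (show (r, θ) ∈ Set.Ioc (0 : ℝ) 1 ×ˢ Set.Ioc (-π) π from
          ⟨⟨hr, h1.le⟩, ⟨hθ.1, hθ.2.le⟩⟩)]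
      rw [← ofReal_norm, ← ENNReal.ofReal_pow (norm_nonneg _), smul_eq_mul,
        ← ENNReal.ofReal_mul hr.le]
      refine ENNReal.ofReal_le_ofReal ?_
      rw [mul_comm]
      refine mul_le_mul_of_nonneg_right ?_ hr.le
      rw [← fderiv_expansion_radial, ← fderiv_expansion_angular s b hr.ne']
      exact norm_sq_le_of_orthogonal _ (Complex.norm_exp_ofReal_mul_I θ)
    · rw [Set.indicator_of_notMem (by rwa [Metric.mem_ball, dist_zero_right, hnorm])]
      simp
  have hmeas : MeasurableSet polarCoord.target := polarCoord.open_target.measurableSet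
  have hbox : MeasurableSet (Set.Ioc (0 : ℝ) 1 ×ˢ Set.Ioc (-π) π) :=
    measurableSet_Ioc.prod measurableSet_Ioc
  have hint : IntegrableOn H (Set.Ioc (0 : ℝ) 1 ×ˢ Set.Ioc (-π) π) (volume.prod volume) :=
    (hHc.continuousOn.integrableOn_compact (isCompact_Icc.prod isCompact_Icc)).mono_set
      (Set.prod_mono Set.Ioc_subset_Icc_self Set.Ioc_subset_Icc_self)
  calc ∫⁻ v, gradENorm s b v ^ 2
      = ∫⁻ p in polarCoord.target,
          ENNReal.ofReal p.1 • gradENorm s b (Complex.polarCoord.symm p) ^ 2 :=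
        (Complex.lintegral_comp_polarCoord_symm _).symm
    _ ≤ ∫⁻ p in polarCoord.target,
          (Set.Ioc (0 : ℝ) 1 ×ˢ Set.Ioc (-π) π).indicator (fun p => ENNReal.ofReal (H p)) p :=
        setLIntegral_mono' hmeas hpt
    _ ≤ ∫⁻ p, (Set.Ioc (0 : ℝ) 1 ×ˢ Set.Ioc (-π) π).indicator
          (fun p => ENNReal.ofReal (H p)) p := setLIntegral_le_lintegral _ _
    _ = ∫⁻ p in Set.Ioc (0 : ℝ) 1 ×ˢ Set.Ioc (-π) π, ENNReal.ofReal (H p) :=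
        lintegral_indicator hbox _
    _ = ENNReal.ofReal (∫ p in Set.Ioc (0 : ℝ) 1 ×ˢ Set.Ioc (-π) π, H p) := by
        refine (ofReal_integral_eq_lintegral_ofReal hint ?_).symm
        exact (ae_restrict_mem hbox).mono fun p hp =>
          mul_nonneg (by positivity) hp.1.1.le
    _ ≤ _ := by
        refine ENNReal.ofReal_le_ofReal (le_of_eq_of_le ?_ (integral_polar_energy_le s b))
        rw [Measure.volume_eq_prod, setIntegral_prod _ hint,
          intervalIntegral.integral_of_le zero_le_one]
        refine integral_congr_ae (ae_of_all _ fun r => ?_)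
        simp only
        rw [intervalIntegral.integral_of_le (by linarith [Real.pi_pos])]

lemma lintegral_gradENorm_le (s : Finset FBIndex) (b : FBIndex → ℝ) :
    ∫⁻ v, gradENorm s b v ≤ ENNReal.ofReal (π * √(∑ k ∈ s, k.mu * b k ^ 2)) := by
  have h0 : 0 ≤ ∑ k ∈ s, k.mu * b k ^ 2 :=
    Finset.sum_nonneg fun k _ => mul_nonneg (sq_nonneg _) (sq_nonneg _)
  have hb : MeasurableSet (Metric.ball (0 : ℂ) 1) := Metric.isOpen_ball.measurableSet
  have h1 : ∫⁻ v, gradENorm s b v = ∫⁻ v in Metric.ball (0 : ℂ) 1, gradENorm s b v := by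
    rw [← lintegral_indicator hb]
    refine lintegral_congr fun v => ?_
    by_cases hv : v ∈ Metric.ball (0 : ℂ) 1 <;> simp only [gradENorm, Set.indicator, hv, if_true,
      if_false]
  have h2 : (∫⁻ v, gradENorm s b v) ^ 2
      ≤ ENNReal.ofReal (π * √(∑ k ∈ s, k.mu * b k ^ 2)) ^ 2 := by
    rw [h1]
    refine (lintegral_sq_le_measure_mul (measurable_gradENorm s b).aemeasurable).trans ?_
    rw [Measure.restrict_apply_univ, Complex.volume_ball, ENNReal.ofReal_one, one_pow, one_mul,
      ← ENNReal.ofReal_pow (by positivity), mul_pow, Real.sq_sqrt h0, sq, mul_assoc,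
      ENNReal.ofReal_mul Real.pi_pos.le]
    have : (NNReal.pi : ℝ≥0∞) = ENNReal.ofReal π := by
      rw [← NNReal.coe_real_pi, ENNReal.ofReal_coe_nnreal]
    rw [this]
    gcongr
    exact (setLIntegral_le_lintegral _ _).trans (lintegral_gradENorm_sq_le s b)
  exact (ENNReal.pow_le_pow_left_iff two_ne_zero).1 h2

/-- The finite Fourier-Bessel expansion on the unit disk, extended by zero. -/
noncomputable def truncExpansion (s : Finset FBIndex) (b : FBIndex → ℝ) (v : ℂ) : ℝ :=
  ∑ k ∈ s, b k * psi k v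

lemma truncExpansion_of_le (s : Finset FBIndex) (b : FBIndex → ℝ) {v : ℂ} (hv : ‖v‖ ≤ 1) :
    truncExpansion s b v = expansion s b v :=
  Finset.sum_congr rfl fun k _ => by rw [psi_eq_psiSmooth k hv]

lemma truncExpansion_of_ge (s : Finset FBIndex) (b : FBIndex → ℝ) {v : ℂ} (hv : 1 ≤ ‖v‖) :
    truncExpansion s b v = 0 :=
  Finset.sum_eq_zero fun k _ => by rw [psi_eq_zero k hv, mul_zero]

lemma continuous_truncExpansion (s : Finset FBIndex) (b : FBIndex → ℝ) :
    Continuous (truncExpansion s b) := by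
  have h : truncExpansion s b = fun v => if ‖v‖ ≤ 1 then expansion s b v else 0 := by
    funext v
    split_ifs with hv
    · exact truncExpansion_of_le s b hv
    · exact truncExpansion_of_ge s b (not_le.1 hv).le
  rw [h]
  refine (contDiff_expansion s b).continuous.if_le continuous_const continuous_norm
    continuous_const fun v hv => ?_
  rw [← truncExpansion_of_le s b hv.le, truncExpansion_of_ge s b hv.ge]

lemma finite_setOf_norm_add_smul_eq (z : ℂ) {h : ℂ} (hh : h ≠ 0) (R : ℝ) :
    {s : ℝ | ‖z + s • h‖ = R}.Finite := by
  open Polynomial in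
  set p : ℝ[X] := C (‖h‖ ^ 2) * X ^ 2 + C (2 * inner ℝ z h) * X + C (‖z‖ ^ 2 - R ^ 2) with hp
  have hp0 : p ≠ 0 := fun h0 => by
    have := Polynomial.leadingCoeff_quadratic (R := ℝ) (b := 2 * inner ℝ z h)
      (c := ‖z‖ ^ 2 - R ^ 2) (pow_ne_zero 2 (norm_ne_zero_iff.2 hh))
    rw [← hp, h0, Polynomial.leadingCoeff_zero] at this
    exact pow_ne_zero 2 (norm_ne_zero_iff.2 hh) this.symm
  refine (Polynomial.finite_setOfPred_isRoot hp0).subset fun s hs => ?_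
  have h1 : ‖z + s • h‖ ^ 2 = R ^ 2 := by rw [show ‖z + s • h‖ = R from hs]
  rw [norm_add_sq_real, inner_smul_right, norm_smul, mul_pow, Real.norm_eq_abs, sq_abs] at h1
  simp only [Set.mem_ofPred_eq, Polynomial.IsRoot, hp, Polynomial.eval_add, Polynomial.eval_mul,
    Polynomial.eval_C, Polynomial.eval_pow, Polynomial.eval_X]
  linarith

lemma enorm_truncExpansion_sub_le (s : Finset FBIndex) (b : FBIndex → ℝ) (z h : ℂ) :
    ‖truncExpansion s b (z + h) - truncExpansion s b z‖ₑ
      ≤ ∫⁻ t in Set.Ioc (0 : ℝ) 1, ‖h‖ₑ * gradENorm s b (z + t • h) := by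
  rcases eq_or_ne h 0 with rfl | hh
  · simp
  set F := expansion s b
  have hF := contDiff_expansion s b
  have hline : Continuous fun t : ℝ => z + t • h := by fun_prop
  set φ' : ℝ → ℝ := {t : ℝ | ‖z + t • h‖ < 1}.indicator fun t => fderiv ℝ F (z + t • h) h with hφ'
  have hopen : IsOpen {t : ℝ | ‖z + t • h‖ < 1} := isOpen_lt hline.norm continuous_const
  have hopen' : IsOpen {t : ℝ | 1 < ‖z + t • h‖} := isOpen_lt continuous_const hline.norm
  have hder : ∀ t : ℝ, t ∉ {t : ℝ | ‖z + t • h‖ = 1} →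
      HasDerivAt (fun t : ℝ => truncExpansion s b (z + t • h)) (φ' t) t := by
    intro t ht
    rcases lt_or_gt_of_ne (show ‖z + t • h‖ ≠ 1 from ht) with h1 | h1
    · have hl : HasDerivAt (fun t : ℝ => z + t • h) h t := by
        simpa using ((hasDerivAt_id t).smul_const h).const_add z
      rw [hφ', Set.indicator_of_mem (by exact h1)]
      refine (((hF.differentiable one_ne_zero) (z + t • h)).hasFDerivAt.comp_hasDerivAt t
        hl).congr_of_eventuallyEq ?_
      filter_upwards [hopen.mem_nhds h1] with x hx
      exact truncExpansion_of_le s b (le_of_lt hx)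
    · rw [hφ', Set.indicator_of_notMem (by exact not_lt.2 (le_of_lt h1))]
      refine (hasDerivAt_const t (0 : ℝ)).congr_of_eventuallyEq ?_
      filter_upwards [hopen'.mem_nhds h1] with x hx
      exact truncExpansion_of_ge s b (le_of_lt hx)
  have hcont : Continuous fun t : ℝ => fderiv ℝ F (z + t • h) h :=
    ((hF.continuous_fderiv one_ne_zero).comp hline).clm_apply continuous_const
  have hint : IntervalIntegrable φ' volume 0 1 := by
    rw [intervalIntegrable_iff]
    exact (intervalIntegrable_iff.1 (hcont.intervalIntegrable 0 1)).indicator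
      hopen.measurableSet
  have key := MeasureTheory.integral_eq_of_hasDerivAt_off_countable
    (fun t : ℝ => truncExpansion s b (z + t • h)) φ' (a := 0) (b := 1)
    (finite_setOf_norm_add_smul_eq z hh 1).countable
    ((continuous_truncExpansion s b).comp hline).continuousOn (fun t ht => hder t ht.2) hint
  simp only [one_smul, zero_smul, add_zero] at key
  rw [← key, intervalIntegral.integral_of_le zero_le_one]
  refine (enorm_integral_le_lintegral_enorm _).trans (lintegral_mono fun t => ?_)
  by_cases h1 : ‖z + t • h‖ < 1
  · rw [hφ', gradENorm, Set.indicator_of_mem (by exact h1),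
      Set.indicator_of_mem (by rwa [Metric.mem_ball, dist_zero_right]), mul_comm]
    exact (fderiv ℝ F (z + t • h)).le_opENorm h
  · rw [hφ', Set.indicator_of_notMem (by exact h1)]
    simp

/-- The maps `T₀ + s (T₁ - T₀)`, `0 ≤ s ≤ 1`, are all antilipschitz with constant `K`, and `T₁` is
`δ`-close to `T₀` wherever one of them takes values in the disk of radius `1 / c`. -/
structure IsDeformation (c : ℝ) (K : NNReal) (δ : ℝ≥0∞) (T₀ T₁ : ℂ → ℂ) : Prop where
  cont₀ : Continuous T₀
  cont₁ : Continuous T₁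
  antilipschitz : ∀ s ∈ Set.Icc (0 : ℝ) 1, AntilipschitzWith K fun v => T₀ v + s • (T₁ v - T₀ v)
  close : ∀ s ∈ Set.Icc (0 : ℝ) 1, ∀ v, c * ‖T₀ v + s • (T₁ v - T₀ v)‖ < 1 → ‖T₁ v - T₀ v‖ₑ ≤ δ

lemma IsDeformation.antilipschitz₀ {c : ℝ} {K : NNReal} {δ : ℝ≥0∞} {T₀ T₁ : ℂ → ℂ}
    (h : IsDeformation c K δ T₀ T₁) : AntilipschitzWith K T₀ := by
  simpa using h.antilipschitz 0 (by simp)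

lemma IsDeformation.antilipschitz₁ {c : ℝ} {K : NNReal} {δ : ℝ≥0∞} {T₀ T₁ : ℂ → ℂ}
    (h : IsDeformation c K δ T₀ T₁) : AntilipschitzWith K T₁ := by
  simpa using h.antilipschitz 1 (by simp)

lemma IsDeformation.smul {c : ℝ} (hc : 0 < c) {K : NNReal} {δ : ℝ≥0∞} {T₀ T₁ : ℂ → ℂ}
    (h : IsDeformation c K δ T₀ T₁) :
    IsDeformation 1 (K * (Real.toNNReal c)⁻¹) (ENNReal.ofReal c * δ) (fun v => c • T₀ v)
      (fun v => c • T₁ v) := by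
  have e : ∀ s : ℝ, ∀ v, c • T₀ v + s • (c • T₁ v - c • T₀ v)
      = c • (T₀ v + s • (T₁ v - T₀ v)) := fun s v => by
    rw [smul_add, smul_comm c s, smul_sub c]
  refine ⟨h.cont₀.const_smul c, h.cont₁.const_smul c, fun s hs => ?_, fun s hs v hv => ?_⟩
  · simp_rw [e]
    refine AntilipschitzWith.of_le_mul_dist fun x y => ?_
    have h1 := (h.antilipschitz s hs).le_mul_dist x y
    rw [dist_smul₀, Real.norm_of_nonneg hc.le]
    refine h1.trans_eq ?_
    push_cast
    rw [Real.coe_toNNReal c hc.le]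
    field_simp
  · rw [e, norm_smul, Real.norm_of_nonneg hc.le, one_mul] at hv
    rw [← smul_sub, enorm_smul, Real.enorm_of_nonneg hc.le]
    gcongr
    exact h.close s hs v hv

lemma lintegral_truncExpansion_sub_le (s : Finset FBIndex) (b : FBIndex → ℝ) {K : NNReal}
    {δ : ℝ≥0∞} {T₀ T₁ : ℂ → ℂ} (h : IsDeformation 1 K δ T₀ T₁) :
    ∫⁻ v, ‖truncExpansion s b (T₁ v) - truncExpansion s b (T₀ v)‖ₑ
      ≤ δ * K ^ 2 * ∫⁻ v, gradENorm s b v := by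
  have c0 := h.cont₀
  have c1 := h.cont₁
  have hg := measurable_gradENorm s b
  have hm : Measurable fun p : ℂ × ℝ => δ * gradENorm s b (T₀ p.1 + p.2 • (T₁ p.1 - T₀ p.1)) :=
    (hg.comp (by fun_prop : Continuous fun p : ℂ × ℝ =>
      T₀ p.1 + p.2 • (T₁ p.1 - T₀ p.1)).measurable).const_mul δ
  calc ∫⁻ v, ‖truncExpansion s b (T₁ v) - truncExpansion s b (T₀ v)‖ₑ
      ≤ ∫⁻ v, ∫⁻ t in Set.Ioc (0 : ℝ) 1, δ * gradENorm s b (T₀ v + t • (T₁ v - T₀ v)) := by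
        refine lintegral_mono fun v => ?_
        have h1 := enorm_truncExpansion_sub_le s b (T₀ v) (T₁ v - T₀ v)
        rw [add_sub_cancel] at h1
        refine h1.trans (setLIntegral_mono' measurableSet_Ioc fun t ht => ?_)
        by_cases hb : ‖T₀ v + t • (T₁ v - T₀ v)‖ < 1
        · gcongr
          exact h.close t (Set.Ioc_subset_Icc_self ht) v (by rwa [one_mul])
        · have : gradENorm s b (T₀ v + t • (T₁ v - T₀ v)) = 0 := by
            rw [gradENorm, Set.indicator_of_notMem (by rwa [Metric.mem_ball, dist_zero_right])]
          rw [this, mul_zero, mul_zero]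
    _ = ∫⁻ t in Set.Ioc (0 : ℝ) 1, ∫⁻ v, δ * gradENorm s b (T₀ v + t • (T₁ v - T₀ v)) :=
        lintegral_lintegral_swap hm.aemeasurable
    _ ≤ ∫⁻ t in Set.Ioc (0 : ℝ) 1, δ * K ^ 2 * ∫⁻ v, gradENorm s b v := by
        refine setLIntegral_mono' measurableSet_Ioc fun t ht => ?_
        have hT : Measurable fun v => T₀ v + t • (T₁ v - T₀ v) :=
          (by fun_prop : Continuous fun v => T₀ v + t • (T₁ v - T₀ v)).measurable
        have hgT : Measurable fun v => gradENorm s b (T₀ v + t • (T₁ v - T₀ v)) := hg.comp hT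
        rw [lintegral_const_mul _ hgT, mul_assoc]
        gcongr
        exact lintegral_comp_le_of_antilipschitz
          (h.antilipschitz t (Set.Ioc_subset_Icc_self ht)) hT hg
    _ = _ := by simp

lemma psiScaled_eq (j : ℝ) (k : FBIndex) (v : ℂ) :
    psiScaled j k v = ((2 : ℝ) ^ (-j)) ^ 2 * psi k ((2 : ℝ) ^ (-j) • v) := by
  rw [psiScaled, ← Real.rpow_mul_natCast (by norm_num)]
  congr 2
  push_cast
  ring

lemma sum_psiScaled_eq (j : ℝ) (s : Finset FBIndex) (b : FBIndex → ℝ) (v : ℂ) :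
    ∑ k ∈ s, b k * psiScaled j k v
      = ((2 : ℝ) ^ (-j)) ^ 2 * truncExpansion s b ((2 : ℝ) ^ (-j) • v) := by
  rw [truncExpansion, Finset.mul_sum]
  exact Finset.sum_congr rfl fun k _ => by rw [psiScaled_eq]; ring

lemma continuous_psiScaled (j : ℝ) (k : FBIndex) : Continuous (psiScaled j k) := by
  have h : psiScaled j k = fun v => ((2 : ℝ) ^ (-j)) ^ 2
      * truncExpansion {k} (fun _ => 1) ((2 : ℝ) ^ (-j) • v) := by
    funext v
    rw [← sum_psiScaled_eq]
    simp
  rw [h]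
  exact continuous_const.mul ((continuous_truncExpansion _ _).comp (continuous_const_smul _))

lemma psiScaled_eq_zero (j : ℝ) (k : FBIndex) {v : ℂ} (hv : 1 ≤ (2 : ℝ) ^ (-j) * ‖v‖) :
    psiScaled j k v = 0 := by
  rw [psiScaled_eq, psi_eq_zero, mul_zero]
  rwa [norm_smul, Real.norm_of_nonneg (by positivity)]

lemma lintegral_sum_psiScaled_sub_le (j : ℝ) (s : Finset FBIndex) (b : FBIndex → ℝ) {K : NNReal}
    {δ : ℝ≥0∞} {T₀ T₁ : ℂ → ℂ} (h : IsDeformation ((2 : ℝ) ^ (-j)) K δ T₀ T₁) :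
    ∫⁻ v, ‖∑ k ∈ s, b k * psiScaled j k (T₁ v) - ∑ k ∈ s, b k * psiScaled j k (T₀ v)‖ₑ
      ≤ δ * K ^ 2 * ENNReal.ofReal ((2 : ℝ) ^ (-j))
        * ENNReal.ofReal (π * √(∑ k ∈ s, k.mu * b k ^ 2)) := by
  set c : ℝ := (2 : ℝ) ^ (-j) with hc
  have hc0 : 0 < c := by positivity
  simp_rw [sum_psiScaled_eq, ← hc, ← mul_sub, enorm_mul]
  rw [lintegral_const_mul' _ _ (by simp), Real.enorm_of_nonneg (by positivity)]
  have h1 := lintegral_truncExpansion_sub_le s b (h.smul hc0)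
  have hcK : ((K * (Real.toNNReal c)⁻¹ : NNReal) : ℝ≥0∞) = K * (ENNReal.ofReal c)⁻¹ := by
    rw [ENNReal.coe_mul, ENNReal.coe_inv (Real.toNNReal_pos.2 hc0).ne']
    rfl
  have hc1 : ENNReal.ofReal c ≠ 0 := (ENNReal.ofReal_pos.2 hc0).ne'
  have hc2 : ENNReal.ofReal c ≠ ∞ := ENNReal.ofReal_ne_top
  calc ENNReal.ofReal (c ^ 2)
        * ∫⁻ v, ‖truncExpansion s b (c • T₁ v) - truncExpansion s b (c • T₀ v)‖ₑ
      ≤ ENNReal.ofReal (c ^ 2) * (ENNReal.ofReal c * δ * (K * (ENNReal.ofReal c)⁻¹) ^ 2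
          * ENNReal.ofReal (π * √(∑ k ∈ s, k.mu * b k ^ 2))) := by
        rw [← hcK]
        gcongr
        refine h1.trans ?_
        gcongr
        exact lintegral_gradENorm_le s b
    _ = _ := by
        rw [ENNReal.ofReal_pow hc0.le]
        have : ENNReal.ofReal c ^ 2 * (ENNReal.ofReal c)⁻¹ ^ 2 = 1 := by
          rw [← mul_pow, ENNReal.mul_inv_cancel hc1 hc2, one_pow]
        generalize ENNReal.ofReal (π * √(∑ k ∈ s, k.mu * b k ^ 2)) = X
        calc ENNReal.ofReal c ^ 2
              * (ENNReal.ofReal c * δ * (K * (ENNReal.ofReal c)⁻¹) ^ 2 * X)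
            = (ENNReal.ofReal c ^ 2 * (ENNReal.ofReal c)⁻¹ ^ 2)
              * (δ * K ^ 2 * ENNReal.ofReal c * X) := by ring
          _ = _ := by rw [this, one_mul]

/-- The total increment of `W` along every deformation, as a multiple of the constant `A`. -/
def HasDeformationBound (c : ℝ) (A : ℝ≥0∞) (W : ℂ × S1 → ℝ) : Prop :=
  ∀ (K : NNReal) (δ : ℝ≥0∞) (T₀ T₁ : S1 → ℂ → ℂ), Continuous (Function.uncurry T₀) →
    Continuous (Function.uncurry T₁) → (∀ β, IsDeformation c K δ (T₀ β) (T₁ β)) →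
    ∫⁻ β, (∫⁻ v, ‖W (T₁ β v, β) - W (T₀ β v, β)‖ₑ) ∂dS1 ≤ δ * K ^ 2 * ENNReal.ofReal c * A

lemma hasDeformationBound_planar (j : ℝ) (a : FBIndex → ℝ) (s : Finset FBIndex) :
    HasDeformationBound ((2 : ℝ) ^ (-j)) (ENNReal.ofReal π * fbNorm a)
      fun p => ∑ k ∈ s, a k * psiScaled j k p.1 := by
  intro K δ T₀ T₁ _ _ h
  have h0 : ∀ k ∈ s, 0 ≤ k.mu * a k ^ 2 := fun k _ => mul_nonneg (sq_nonneg _) (sq_nonneg _)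
  have hs : ENNReal.ofReal (π * √(∑ k ∈ s, k.mu * a k ^ 2)) ≤ ENNReal.ofReal π * fbNorm a := by
    rw [ENNReal.ofReal_mul Real.pi_pos.le, Real.sqrt_eq_rpow,
      ← ENNReal.ofReal_rpow_of_nonneg (Finset.sum_nonneg h0) (by norm_num),
      ENNReal.ofReal_sum_of_nonneg h0, fbNorm]
    gcongr
    exact ENNReal.sum_le_tsum s
  calc _ ≤ ∫⁻ _ : S1, δ * K ^ 2 * ENNReal.ofReal ((2 : ℝ) ^ (-j))
          * (ENNReal.ofReal π * fbNorm a) ∂dS1 := by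
        refine lintegral_mono fun β => (lintegral_sum_psiScaled_sub_le j s a (h β)).trans ?_
        gcongr
    _ = _ := by simp

open Classical in
lemma hasDeformationBound_joint (j : ℝ) (a : FBIndex × ℤ → ℝ) (s : Finset (FBIndex × ℤ)) :
    HasDeformationBound ((2 : ℝ) ^ (-j)) (ENNReal.ofReal π * fbNormJoint a)
      fun p => ∑ q ∈ s, a q * psiJoint j q p := by
  intro K δ T₀ T₁ _ _ h
  set b : S1 → FBIndex → ℝ := fun β k => ∑ q ∈ s with q.1 = k, a q * fourierReal q.2 β with hb
  have hW : ∀ v β, ∑ q ∈ s, a q * psiJoint j q (v, β)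
      = ∑ k ∈ s.image Prod.fst, b β k * psiScaled j k v := fun v β => by
    rw [← Finset.sum_fiberwise_of_maps_to (g := Prod.fst)
      (fun q hq => Finset.mem_image_of_mem _ hq)]
    refine Finset.sum_congr rfl fun k _ => ?_
    rw [hb, Finset.sum_mul]
    refine Finset.sum_congr rfl fun q hq => ?_
    rw [psiJoint, (Finset.mem_filter.1 hq).2]
    ring
  have hbc : ∀ k, Continuous fun β => b β k := fun k =>
    continuous_finsetSum _ fun q _ => continuous_const.mul (continuous_fourierReal _)
  have hSc : Continuous fun β => ∑ k ∈ s.image Prod.fst, k.mu * b β k ^ 2 :=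
    continuous_finsetSum _ fun k _ => continuous_const.mul ((hbc k).pow 2)
  have hS0 : ∀ β, 0 ≤ ∑ k ∈ s.image Prod.fst, k.mu * b β k ^ 2 := fun β =>
    Finset.sum_nonneg fun k _ => mul_nonneg (sq_nonneg _) (sq_nonneg _)
  have hint : ∀ f : S1 → ℝ, Continuous f → Integrable f dS1 := fun f hf =>
    hf.integrable_of_hasCompactSupport (HasCompactSupport.of_compactSpace _)
  have hbint : ∀ k, ∫ β, b β k ^ 2 ∂dS1 = ∑ q ∈ s with q.1 = k, a q ^ 2 := fun k => by
    simp_rw [hb, sq, Finset.sum_mul_sum]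
    have hc : ∀ q r : FBIndex × ℤ, Continuous fun β =>
        a q * fourierReal q.2 β * (a r * fourierReal r.2 β) := fun q r =>
      (continuous_const.mul (continuous_fourierReal _)).mul
        (continuous_const.mul (continuous_fourierReal _))
    rw [integral_finsetSum _ fun q _ => hint _ (continuous_finsetSum _ fun r _ => hc q r)]
    refine Finset.sum_congr rfl fun q hq => ?_
    rw [integral_finsetSum _ fun r _ => hint _ (hc q r), Finset.sum_eq_single_of_mem q hq]
    · simp_rw [show ∀ β, a q * fourierReal q.2 β * (a q * fourierReal q.2 β)
        = a q * a q * (fourierReal q.2 β * fourierReal q.2 β) from fun β => by ring]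
      rw [integral_const_mul, integral_fourierReal_mul, if_pos rfl, mul_one]
    · intro r hr hrq
      simp_rw [show ∀ β, a q * fourierReal q.2 β * (a r * fourierReal r.2 β)
        = a q * a r * (fourierReal q.2 β * fourierReal r.2 β) from fun β => by ring]
      have : q.2 ≠ r.2 := fun h2 => hrq (Prod.ext
        ((Finset.mem_filter.1 hr).2.trans (Finset.mem_filter.1 hq).2.symm) h2.symm)
      rw [integral_const_mul, integral_fourierReal_mul, if_neg this, mul_zero]
  have hSint : ∫⁻ β, ENNReal.ofReal (∑ k ∈ s.image Prod.fst, k.mu * b β k ^ 2) ∂dS1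
      ≤ ∑' k : FBIndex, ∑' m : ℤ, ENNReal.ofReal (k.mu * a (k, m) ^ 2) := by
    have hki : ∀ k : FBIndex, Integrable (fun β => k.mu * b β k ^ 2) dS1 := fun k =>
      hint _ (continuous_const.mul ((hbc k).pow 2))
    rw [← ofReal_integral_eq_lintegral_ofReal (hint _ hSc) (ae_of_all _ hS0),
      integral_finsetSum _ fun k _ => hki k]
    simp_rw [integral_const_mul, hbint, Finset.mul_sum]
    have e : ∑ k ∈ s.image Prod.fst, ∑ q ∈ s with q.1 = k, k.mu * a q ^ 2
        = ∑ q ∈ s, q.1.mu * a q ^ 2 := by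
      rw [← Finset.sum_fiberwise_of_maps_to (g := Prod.fst) (t := s.image Prod.fst)
        (fun q hq => Finset.mem_image_of_mem _ hq)]
      exact Finset.sum_congr rfl fun k _ => Finset.sum_congr rfl fun q hq => by
        rw [(Finset.mem_filter.1 hq).2]
    have h0 : ∀ q ∈ s, 0 ≤ q.1.mu * a q ^ 2 := fun q _ => mul_nonneg (sq_nonneg _) (sq_nonneg _)
    rw [e, ENNReal.ofReal_sum_of_nonneg h0,
      ← ENNReal.tsum_prod (f := fun k m => ENNReal.ofReal (FBIndex.mu k * a (k, m) ^ 2))]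
    exact ENNReal.sum_le_tsum s
  have hsqrt : ∫⁻ β, ENNReal.ofReal (π * √(∑ k ∈ s.image Prod.fst, k.mu * b β k ^ 2)) ∂dS1
      ≤ ENNReal.ofReal π * fbNormJoint a := by
    simp_rw [ENNReal.ofReal_mul Real.pi_pos.le]
    rw [lintegral_const_mul' _ _ ENNReal.ofReal_ne_top]
    gcongr
    rw [fbNormJoint, ← ENNReal.rpow_le_rpow_iff (z := 2) (by norm_num), ← ENNReal.rpow_mul]
    norm_num
    refine (lintegral_sq_le_measure_mul
      (hSc.sqrt.measurable.ennreal_ofReal.aemeasurable)).trans ?_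
    rw [measure_univ, one_mul]
    refine le_of_eq_of_le (lintegral_congr fun β => ?_) hSint
    rw [← ENNReal.ofReal_pow (Real.sqrt_nonneg _), Real.sq_sqrt (hS0 β)]
  calc _ ≤ ∫⁻ β : S1, δ * K ^ 2 * ENNReal.ofReal ((2 : ℝ) ^ (-j))
          * ENNReal.ofReal (π * √(∑ k ∈ s.image Prod.fst, k.mu * b β k ^ 2)) ∂dS1 := by
        refine lintegral_mono fun β => ?_
        simp only [hW]
        exact lintegral_sum_psiScaled_sub_le j _ _ (h β)
    _ ≤ _ := by
        have hm : Measurable fun β => ENNReal.ofReal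
            (π * √(∑ k ∈ s.image Prod.fst, k.mu * b β k ^ 2)) :=
          (continuous_const.mul hSc.sqrt).measurable.ennreal_ofReal
        rw [lintegral_const_mul _ hm]
        gcongr

/-- What the network analysis uses of a filter: `L¹` size and increments along deformations, both
controlled by `A`, where `c` is the inverse of the radius of the support. -/
structure FilterBound (c : ℝ) (A : ℝ≥0∞) (W : ℂ × S1 → ℝ) : Prop where
  measurable : Measurable W
  memLp : MemLp W 2 dPlaneS1
  integrable : Integrable W dPlaneS1
  lintegral_le : ∫⁻ p, ‖W p‖ₑ ∂dPlaneS1 ≤ A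
  deformation : HasDeformationBound c A W

lemma eLpNorm_two_sq {X : Type*} [MeasurableSpace X] (μ : Measure X) (f : X → ℝ) :
    eLpNorm f 2 μ ^ 2 = ∫⁻ x, ‖f x‖ₑ ^ 2 ∂μ := by
  have h := eLpNorm_nnreal_pow_eq_lintegral (f := f) (μ := μ) (p := 2) two_ne_zero
  simpa using h

lemma lintegral_prod_swapped {f : ℂ × S1 → ℝ≥0∞} (hf : Measurable f) :
    ∫⁻ p, f p ∂dPlaneS1 = ∫⁻ β, (∫⁻ v, f (v, β)) ∂dS1 :=
  lintegral_prod_symm _ hf.aemeasurable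

/-- A filter supported in the disk of radius `1 / c` is moved off itself by a translation, so its
`L¹` norm is controlled by its increments. -/
lemma HasDeformationBound.lintegral_le {c : ℝ} (hc : 0 < c) {A : ℝ≥0∞} {W : ℂ × S1 → ℝ}
    (hm : Measurable W) (h0 : ∀ p : ℂ × S1, 1 ≤ c * ‖p.1‖ → W p = 0)
    (h : HasDeformationBound c A W) : ∫⁻ p, ‖W p‖ₑ ∂dPlaneS1 ≤ A := by
  set w : ℂ := ((2 / c : ℝ) : ℂ) with hw
  have hwn : ‖w‖ = 2 / c := by
    rw [hw, Complex.norm_real, Real.norm_of_nonneg (by positivity)]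
  have hdef : IsDeformation c 1 (ENNReal.ofReal (2 / c)) (fun v => v) fun v => v + w := by
    refine ⟨continuous_id, by fun_prop, fun s _ => ?_, fun s _ v _ => ?_⟩
    · refine AntilipschitzWith.of_le_mul_dist fun x y => ?_
      simp
    · rw [add_sub_cancel_left, ← ofReal_norm, hwn]
  have h1 := h 1 (ENNReal.ofReal (2 / c)) (fun _ v => v) (fun _ v => v + w)
    continuous_snd (continuous_snd.add continuous_const) fun _ => hdef
  have hdisj : ∀ v β, ‖W (v + w, β) - W (v, β)‖ₑ = ‖W (v + w, β)‖ₑ + ‖W (v, β)‖ₑ := by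
    intro v β
    by_cases hv : 1 ≤ c * ‖v‖
    · rw [h0 (v, β) hv, sub_zero, enorm_zero, add_zero]
    · have hvw : 1 ≤ c * ‖v + w‖ := by
        have h2 : ‖w‖ ≤ ‖v + w‖ + ‖v‖ := by
          simpa using norm_sub_le (v + w) v
        have h3 : c * ‖w‖ = 2 := by rw [hwn]; field_simp
        nlinarith
      rw [h0 (v + w, β) hvw, zero_sub, enorm_neg, enorm_zero, zero_add]
  have hmβ : ∀ β, Measurable fun v => ‖W (v, β)‖ₑ := fun β =>
    (hm.comp measurable_prodMk_right).enorm
  have h2 : ∀ β, ∫⁻ v, ‖W (v + w, β) - W (v, β)‖ₑ = 2 * ∫⁻ v, ‖W (v, β)‖ₑ := fun β => by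
    simp_rw [hdisj]
    rw [lintegral_add_right _ (hmβ β), lintegral_add_right_eq_self (fun v => ‖W (v, β)‖ₑ) w,
      two_mul]
  simp_rw [h2] at h1
  have h3 : ENNReal.ofReal (2 / c) * ENNReal.ofReal c = 2 := by
    rw [← ENNReal.ofReal_mul (by positivity), div_mul_cancel₀ _ hc.ne']
    simp
  rw [lintegral_const_mul' _ _ (by simp), ← lintegral_prod_swapped hm.enorm, ENNReal.coe_one,
    one_pow, mul_one, h3] at h1
  exact (ENNReal.mul_le_mul_iff_right (by simp) (by simp)).1 h1

lemma lintegral_comp_deformation_le {K : NNReal} {T : S1 → ℂ → ℂ}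
    (hT : ∀ β, AntilipschitzWith K (T β)) (hc : Continuous (Function.uncurry T))
    {f : ℂ × S1 → ℝ≥0∞} (hf : Measurable f) :
    ∫⁻ β, (∫⁻ v, f (T β v, β)) ∂dS1 ≤ (K : ℝ≥0∞) ^ 2 * ∫⁻ p, f p ∂dPlaneS1 := by
  rw [lintegral_prod_swapped hf, ← lintegral_const_mul' _ _ (by simp)]
  refine lintegral_mono fun β => ?_
  have hTm : Measurable (T β) := (hc.comp (continuous_const.prodMk continuous_id)).measurable
  exact lintegral_comp_le_of_antilipschitz (hT β) hTm
    (f := fun v => f (v, β)) (hf.comp measurable_prodMk_right)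

lemma measurableSet_support (c : ℝ) : MeasurableSet {p : ℂ × S1 | c * ‖p.1‖ < 1} :=
  (isOpen_lt (by fun_prop) continuous_const).measurableSet

lemma measure_support_lt_top {c : ℝ} (hc : 0 < c) :
    dPlaneS1 {p : ℂ × S1 | c * ‖p.1‖ < 1} < ∞ := by
  have h : {p : ℂ × S1 | c * ‖p.1‖ < 1} ⊆ Metric.ball (0 : ℂ) (1 / c) ×ˢ Set.univ := fun p hp => by
    refine ⟨?_, trivial⟩
    rw [Metric.mem_ball, dist_zero_right, lt_div_iff₀ hc, mul_comm]
    exact hp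
  refine (measure_mono h).trans_lt ?_
  rw [Measure.prod_prod, measure_univ, mul_one]
  exact measure_ball_lt_top

/-- Increment bounds pass to `L¹` limits. -/
lemma HasDeformationBound.of_approx {c : ℝ} {A : ℝ≥0∞} {W' : ℂ × S1 → ℝ} (hW'm : Measurable W')
    (hsmall : ∀ ε : ℝ≥0∞, 0 < ε → ∃ V : ℂ × S1 → ℝ, Measurable V ∧ HasDeformationBound c A V ∧
      ∫⁻ p, ‖W' p - V p‖ₑ ∂dPlaneS1 ≤ ε) : HasDeformationBound c A W' := by
  intro K δ T₀ T₁ hT₀ hT₁ h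
  refine ENNReal.le_of_forall_pos_le_add fun ε hε _ => ?_
  set x : ℝ≥0∞ := 2 * (K : ℝ≥0∞) ^ 2 + 1 with hx
  have hx0 : x ≠ 0 := by simp [hx]
  have hxt : x ≠ ∞ := by finiteness
  obtain ⟨V, hVm, hVd, hVI⟩ := hsmall (ε * x⁻¹)
    (ENNReal.mul_pos (by exact_mod_cast hε.ne') (ENNReal.inv_ne_zero.2 hxt))
  have hE : Measurable fun p => ‖W' p - V p‖ₑ := (hW'm.sub hVm).enorm
  have hT₀m : Measurable fun p : S1 × ℂ => (T₀ p.1 p.2, p.1) := hT₀.measurable.prodMk measurable_fst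
  have hT₁m : Measurable fun p : S1 × ℂ => (T₁ p.1 p.2, p.1) := hT₁.measurable.prodMk measurable_fst
  have hE₀ : Measurable fun p : S1 × ℂ => ‖W' (T₀ p.1 p.2, p.1) - V (T₀ p.1 p.2, p.1)‖ₑ :=
    hE.comp hT₀m
  have hE₁ : Measurable fun p : S1 × ℂ => ‖W' (T₁ p.1 p.2, p.1) - V (T₁ p.1 p.2, p.1)‖ₑ :=
    hE.comp hT₁m
  have hE₀v : ∀ β, Measurable fun v => ‖W' (T₀ β v, β) - V (T₀ β v, β)‖ₑ := fun β =>
    hE₀.comp measurable_prodMk_left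
  have hE₁v : ∀ β, Measurable fun v => ‖W' (T₁ β v, β) - V (T₁ β v, β)‖ₑ := fun β =>
    hE₁.comp measurable_prodMk_left
  have hE₀β : Measurable fun β => ∫⁻ v, ‖W' (T₀ β v, β) - V (T₀ β v, β)‖ₑ :=
    hE₀.lintegral_prod_right'
  have hE₁β : Measurable fun β => ∫⁻ v, ‖W' (T₁ β v, β) - V (T₁ β v, β)‖ₑ :=
    hE₁.lintegral_prod_right'
  calc ∫⁻ β, (∫⁻ v, ‖W' (T₁ β v, β) - W' (T₀ β v, β)‖ₑ) ∂dS1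
      ≤ ∫⁻ β, ((∫⁻ v, ‖V (T₁ β v, β) - V (T₀ β v, β)‖ₑ)
          + (∫⁻ v, ‖W' (T₁ β v, β) - V (T₁ β v, β)‖ₑ)
          + ∫⁻ v, ‖W' (T₀ β v, β) - V (T₀ β v, β)‖ₑ) ∂dS1 := by
        refine lintegral_mono fun β => ?_
        rw [← lintegral_add_right _ (hE₁v β),
          ← lintegral_add_right _ (hE₀v β)]
        refine lintegral_mono fun v => ?_
        have e : W' (T₁ β v, β) - W' (T₀ β v, β) = (V (T₁ β v, β) - V (T₀ β v, β))
            + (W' (T₁ β v, β) - V (T₁ β v, β)) - (W' (T₀ β v, β) - V (T₀ β v, β)) := by ring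
        rw [e]
        exact (enorm_sub_le).trans (add_le_add_left (enorm_add_le _ _) _)
    _ = ∫⁻ β, (∫⁻ v, ‖V (T₁ β v, β) - V (T₀ β v, β)‖ₑ) ∂dS1
          + ∫⁻ β, (∫⁻ v, ‖W' (T₁ β v, β) - V (T₁ β v, β)‖ₑ) ∂dS1
          + ∫⁻ β, (∫⁻ v, ‖W' (T₀ β v, β) - V (T₀ β v, β)‖ₑ) ∂dS1 := by
        rw [lintegral_add_right _ hE₀β,
          lintegral_add_right _ hE₁β]
    _ ≤ δ * K ^ 2 * ENNReal.ofReal c * A + K ^ 2 * (ε * x⁻¹) + K ^ 2 * (ε * x⁻¹) := by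
        gcongr
        · exact hVd K δ T₀ T₁ hT₀ hT₁ h
        · refine (lintegral_comp_deformation_le (fun β => (h β).antilipschitz₁) hT₁ hE).trans ?_
          gcongr
        · refine (lintegral_comp_deformation_le (fun β => (h β).antilipschitz₀) hT₀ hE).trans ?_
          gcongr
    _ ≤ δ * K ^ 2 * ENNReal.ofReal c * A + ε := by
        rw [add_assoc]
        gcongr
        calc (K : ℝ≥0∞) ^ 2 * (ε * x⁻¹) + K ^ 2 * (ε * x⁻¹)
            = 2 * (K : ℝ≥0∞) ^ 2 * (ε * x⁻¹) := by ring
          _ ≤ x * (ε * x⁻¹) := by gcongr; exact le_self_add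
          _ = ε * (x * x⁻¹) := by ring
          _ = ε := by rw [ENNReal.mul_inv_cancel hx0 hxt, mul_one]

/-- Increment bounds pass to `L²` limits of filters with a common support. -/
lemma exists_filterBound_of_approx {c : ℝ} (hc : 0 < c) {A : ℝ≥0∞} {W : ℂ × S1 → ℝ}
    (hW : MemLp W 2 dPlaneS1)
    (happ : ∀ η : ℝ≥0∞, 0 < η → ∃ V : ℂ × S1 → ℝ, Measurable V ∧
      (∀ p : ℂ × S1, 1 ≤ c * ‖p.1‖ → V p = 0) ∧ HasDeformationBound c A V ∧
      eLpNorm (fun p => W p - V p) 2 dPlaneS1 ≤ η) :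
    ∃ W' : ℂ × S1 → ℝ, W' =ᵐ[dPlaneS1] W ∧ FilterBound c A W' := by
  set D : Set (ℂ × S1) := {p : ℂ × S1 | c * ‖p.1‖ < 1} with hD
  have hDm : MeasurableSet D := measurableSet_support c
  have hDfin : dPlaneS1 D < ∞ := measure_support_lt_top hc
  set W₀ : ℂ × S1 → ℝ := hW.1.mk W with hW₀
  have hW₀m : Measurable W₀ := hW.1.stronglyMeasurable_mk.measurable
  have hW₀e : W =ᵐ[dPlaneS1] W₀ := hW.1.ae_eq_mk
  have happ₀ : ∀ η : ℝ≥0∞, 0 < η → ∃ V : ℂ × S1 → ℝ, Measurable V ∧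
      (∀ p : ℂ × S1, 1 ≤ c * ‖p.1‖ → V p = 0) ∧ HasDeformationBound c A V ∧
      eLpNorm (fun p => W₀ p - V p) 2 dPlaneS1 ≤ η := fun η hη => by
    obtain ⟨V, h1, h2, h3, h4⟩ := happ η hη
    refine ⟨V, h1, h2, h3, le_of_eq_of_le (eLpNorm_congr_ae ?_) h4⟩
    filter_upwards [hW₀e] with p hp
    rw [hp]
  have hout : Dᶜ.indicator W₀ =ᵐ[dPlaneS1] 0 := by
    rw [← eLpNorm_eq_zero_iff (hW₀m.indicator hDm.compl).aestronglyMeasurable two_ne_zero]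
    refine le_antisymm (le_of_forall_gt fun η hη => ?_) zero_le
    obtain ⟨η', h0, h1⟩ := exists_between hη
    obtain ⟨V, -, hV0, -, hV⟩ := happ₀ η' h0
    have e : Dᶜ.indicator W₀ = Dᶜ.indicator fun p => W₀ p - V p := by
      funext p
      by_cases hp : p ∈ Dᶜ
      · rw [Set.indicator_of_mem hp, Set.indicator_of_mem hp, hV0 p (not_lt.1 hp), sub_zero]
      · rw [Set.indicator_of_notMem hp, Set.indicator_of_notMem hp]
    rw [e]
    exact ((eLpNorm_indicator_le _).trans hV).trans_lt h1
  set W' : ℂ × S1 → ℝ := D.indicator W₀ with hW'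
  have hW'm : Measurable W' := hW₀m.indicator hDm
  have hW'e : W' =ᵐ[dPlaneS1] W := by
    filter_upwards [hout, hW₀e] with p h1 h2
    rw [h2, hW']
    by_cases hp : p ∈ D
    · rw [Set.indicator_of_mem hp]
    · rw [Set.indicator_of_notMem hp]
      rw [Set.indicator_of_mem (show p ∈ Dᶜ from hp)] at h1
      exact h1.symm
  have hW'0 : ∀ p : ℂ × S1, 1 ≤ c * ‖p.1‖ → W' p = 0 := fun p hp =>
    Set.indicator_of_notMem (show p ∉ D from not_lt.2 hp) _
  have hL1 : ∀ V : ℂ × S1 → ℝ, Measurable V → (∀ p : ℂ × S1, 1 ≤ c * ‖p.1‖ → V p = 0) →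
      (∫⁻ p, ‖W' p - V p‖ₑ ∂dPlaneS1) ^ 2
        ≤ dPlaneS1 D * eLpNorm (fun p => W₀ p - V p) 2 dPlaneS1 ^ 2 := by
    intro V hVm hV0
    have e : ∀ p, ‖W' p - V p‖ₑ = D.indicator (fun p => ‖W₀ p - V p‖ₑ) p := fun p => by
      by_cases hp : p ∈ D
      · rw [hW', Set.indicator_of_mem hp, Set.indicator_of_mem hp]
      · rw [hW', Set.indicator_of_notMem hp, Set.indicator_of_notMem hp, hV0 p (not_lt.1 hp),
          sub_zero, enorm_zero]
    simp_rw [e]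
    rw [lintegral_indicator hDm]
    refine (lintegral_sq_le_measure_mul (hW₀m.sub hVm).enorm.aemeasurable).trans ?_
    rw [Measure.restrict_apply_univ, eLpNorm_two_sq]
    exact mul_le_mul_right (setLIntegral_le_lintegral _ _) _
  have hsmall : ∀ ε : ℝ≥0∞, 0 < ε → ∃ V : ℂ × S1 → ℝ, Measurable V ∧
      HasDeformationBound c A V ∧
      ∫⁻ p, ‖W' p - V p‖ₑ ∂dPlaneS1 ≤ ε := by
    intro ε hε
    set m : ℝ≥0∞ := dPlaneS1 D with hm
    have hm0 : m + 1 ≠ 0 := by simp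
    have hmt : m + 1 ≠ ∞ := by finiteness
    obtain ⟨V, hVm, hV0, hVd, hV⟩ := happ₀ (ε * (m + 1)⁻¹)
      (ENNReal.mul_pos hε.ne' (ENNReal.inv_ne_zero.2 hmt))
    refine ⟨V, hVm, hVd, (ENNReal.pow_le_pow_left_iff two_ne_zero).1 ?_⟩
    calc (∫⁻ p, ‖W' p - V p‖ₑ ∂dPlaneS1) ^ 2
        ≤ m * (ε * (m + 1)⁻¹) ^ 2 := (hL1 V hVm hV0).trans (by gcongr)
      _ ≤ (m + 1) ^ 2 * (ε * (m + 1)⁻¹) ^ 2 := by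
          gcongr
          calc m ≤ m + 1 := le_self_add
            _ = (m + 1) * 1 := (mul_one _).symm
            _ ≤ (m + 1) * (m + 1) := by gcongr; exact le_add_self
            _ = (m + 1) ^ 2 := (sq _).symm
      _ = ε ^ 2 * ((m + 1) * (m + 1)⁻¹) ^ 2 := by ring
      _ = ε ^ 2 := by rw [ENNReal.mul_inv_cancel hm0 hmt, one_pow, mul_one]
  have hdef : HasDeformationBound c A W' := .of_approx hW'm hsmall
  refine ⟨W', hW'e, hW'm, hW.ae_eq hW'e.symm, ?_, hdef.lintegral_le hc hW'm hW'0, hdef⟩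
  have : IntegrableOn W' D dPlaneS1 := by
    have : IsFiniteMeasure (dPlaneS1.restrict D) := ⟨by rwa [Measure.restrict_apply_univ]⟩
    exact ((hW.ae_eq hW'e.symm).restrict D).integrable one_le_two
  rw [← integrable_indicator_iff hDm] at this
  rwa [hW', Set.indicator_indicator, Set.inter_self] at this

lemma exists_filterBound_joint (j : ℝ) (a : FBIndex × ℤ → ℝ) {W : ℂ × S1 → ℝ}
    (h : IsL2Expansion dPlaneS1 a (psiJoint j) W) :
    ∃ W' : ℂ × S1 → ℝ, W' =ᵐ[dPlaneS1] W ∧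
      FilterBound ((2 : ℝ) ^ (-j)) (ENNReal.ofReal π * fbNormJoint a) W' := by
  refine exists_filterBound_of_approx (by positivity) h.1 fun η hη => ?_
  obtain ⟨s, hs⟩ := (h.2.eventually (ge_mem_nhds hη)).exists
  have hc : Continuous fun p : ℂ × S1 => ∑ q ∈ s, a q * psiJoint j q p :=
    continuous_finsetSum _ fun q _ => continuous_const.mul
      (((continuous_psiScaled j q.1).comp continuous_fst).mul
        ((continuous_fourierReal q.2).comp continuous_snd))
  refine ⟨_, hc.measurable, fun p hp => ?_, hasDeformationBound_joint j a s, hs⟩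
  exact Finset.sum_eq_zero fun q _ => by rw [psiJoint, psiScaled_eq_zero j q.1 hp]; simp

lemma exists_filterBound_planar (j : ℝ) (a : FBIndex → ℝ) {W : ℂ → ℝ}
    (h : IsL2Expansion volume a (psiScaled j) W) :
    ∃ W' : ℂ × S1 → ℝ, W' =ᵐ[dPlaneS1] (fun p => W p.1) ∧
      FilterBound ((2 : ℝ) ^ (-j)) (ENNReal.ofReal π * fbNorm a) W' := by
  have hfst : MeasurePreserving (Prod.fst : ℂ × S1 → ℂ) dPlaneS1 volume :=
    measurePreserving_fst
  refine exists_filterBound_of_approx (by positivity) (h.1.comp_measurePreserving hfst)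
    fun η hη => ?_
  obtain ⟨s, hs⟩ := (h.2.eventually (ge_mem_nhds hη)).exists
  have hc : Continuous fun v => ∑ k ∈ s, a k * psiScaled j k v :=
    continuous_finsetSum _ fun k _ => continuous_const.mul (continuous_psiScaled j k)
  refine ⟨_, (hc.comp continuous_fst).measurable, fun p hp => ?_,
    hasDeformationBound_planar j a s, ?_⟩
  · exact Finset.sum_eq_zero fun k _ => by rw [psiScaled_eq_zero j k hp, mul_zero]
  · refine le_of_eq_of_le ?_ hs
    exact eLpNorm_comp_measurePreserving (g := fun v => W v - ∑ k ∈ s, a k * psiScaled j k v)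
      (h.1.1.sub hc.aestronglyMeasurable) hfst

/-! ### Rotations -/

lemma rot_sub (t : S1) (v w : ℂ) : rot t (v - w) = rot t v - rot t w := mul_sub _ _ _

lemma rot_add (t : S1) (v w : ℂ) : rot t (v + w) = rot t v + rot t w := mul_add _ _ _

lemma rot_smul (t : S1) (s : ℝ) (v : ℂ) : rot t (s • v) = s • rot t v := mul_smul_comm _ _ _

lemma rot_rot (s t : S1) (v : ℂ) : rot s (rot t v) = rot (s + t) v := by
  simp only [rot, AddCircle.toCircle_add, Circle.coe_mul, mul_assoc]

lemma norm_rot (t : S1) (v : ℂ) : ‖rot t v‖ = ‖v‖ := by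
  rw [rot, norm_mul, Circle.norm_coe, one_mul]

lemma continuous_rot : Continuous fun p : S1 × ℂ => rot p.1 p.2 :=
  (continuous_subtype_val.comp (AddCircle.continuous_toCircle.comp continuous_fst)).mul
    continuous_snd

lemma continuous_rot_comp {X : Type*} [TopologicalSpace X] {f : X → S1} {g : X → ℂ}
    (hf : Continuous f) (hg : Continuous g) : Continuous fun x => rot (f x) (g x) :=
  continuous_rot.comp (hf.prodMk hg)

lemma measurePreserving_rot (t : S1) : MeasurePreserving (rot t) volume volume :=
  (rotation (AddCircle.toCircle t)).measurePreserving

lemma antilipschitz_rot_comp {K : NNReal} {P : ℂ → ℂ} (t : S1) (h : AntilipschitzWith K P) :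
    AntilipschitzWith K fun v => rot t (P v) :=
  AntilipschitzWith.of_le_mul_dist fun x y => by
    rw [dist_eq_norm (rot t (P x)), ← rot_sub, norm_rot, ← dist_eq_norm]
    exact h.le_mul_dist x y

lemma IsDeformation.rot {c : ℝ} {K : NNReal} {δ : ℝ≥0∞} {P₀ P₁ : ℂ → ℂ}
    (h : IsDeformation c K δ P₀ P₁) (t : S1) :
    IsDeformation c K δ (fun v => rot t (P₀ v)) fun v => rot t (P₁ v) := by
  have hc : Continuous fun v => RotDCF.rot t v := continuous_rot_comp (by fun_prop) (by fun_prop)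
  have e : ∀ s : ℝ, ∀ v, RotDCF.rot t (P₀ v) + s • (RotDCF.rot t (P₁ v) - RotDCF.rot t (P₀ v))
      = RotDCF.rot t (P₀ v + s • (P₁ v - P₀ v)) := fun s v => by
    rw [rot_add, rot_smul, rot_sub]
  refine ⟨hc.comp h.cont₀, hc.comp h.cont₁, fun s hs => ?_, fun s hs v hv => ?_⟩
  · simp_rw [e]
    exact antilipschitz_rot_comp t (h.antilipschitz s hs)
  · rw [e, norm_rot] at hv
    rw [← rot_sub, ← ofReal_norm, norm_rot, ofReal_norm]
    exact h.close s hs v hv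

/-! ### Integrals of rotated and translated filters -/

lemma measurable_rot_left {P : ℂ → ℂ} (hP : Continuous P) (α : S1) :
    Measurable fun q : ℂ × S1 => (rot α (P q.1), q.2 - α) :=
  (Continuous.prodMk (continuous_rot_comp (by fun_prop) (by fun_prop)) (by fun_prop)).measurable

lemma measurable_rot_right {P : ℂ → ℂ} (hP : Continuous P) (β : S1) :
    Measurable fun p : ℂ × S1 => (rot p.2 (P p.1), β - p.2) :=
  (Continuous.prodMk (continuous_rot_comp (by fun_prop) (by fun_prop)) (by fun_prop)).measurable

lemma lintegral_rot_left {f : S1 × ℂ → ℂ × S1 → ℝ≥0∞} {α : S1}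
    (hf : Measurable fun q : ℂ × S1 => f (α, q.1) (q.1, q.2 - α)) :
    ∫⁻ q : ℂ × S1, f (α, q.1) (q.1, q.2 - α) ∂dPlaneS1
      = ∫⁻ β, (∫⁻ v, f (α, v) (v, β)) ∂dS1 := by
  rw [lintegral_prod_swapped hf]
  exact lintegral_sub_right_eq_self (fun β => ∫⁻ v, f (α, v) (v, β)) α

lemma lintegral_rot_right {f : S1 × ℂ → ℂ × S1 → ℝ≥0∞} {α' : S1}
    (hf : Measurable fun p : ℂ × S1 => f (p.2, p.1) (p.1, α' - p.2)) :
    ∫⁻ p : ℂ × S1, f (p.2, p.1) (p.1, α' - p.2) ∂dPlaneS1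
      = ∫⁻ β, (∫⁻ u, f (α' - β, u) (u, β)) ∂dS1 := by
  rw [lintegral_prod_swapped hf,
    ← lintegral_sub_left_eq_self (fun β => ∫⁻ u, f (α' - β, u) (u, β)) α']
  simp_rw [sub_sub_cancel]

lemma lintegral_filter_left_le {K : NNReal} {P : ℂ → ℂ} (hP : Continuous P)
    (hK : AntilipschitzWith K P) {f : ℂ × S1 → ℝ≥0∞} (hf : Measurable f) (α : S1) :
    ∫⁻ q : ℂ × S1, f (rot α (P q.1), q.2 - α) ∂dPlaneS1
      ≤ (K : ℝ≥0∞) ^ 2 * ∫⁻ p, f p ∂dPlaneS1 := by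
  rw [lintegral_rot_left (f := fun a p => f (rot a.1 (P a.2), p.2))
    (hf.comp (measurable_rot_left hP α))]
  exact lintegral_comp_deformation_le (T := fun _ v => rot α (P v))
    (fun _ => antilipschitz_rot_comp α hK) (continuous_rot_comp (by fun_prop) (by fun_prop)) hf

lemma lintegral_filter_right_le {K : NNReal} {P : ℂ → ℂ} (hP : Continuous P)
    (hK : AntilipschitzWith K P) {f : ℂ × S1 → ℝ≥0∞} (hf : Measurable f) (α' : S1) :
    ∫⁻ p : ℂ × S1, f (rot p.2 (P p.1), α' - p.2) ∂dPlaneS1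
      ≤ (K : ℝ≥0∞) ^ 2 * ∫⁻ p, f p ∂dPlaneS1 := by
  rw [lintegral_rot_right (f := fun a p => f (rot a.1 (P a.2), p.2))
    (hf.comp (measurable_rot_right hP α'))]
  exact lintegral_comp_deformation_le (T := fun β v => rot (α' - β) (P v))
    (fun β => antilipschitz_rot_comp _ hK) (continuous_rot_comp (by fun_prop) (by fun_prop)) hf

lemma FilterBound.lintegral_sub_left_le {c : ℝ} {A : ℝ≥0∞} {W : ℂ × S1 → ℝ}
    (hW : FilterBound c A W) {K : NNReal} {δ : ℝ≥0∞} {P₀ P₁ : ℂ → ℂ}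
    (h : IsDeformation c K δ P₀ P₁) (α : S1) :
    ∫⁻ q : ℂ × S1, ‖W (rot α (P₁ q.1), q.2 - α) - W (rot α (P₀ q.1), q.2 - α)‖ₑ ∂dPlaneS1
      ≤ δ * K ^ 2 * ENNReal.ofReal c * A := by
  have h0 := h.cont₀
  have h1 := h.cont₁
  rw [lintegral_rot_left (f := fun a p => ‖W (rot a.1 (P₁ a.2), p.2) - W (rot a.1 (P₀ a.2), p.2)‖ₑ)
    ((hW.measurable.comp (measurable_rot_left h1 α)).sub
      (hW.measurable.comp (measurable_rot_left h0 α))).enorm]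
  exact hW.deformation K δ (fun _ v => rot α (P₀ v)) (fun _ v => rot α (P₁ v))
    (continuous_rot_comp (by fun_prop) (by fun_prop))
    (continuous_rot_comp (by fun_prop) (by fun_prop)) fun _ => h.rot α

lemma FilterBound.lintegral_sub_right_le {c : ℝ} {A : ℝ≥0∞} {W : ℂ × S1 → ℝ}
    (hW : FilterBound c A W) {K : NNReal} {δ : ℝ≥0∞} {P₀ P₁ : ℂ → ℂ}
    (h : IsDeformation c K δ P₀ P₁) (α' : S1) :
    ∫⁻ p : ℂ × S1, ‖W (rot p.2 (P₁ p.1), α' - p.2) - W (rot p.2 (P₀ p.1), α' - p.2)‖ₑ ∂dPlaneS1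
      ≤ δ * K ^ 2 * ENNReal.ofReal c * A := by
  have h0 := h.cont₀
  have h1 := h.cont₁
  rw [lintegral_rot_right (f := fun a p => ‖W (rot a.1 (P₁ a.2), p.2) - W (rot a.1 (P₀ a.2), p.2)‖ₑ)
    ((hW.measurable.comp (measurable_rot_right h1 α')).sub
      (hW.measurable.comp (measurable_rot_right h0 α'))).enorm]
  exact hW.deformation K δ (fun β v => rot (α' - β) (P₀ v)) (fun β v => rot (α' - β) (P₁ v))
    (continuous_rot_comp (by fun_prop) (by fun_prop))
    (continuous_rot_comp (by fun_prop) (by fun_prop)) fun _ => h.rot _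

/-! ### The diffeomorphism `u ↦ u - τ(u)` -/

lemma norm_sub_sub_smul_ge {τ : ℂ → ℂ} {ε : NNReal} (hε : ε ≤ 1 / 5) (hτ : LipschitzWith ε τ)
    {s : ℝ} (hs : s ∈ Set.Icc (0 : ℝ) 1) (x y : ℂ) :
    ‖x - y‖ ≤ ((5 / 4 : NNReal) : ℝ) * ‖x - y - s • (τ x - τ y)‖ := by
  have h1 : ‖τ x - τ y‖ ≤ ε * ‖x - y‖ := by simpa [dist_eq_norm] using hτ.dist_le_mul x y
  have h2 : ‖s • (τ x - τ y)‖ ≤ 1 * ‖τ x - τ y‖ := by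
    rw [norm_smul, Real.norm_of_nonneg hs.1]
    exact mul_le_mul_of_nonneg_right hs.2 (norm_nonneg _)
  have h3 : ‖x - y‖ ≤ ‖x - y - s • (τ x - τ y)‖ + ‖s • (τ x - τ y)‖ := by
    simpa using norm_add_le (x - y - s • (τ x - τ y)) (s • (τ x - τ y))
  have h4 : (ε : ℝ) ≤ 1 / 5 := by exact_mod_cast hε
  have h5 : ((5 / 4 : NNReal) : ℝ) = 5 / 4 := by norm_num
  rw [h5]
  nlinarith [norm_nonneg (x - y)]

lemma antilipschitz_sub_smul {τ : ℂ → ℂ} {ε : NNReal} (hε : ε ≤ 1 / 5) (hτ : LipschitzWith ε τ)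
    {s : ℝ} (hs : s ∈ Set.Icc (0 : ℝ) 1) : AntilipschitzWith (5 / 4) fun v => v - s • τ v :=
  AntilipschitzWith.of_le_mul_dist fun x y => by
    rw [dist_eq_norm, dist_eq_norm]
    refine (norm_sub_sub_smul_ge hε hτ hs x y).trans_eq ?_
    rw [smul_sub]
    congr 2
    abel

lemma antilipschitz_sub {τ : ℂ → ℂ} {ε : NNReal} (hε : ε ≤ 1 / 5) (hτ : LipschitzWith ε τ) :
    AntilipschitzWith (5 / 4) fun v => v - τ v := by
  simpa using antilipschitz_sub_smul hε hτ (s := 1) (by simp)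

lemma isDeformation_commutator_left {τ : ℂ → ℂ} {ε : NNReal} (hε : ε ≤ 1 / 5)
    (hτ : LipschitzWith ε τ) {c : ℝ} (hc : 0 < c) (u : ℂ) :
    IsDeformation c (5 / 4) (ENNReal.ofReal (5 / 4 * ε / c)) (fun v => v - u)
      fun v => v - τ v - (u - τ u) := by
  have hτc := hτ.continuous
  have e : ∀ s : ℝ, ∀ v, v - u + s • (v - τ v - (u - τ u) - (v - u))
      = v - u - s • (τ v - τ u) := fun s v => by
    rw [show v - τ v - (u - τ u) - (v - u) = -(τ v - τ u) by ring, smul_neg, ← sub_eq_add_neg]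
  refine ⟨by fun_prop, by fun_prop, fun s hs => ?_, fun s hs v hv => ?_⟩
  · simp_rw [e]
    refine AntilipschitzWith.of_le_mul_dist fun x y => ?_
    refine ((antilipschitz_sub_smul hε hτ hs).le_mul_dist x y).trans_eq ?_
    rw [dist_eq_norm, dist_eq_norm, smul_sub, smul_sub]
    congr 2
    abel
  · rw [e] at hv
    rw [show v - τ v - (u - τ u) - (v - u) = -(τ v - τ u) by ring, enorm_neg, ← ofReal_norm]
    refine ENNReal.ofReal_le_ofReal ?_
    have h1 : ‖τ v - τ u‖ ≤ ε * ‖v - u‖ := by simpa [dist_eq_norm] using hτ.dist_le_mul v u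
    have h2 := norm_sub_sub_smul_ge hε hτ hs v u
    have h5 : ((5 / 4 : NNReal) : ℝ) = 5 / 4 := by norm_num
    rw [h5] at h2
    rw [le_div_iff₀ hc]
    have h3 : ‖τ v - τ u‖ ≤ ε * (5 / 4 * ‖v - u - s • (τ v - τ u)‖) :=
      h1.trans (mul_le_mul_of_nonneg_left h2 ε.2)
    calc ‖τ v - τ u‖ * c ≤ ε * (5 / 4 * ‖v - u - s • (τ v - τ u)‖) * c := by gcongr
      _ = 5 / 4 * ε * (c * ‖v - u - s • (τ v - τ u)‖) := by ring
      _ ≤ 5 / 4 * ε * 1 := by gcongr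
      _ = 5 / 4 * ε := mul_one _

lemma IsDeformation.neg {c : ℝ} {K : NNReal} {δ : ℝ≥0∞} {P₀ P₁ : ℂ → ℂ}
    (h : IsDeformation c K δ P₀ P₁) :
    IsDeformation c K δ (fun v => -P₀ v) fun v => -P₁ v := by
  have e : ∀ s : ℝ, ∀ v, -P₀ v + s • (-P₁ v - -P₀ v) = -(P₀ v + s • (P₁ v - P₀ v)) :=
    fun s v => by
      rw [show -P₁ v - -P₀ v = -(P₁ v - P₀ v) by ring, smul_neg, neg_add]
  refine ⟨h.cont₀.neg, h.cont₁.neg, fun s hs => ?_, fun s hs v hv => ?_⟩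
  · simp_rw [e]
    refine AntilipschitzWith.of_le_mul_dist fun x y => ?_
    rw [dist_neg_neg]
    exact (h.antilipschitz s hs).le_mul_dist x y
  · rw [e, norm_neg] at hv
    rw [show -P₁ v - -P₀ v = -(P₁ v - P₀ v) by ring, enorm_neg]
    exact h.close s hs v hv

lemma isDeformation_commutator_right {τ : ℂ → ℂ} {ε : NNReal} (hε : ε ≤ 1 / 5)
    (hτ : LipschitzWith ε τ) {c : ℝ} (hc : 0 < c) (v : ℂ) :
    IsDeformation c (5 / 4) (ENNReal.ofReal (5 / 4 * ε / c)) (fun u => v - u)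
      fun u => v - τ v - (u - τ u) := by
  simpa only [neg_sub] using (isDeformation_commutator_left hε hτ hc v).neg

lemma isDeformation_displacement_left (τ : ℂ → ℂ) (c : ℝ) (u : ℂ) :
    IsDeformation c 1 (supNorm τ) (fun v => v - u) fun v => v - (u - τ u) := by
  have e : ∀ v, v - (u - τ u) - (v - u) = τ u := fun v => by ring
  refine ⟨by fun_prop, by fun_prop, fun s hs => ?_, fun s hs v hv => ?_⟩
  · simp_rw [e]
    refine AntilipschitzWith.of_le_mul_dist fun x y => ?_
    simp
  · rw [e]
    exact le_iSup (fun u => ‖τ u‖ₑ) u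

lemma isDeformation_displacement_right {τ : ℂ → ℂ} {ε : NNReal} (hε : ε ≤ 1 / 5)
    (hτ : LipschitzWith ε τ) (c : ℝ) (v : ℂ) :
    IsDeformation c (5 / 4) (supNorm τ) (fun u => v - u) fun u => v - (u - τ u) := by
  have hτc := hτ.continuous
  have e : ∀ u, v - (u - τ u) - (v - u) = τ u := fun v => by ring
  refine ⟨by fun_prop, by fun_prop, fun s hs => ?_, fun s hs u hu => ?_⟩
  · simp_rw [e]
    refine AntilipschitzWith.of_le_mul_dist fun x y => ?_
    refine ((antilipschitz_sub_smul hε hτ hs).le_mul_dist x y).trans_eq ?_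
    rw [dist_comm (v - x + _), dist_eq_norm, dist_eq_norm]
    congr 2
    abel
  · rw [e]
    exact le_iSup (fun u => ‖τ u‖ₑ) u

/-- The Jacobian of `u ↦ u - τ(u)`. -/
noncomputable def jacobian (τ : ℂ → ℂ) (u : ℂ) : ℝ :=
  |(ContinuousLinearMap.id ℝ ℂ - fderiv ℝ τ u).det|

lemma abs_one_sub_abs_det_le {A : ℂ →L[ℝ] ℂ} {ε : ℝ} (hA : ‖A‖ ≤ ε) (hε : ε ≤ 1 / 5) :
    |1 - abs (ContinuousLinearMap.id ℝ ℂ - A).det| ≤ 11 / 5 * ε := by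
  set B : ℂ →L[ℝ] ℂ := ContinuousLinearMap.id ℝ ℂ - A with hB
  have hε0 : 0 ≤ ε := (norm_nonneg A).trans hA
  have hAx : ∀ x, ‖A x‖ ≤ ε * ‖x‖ := fun x =>
    (A.le_opNorm x).trans (mul_le_mul_of_nonneg_right hA (norm_nonneg x))
  have hBx : ∀ x, B x = x - A x := fun x => rfl
  have hup : ∀ x, ‖B x‖ ≤ (1 + ε) * ‖x‖ := fun x => by
    have := norm_sub_le x (A x)
    rw [hBx]
    linarith [hAx x]
  have hlow : ∀ x, (1 - ε) * ‖x‖ ≤ ‖B x‖ := fun x => by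
    have := norm_sub_norm_le x (A x)
    rw [hBx]
    linarith [hAx x]
  have hinj : Function.Injective (B : ℂ →ₗ[ℝ] ℂ) := by
    rw [← LinearMap.ker_eq_bot, LinearMap.ker_eq_bot']
    intro x hx
    have h1 := hlow x
    rw [show B x = 0 from hx, norm_zero] at h1
    have h2 : ‖x‖ ≤ 0 := by nlinarith [norm_nonneg x]
    exact norm_le_zero_iff.1 h2
  have hsurj : Function.Surjective (B : ℂ →ₗ[ℝ] ℂ) := LinearMap.surjective_of_injective hinj
  have hvol : ∀ r : ℝ, 0 ≤ r → volume (Metric.ball (0 : ℂ) r) = ENNReal.ofReal (r ^ 2 * π) :=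
    fun r hr => by
      rw [Complex.volume_ball, ENNReal.ofReal_mul (by positivity), ENNReal.ofReal_pow hr]
      congr 1
      rw [← NNReal.coe_real_pi, ENNReal.ofReal_coe_nnreal]
  have himg : volume (B '' Metric.ball (0 : ℂ) 1) = ENNReal.ofReal (|B.det| * π) := by
    have h := Measure.addHaar_image_continuousLinearMap (volume : Measure ℂ) B (Metric.ball 0 1)
    rw [h, hvol 1 zero_le_one, ENNReal.ofReal_mul (abs_nonneg _), one_pow, one_mul]
  have h1 : |B.det| ≤ (1 + ε) ^ 2 := by
    have hsub : B '' Metric.ball (0 : ℂ) 1 ⊆ Metric.ball 0 (1 + ε) := by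
      rintro _ ⟨x, hx, rfl⟩
      rw [Metric.mem_ball, dist_zero_right] at hx ⊢
      nlinarith [hup x]
    have h := measure_mono (μ := volume) hsub
    rw [himg, hvol _ (by positivity), ENNReal.ofReal_le_ofReal_iff (by positivity)] at h
    exact le_of_mul_le_mul_right h Real.pi_pos
  have h2 : (1 - ε) ^ 2 ≤ |B.det| := by
    have hsub : Metric.ball (0 : ℂ) (1 - ε) ⊆ B '' Metric.ball 0 1 := by
      intro y hy
      obtain ⟨x, rfl⟩ := hsurj y
      refine ⟨x, ?_, rfl⟩
      rw [Metric.mem_ball, dist_zero_right] at hy ⊢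
      have h3 := hlow x
      have h4 : ‖B x‖ < 1 - ε := hy
      nlinarith
    have h := measure_mono (μ := volume) hsub
    rw [himg, hvol _ (by linarith), ENNReal.ofReal_le_ofReal_iff (by positivity)] at h
    exact le_of_mul_le_mul_right h Real.pi_pos
  rw [abs_le]
  constructor <;> nlinarith

lemma enorm_one_sub_jacobian_le {τ : ℂ → ℂ} {ε : NNReal} (hε : ε ≤ 1 / 5)
    (hτ : ∀ u, ‖fderiv ℝ τ u‖ ≤ ε) (u : ℂ) : ‖1 - jacobian τ u‖ₑ ≤ ENNReal.ofReal (11 / 5 * ε) := by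
  rw [← ofReal_norm]
  exact ENNReal.ofReal_le_ofReal (abs_one_sub_abs_det_le (hτ u) (by exact_mod_cast hε))

lemma continuous_jacobian {τ : ℂ → ℂ} (hτ : ContDiff ℝ 1 τ) : Continuous (jacobian τ) :=
  (ContinuousLinearMap.continuous_det.comp
    (continuous_const.sub (hτ.continuous_fderiv one_ne_zero))).abs

lemma map_withDensity_jacobian {τ : ℂ → ℂ} (hτ : ContDiff ℝ 1 τ) {ε : NNReal} (hε : ε ≤ 1 / 5)
    (hL : LipschitzWith ε τ) :
    Measure.map (fun v => v - τ v) (volume.withDensity fun v => ENNReal.ofReal (jacobian τ v))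
      = volume := by
  have hd : ∀ x ∈ Set.univ, HasFDerivWithinAt (fun v => v - τ v)
      (ContinuousLinearMap.id ℝ ℂ - fderiv ℝ τ x) Set.univ x := fun x _ =>
    ((hasFDerivAt_id x).sub ((hτ.differentiable one_ne_zero) x).hasFDerivAt).hasFDerivWithinAt
  have h := map_withDensity_abs_det_fderiv_eq_addHaar (volume : Measure ℂ)
    MeasurableSet.univ.nullMeasurableSet hd (antilipschitz_sub hε hL).injective.injOn
  have hsurj : Set.range (fun v => v - τ v) = Set.univ := by
    refine Set.range_eq_univ.2 fun w => ?_
    have hc : ContractingWith ε fun v => w + τ v :=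
      ⟨lt_of_le_of_lt hε (by norm_num), by simpa using (LipschitzWith.const w).add hL⟩
    refine ⟨hc.fixedPoint, ?_⟩
    have := hc.fixedPoint_isFixedPt
    simp only [Function.IsFixedPt] at this
    linear_combination -this
  rw [Set.image_univ, hsurj, Measure.restrict_univ] at h
  exact h

lemma map_prod_withDensity_jacobian {τ : ℂ → ℂ} (hτ : ContDiff ℝ 1 τ) {ε : NNReal}
    (hε : ε ≤ 1 / 5) (hL : LipschitzWith ε τ) :
    Measure.map (fun q : ℂ × S1 => (q.1 - τ q.1, q.2))
      (dPlaneS1.withDensity fun q => ENNReal.ofReal (jacobian τ q.1)) = dPlaneS1 := by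
  have hm : Measurable fun v => ENNReal.ofReal (jacobian τ v) :=
    (continuous_jacobian hτ).measurable.ennreal_ofReal
  have hg : Measurable fun v => v - τ v := (continuous_id.sub hτ.continuous).measurable
  have hmap := map_withDensity_jacobian hτ hε hL
  rw [dPlaneS1, ← prod_withDensity_left hm]
  have : SFinite (Measure.map (fun v => v - τ v)
      ((volume : Measure ℂ).withDensity fun v => ENNReal.ofReal (jacobian τ v))) := by
    rw [hmap]; infer_instance
  conv_rhs => rw [← hmap, ← Measure.map_id (μ := dS1), Measure.map_prod_map _ _ hg measurable_id]
  rfl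

lemma integral_eq_integral_jacobian_mul {τ : ℂ → ℂ} (hτ : ContDiff ℝ 1 τ) {ε : NNReal}
    (hε : ε ≤ 1 / 5) (hL : LipschitzWith ε τ) {F : ℂ × S1 → ℝ} (hF : Integrable F dPlaneS1) :
    Integrable (fun q : ℂ × S1 => jacobian τ q.1 * F (q.1 - τ q.1, q.2)) dPlaneS1 ∧
    ∫ q, F q ∂dPlaneS1 = ∫ q : ℂ × S1, jacobian τ q.1 * F (q.1 - τ q.1, q.2) ∂dPlaneS1 := by
  have hmap := map_prod_withDensity_jacobian hτ hε hL
  have hτc := hτ.continuous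
  have hg : Measurable fun q : ℂ × S1 => (q.1 - τ q.1, q.2) :=
    (by fun_prop : Continuous fun q : ℂ × S1 => (q.1 - τ q.1, q.2)).measurable
  have hm : Measurable fun q : ℂ × S1 => ENNReal.ofReal (jacobian τ q.1) :=
    ((continuous_jacobian hτ).measurable.comp measurable_fst).ennreal_ofReal
  have hlt : ∀ᵐ q ∂dPlaneS1, ENNReal.ofReal (jacobian τ q.1) < ∞ :=
    ae_of_all _ fun _ => ENNReal.ofReal_lt_top
  have hF' : AEStronglyMeasurable F (Measure.map (fun q : ℂ × S1 => (q.1 - τ q.1, q.2))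
      (dPlaneS1.withDensity fun q => ENNReal.ofReal (jacobian τ q.1))) := by
    rw [hmap]; exact hF.1
  have e : ∀ q : ℂ × S1, (ENNReal.ofReal (jacobian τ q.1)).toReal • F (q.1 - τ q.1, q.2)
      = jacobian τ q.1 * F (q.1 - τ q.1, q.2) := fun q => by
    rw [ENNReal.toReal_ofReal (show 0 ≤ jacobian τ q.1 from abs_nonneg _), smul_eq_mul]
  constructor
  · rw [← hmap, integrable_map_measure hF' hg.aemeasurable,
      integrable_withDensity_iff_integrable_smul' hm hlt] at hF
    exact hF.congr (ae_of_all _ e)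
  · conv_lhs => rw [← hmap, integral_map hg.aemeasurable hF',
      integral_withDensity_eq_integral_toReal_smul hm hlt]
    exact integral_congr_ae (ae_of_all _ e)

/-! ### Norms of feature maps -/

/-- Each channel of the feature map is Borel measurable. -/
def MeasurableFeature {M : ℕ} (x : ℂ → S1 → Fin M → ℝ) : Prop :=
  ∀ c, Measurable fun p : ℂ × S1 => x p.1 p.2 c

lemma MeasurableFeature.sub {M : ℕ} {x y : ℂ → S1 → Fin M → ℝ} (hx : MeasurableFeature x)
    (hy : MeasurableFeature y) : MeasurableFeature (x - y) := fun c => (hx c).sub (hy c)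

lemma featureNorm_sq (Ω : Set ℂ) {M : ℕ} (x : ℂ → S1 → Fin M → ℝ) :
    featureNorm Ω x ^ 2
      = (M : ℝ≥0∞)⁻¹ * ∑ c, (volume Ω)⁻¹ * ∫⁻ p : ℂ × S1, ‖x p.1 p.2 c‖ₑ ^ 2 ∂dPlaneS1 := by
  rw [featureNorm, ← ENNReal.rpow_two, ← ENNReal.rpow_mul]
  norm_num

lemma featureNorm_eq_eLpNorm (Ω : Set ℂ) {M : ℕ} {x : ℂ → S1 → Fin M → ℝ}
    (hx : MeasurableFeature x) :
    featureNorm Ω x = eLpNorm (fun q : Fin M × (ℂ × S1) => x q.2.1 q.2.2 q.1) 2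
      (((M : ℝ≥0∞)⁻¹ * (volume Ω)⁻¹) • Measure.count.prod dPlaneS1) := by
  have hm : Measurable fun q : Fin M × (ℂ × S1) => x q.2.1 q.2.2 q.1 :=
    measurable_from_prod_countable_right hx
  refine (ENNReal.pow_right_strictMono two_ne_zero).injective ?_
  rw [featureNorm_sq, eLpNorm_two_sq, lintegral_smul_measure,
    lintegral_prod _ (hm.enorm.pow_const 2).aemeasurable, lintegral_count, tsum_fintype,
    smul_eq_mul, ← Finset.mul_sum, mul_assoc]

lemma featureNorm_triangle (Ω : Set ℂ) {M : ℕ} {x y z : ℂ → S1 → Fin M → ℝ}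
    (hx : MeasurableFeature x) (hy : MeasurableFeature y) (hz : MeasurableFeature z) :
    featureNorm Ω (x - z) ≤ featureNorm Ω (x - y) + featureNorm Ω (y - z) := by
  rw [featureNorm_eq_eLpNorm Ω (hx.sub hz), featureNorm_eq_eLpNorm Ω (hx.sub hy),
    featureNorm_eq_eLpNorm Ω (hy.sub hz)]
  have h1 : Measurable fun q : Fin M × (ℂ × S1) => (x - y) q.2.1 q.2.2 q.1 :=
    measurable_from_prod_countable_right (hx.sub hy)
  have h2 : Measurable fun q : Fin M × (ℂ × S1) => (y - z) q.2.1 q.2.2 q.1 :=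
    measurable_from_prod_countable_right (hy.sub hz)
  refine le_of_eq_of_le (congrArg (fun f => eLpNorm f 2 _) ?_)
    (eLpNorm_add_le h1.aestronglyMeasurable h2.aestronglyMeasurable one_le_two)
  funext q
  simp

lemma memLp_of_featureNorm_ne_top {Ω : Set ℂ} (hΩ : volume Ω ≠ ∞) {M : ℕ}
    {x : ℂ → S1 → Fin M → ℝ} (hx : MeasurableFeature x) (h : featureNorm Ω x ≠ ∞) (c : Fin M) :
    MemLp (fun p : ℂ × S1 => x p.1 p.2 c) 2 dPlaneS1 := by
  refine ⟨(hx c).aestronglyMeasurable, ?_⟩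
  have h1 : featureNorm Ω x ^ 2 ≠ ∞ := ENNReal.pow_ne_top h
  rw [featureNorm_sq] at h1
  by_contra htop
  have h3 : ∫⁻ p : ℂ × S1, ‖x p.1 p.2 c‖ₑ ^ 2 ∂dPlaneS1 = ∞ := by
    rw [← eLpNorm_two_sq, not_lt_top_iff.1 htop]
    simp
  refine h1 ?_
  have h4 : ∑ c, (volume Ω)⁻¹ * ∫⁻ p : ℂ × S1, ‖x p.1 p.2 c‖ₑ ^ 2 ∂dPlaneS1 = ∞ := by
    refine ENNReal.sum_eq_top.2 ⟨c, Finset.mem_univ c, ?_⟩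
    rw [h3, ENNReal.mul_top (ENNReal.inv_ne_zero.2 hΩ)]
  rw [h4, ENNReal.mul_top (ENNReal.inv_ne_zero.2 (ENNReal.natCast_ne_top M))]

/-! ### The Schur test -/

lemma sum_sq_le_of_sq_le_mul {ι : Type*} (s : Finset ι) {f a b : ι → ℝ≥0∞}
    (h : ∀ i ∈ s, f i ^ 2 ≤ a i * b i) : (∑ i ∈ s, f i) ^ 2 ≤ (∑ i ∈ s, a i) * ∑ i ∈ s, b i := by
  have hr : ∀ x : ℝ≥0∞, (x ^ (1 / 2 : ℝ)) ^ (2 : ℝ) = x := fun x => by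
    rw [← ENNReal.rpow_mul]; norm_num
  have h1 : ∀ i ∈ s, f i ≤ a i ^ (1 / 2 : ℝ) * b i ^ (1 / 2 : ℝ) := fun i hi => by
    rw [← ENNReal.mul_rpow_of_nonneg _ _ (by norm_num : (0 : ℝ) ≤ 1 / 2),
      ← ENNReal.rpow_le_rpow_iff (z := 2) (by norm_num), hr, ENNReal.rpow_two]
    exact h i hi
  have h2 := ENNReal.inner_le_Lp_mul_Lq s (fun i => a i ^ (1 / 2 : ℝ)) (fun i => b i ^ (1 / 2 : ℝ))
    Real.HolderConjugate.two_two
  simp_rw [hr] at h2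
  calc (∑ i ∈ s, f i) ^ 2
      ≤ ((∑ i ∈ s, a i) ^ (1 / 2 : ℝ) * (∑ i ∈ s, b i) ^ (1 / 2 : ℝ)) ^ 2 := by
        gcongr
        exact (Finset.sum_le_sum h1).trans h2
    _ = _ := by rw [mul_pow, ← ENNReal.rpow_two, ← ENNReal.rpow_two, hr, hr]

lemma lintegral_mul_sq_le_weighted {X : Type*} [MeasurableSpace X] {μ : Measure X}
    {f k : X → ℝ≥0∞} (hf : Measurable f) (hk : Measurable k) :
    (∫⁻ x, f x * k x ∂μ) ^ 2 ≤ (∫⁻ x, k x ∂μ) * ∫⁻ x, f x ^ 2 * k x ∂μ := by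
  have h := lintegral_sq_le_measure_mul (μ := μ.withDensity k) hf.aemeasurable
  rw [lintegral_withDensity_eq_lintegral_mul _ hk hf,
    lintegral_withDensity_eq_lintegral_mul _ hk (hf.pow_const 2), withDensity_apply _ .univ,
    Measure.restrict_univ] at h
  simpa only [Pi.mul_apply, mul_comm] using h

/-- The Schur test for matrices of kernels, in the normalized norms of feature maps. -/
lemma featureNorm_le_of_kernel (Ω : Set ℂ) {M' M : ℕ} (hM' : 0 < M')
    {A : Fin M' → Fin M → ℝ≥0∞} (hrow : ∀ c, ∑ c', A c' c ≤ 1)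
    (hcol : ∀ c', (M' : ℝ≥0∞) / M * ∑ c, A c' c ≤ 1) {B : ℝ≥0∞}
    {k : Fin M' → Fin M → ℂ × S1 → ℂ × S1 → ℝ≥0∞}
    (hk : ∀ c' c, Measurable (Function.uncurry (k c' c)))
    (hkr : ∀ c' c p, ∫⁻ q, k c' c p q ∂dPlaneS1 ≤ B * A c' c)
    (hkc : ∀ c' c q, ∫⁻ p, k c' c p q ∂dPlaneS1 ≤ B * A c' c)
    {z : ℂ → S1 → Fin M' → ℝ} (hz : MeasurableFeature z) {y : ℂ → S1 → Fin M → ℝ}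
    (hy : ∀ u α c, ‖y u α c‖ₑ
      ≤ ∑ c', ∫⁻ q : ℂ × S1, ‖z q.1 q.2 c'‖ₑ * k c' c (u, α) q ∂dPlaneS1) :
    featureNorm Ω y ≤ B * featureNorm Ω z := by
  have hM0 : (M' : ℝ≥0∞) ≠ 0 := by exact_mod_cast hM'.ne'
  have hcol' : ∀ c', (M : ℝ≥0∞)⁻¹ * ∑ c, A c' c ≤ (M' : ℝ≥0∞)⁻¹ := fun c' => by
    rw [ENNReal.le_inv_iff_mul_le]
    refine le_of_eq_of_le ?_ (hcol c')
    rw [div_eq_mul_inv]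
    ring
  have hkp : ∀ c' c p, Measurable (k c' c p) := fun c' c p => (hk c' c).comp measurable_prodMk_left
  have hkq : ∀ c' c q, Measurable fun p => k c' c p q := fun c' c q =>
    (hk c' c).comp measurable_prodMk_right
  have hz2 : ∀ c', Measurable fun q : ℂ × S1 => ‖z q.1 q.2 c'‖ₑ ^ 2 := fun c' =>
    (hz c').enorm.pow_const 2
  have hzk : ∀ c' c, Measurable fun r : (ℂ × S1) × (ℂ × S1) =>
      ‖z r.2.1 r.2.2 c'‖ₑ ^ 2 * k c' c r.1 r.2 := fun c' c =>
    ((hz2 c').comp measurable_snd).mul (hk c' c)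
  have hpt : ∀ c (p : ℂ × S1), ‖y p.1 p.2 c‖ₑ ^ 2
      ≤ B * ∑ c', ∫⁻ q : ℂ × S1, ‖z q.1 q.2 c'‖ₑ ^ 2 * k c' c p q ∂dPlaneS1 := fun c p => by
    calc ‖y p.1 p.2 c‖ₑ ^ 2
        ≤ (∑ c', ∫⁻ q : ℂ × S1, ‖z q.1 q.2 c'‖ₑ * k c' c p q ∂dPlaneS1) ^ 2 := by
          gcongr
          exact hy p.1 p.2 c
      _ ≤ (∑ c', ∫⁻ q, k c' c p q ∂dPlaneS1)
            * ∑ c', ∫⁻ q : ℂ × S1, ‖z q.1 q.2 c'‖ₑ ^ 2 * k c' c p q ∂dPlaneS1 :=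
          sum_sq_le_of_sq_le_mul _ fun c' _ =>
            lintegral_mul_sq_le_weighted (hz c').enorm (hkp c' c p)
      _ ≤ _ := by
          gcongr
          calc ∑ c', ∫⁻ q, k c' c p q ∂dPlaneS1 ≤ ∑ c', B * A c' c :=
                Finset.sum_le_sum fun c' _ => hkr c' c p
            _ = B * ∑ c', A c' c := (Finset.mul_sum _ _ _).symm
            _ ≤ B * 1 := by gcongr; exact hrow c
            _ = B := mul_one B
  have hint : ∀ c, ∫⁻ p : ℂ × S1, ‖y p.1 p.2 c‖ₑ ^ 2 ∂dPlaneS1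
      ≤ B * ∑ c', (∫⁻ q : ℂ × S1, ‖z q.1 q.2 c'‖ₑ ^ 2 ∂dPlaneS1) * (B * A c' c) := fun c => by
    calc ∫⁻ p : ℂ × S1, ‖y p.1 p.2 c‖ₑ ^ 2 ∂dPlaneS1
        ≤ ∫⁻ p, B * ∑ c', ∫⁻ q : ℂ × S1, ‖z q.1 q.2 c'‖ₑ ^ 2 * k c' c p q ∂dPlaneS1 ∂dPlaneS1 :=
          lintegral_mono (hpt c)
      _ = B * ∑ c', ∫⁻ p, ∫⁻ q : ℂ × S1, ‖z q.1 q.2 c'‖ₑ ^ 2 * k c' c p q ∂dPlaneS1 ∂dPlaneS1 := by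
          rw [lintegral_const_mul _ (Finset.measurable_fun_sum _ fun c' _ =>
            (hzk c' c).lintegral_prod_right'),
            lintegral_finsetSum _ fun c' _ => (hzk c' c).lintegral_prod_right']
      _ ≤ _ := by
          gcongr with c' _
          rw [lintegral_lintegral_swap (hzk c' c).aemeasurable]
          rw [← lintegral_mul_const _ (hz2 c')]
          refine lintegral_mono fun q => ?_
          rw [lintegral_const_mul _ (hkq c' c q)]
          gcongr
          exact hkc c' c q
  refine (ENNReal.pow_le_pow_left_iff two_ne_zero).1 ?_
  rw [mul_pow, featureNorm_sq, featureNorm_sq]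
  set V := (volume Ω)⁻¹
  calc (M : ℝ≥0∞)⁻¹ * ∑ c, V * ∫⁻ p : ℂ × S1, ‖y p.1 p.2 c‖ₑ ^ 2 ∂dPlaneS1
      ≤ (M : ℝ≥0∞)⁻¹ * ∑ c, V
          * (B * ∑ c', (∫⁻ q : ℂ × S1, ‖z q.1 q.2 c'‖ₑ ^ 2 ∂dPlaneS1) * (B * A c' c)) := by
        gcongr with c _
        exact hint c
    _ = B ^ 2 * ∑ c', V * (∫⁻ q : ℂ × S1, ‖z q.1 q.2 c'‖ₑ ^ 2 ∂dPlaneS1)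
          * ((M : ℝ≥0∞)⁻¹ * ∑ c, A c' c) := by
        simp_rw [Finset.mul_sum]
        rw [Finset.sum_comm]
        refine Finset.sum_congr rfl fun c' _ => Finset.sum_congr rfl fun c _ => ?_
        ring
    _ ≤ B ^ 2 * ∑ c', V * (∫⁻ q : ℂ × S1, ‖z q.1 q.2 c'‖ₑ ^ 2 ∂dPlaneS1) * (M' : ℝ≥0∞)⁻¹ := by
        gcongr with c' _
        exact hcol' c'
    _ = _ := by rw [← Finset.sum_mul, mul_comm (∑ c', _) (M' : ℝ≥0∞)⁻¹]

/-! ### Joint convolution layers -/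

/-- The linear part of a joint convolution layer with filters `W`. -/
noncomputable def preact {M' M : ℕ} (W : Fin M' → Fin M → ℂ × S1 → ℝ)
    (x : ℂ → S1 → Fin M' → ℝ) (u : ℂ) (α : S1) (c : Fin M) : ℝ :=
  ∑ c', ∫ p : ℂ × S1, x (u + p.1) p.2 c' * W c' c (rot α p.1, p.2 - α) ∂dPlaneS1

/-- A joint convolution layer with filters `W`, biases `b` and activation `σ`. -/
noncomputable def layer {M' M : ℕ} (σ : ℝ → ℝ) (W : Fin M' → Fin M → ℂ × S1 → ℝ) (b : Fin M → ℝ)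
    (x : ℂ → S1 → Fin M' → ℝ) : ℂ → S1 → Fin M → ℝ :=
  fun u α c => σ (preact W x u α c + b c)

/-- The argument of a filter at the input position `q`, seen from the output position `(u, α)`. -/
noncomputable def filterArg (u : ℂ) (α : S1) (q : ℂ × S1) : ℂ × S1 := (rot α (q.1 - u), q.2 - α)

lemma measurePreserving_rot_sub (α : S1) :
    MeasurePreserving (fun p : ℂ × S1 => (rot α p.1, p.2 - α)) dPlaneS1 dPlaneS1 :=
  (measurePreserving_rot α).prod (measurePreserving_sub_right dS1 α)

lemma measurePreserving_filterArg (u : ℂ) (α : S1) :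
    MeasurePreserving (filterArg u α) dPlaneS1 dPlaneS1 :=
  ((measurePreserving_rot α).comp (measurePreserving_sub_right volume u)).prod
    (measurePreserving_sub_right dS1 α)

lemma preact_eq {M' M : ℕ} (W : Fin M' → Fin M → ℂ × S1 → ℝ) (x : ℂ → S1 → Fin M' → ℝ)
    (u : ℂ) (α : S1) (c : Fin M) :
    preact W x u α c
      = ∑ c', ∫ q : ℂ × S1, x q.1 q.2 c' * W c' c (filterArg u α q) ∂dPlaneS1 := by
  refine Finset.sum_congr rfl fun c' _ => ?_
  rw [← integral_add_left_eq_self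
    (fun q : ℂ × S1 => x q.1 q.2 c' * W c' c (filterArg u α q)) ((u, 0) : ℂ × S1)]
  simp [filterArg]

lemma preact_congr_filter {M' M : ℕ} {W W' : Fin M' → Fin M → ℂ × S1 → ℝ}
    (h : ∀ c' c, W c' c =ᵐ[dPlaneS1] W' c' c) (x : ℂ → S1 → Fin M' → ℝ) :
    preact W x = preact W' x := by
  funext u α c
  refine Finset.sum_congr rfl fun c' _ => integral_congr_ae ?_
  filter_upwards [(measurePreserving_rot_sub α).quasiMeasurePreserving.ae (h c' c)] with p hp
  rw [hp]

lemma preact_congr_input {M' M : ℕ} (W : Fin M' → Fin M → ℂ × S1 → ℝ)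
    {x x' : ℂ → S1 → Fin M' → ℝ}
    (h : ∀ c', (fun q : ℂ × S1 => x q.1 q.2 c') =ᵐ[dPlaneS1] fun q => x' q.1 q.2 c') :
    preact W x = preact W x' := by
  funext u α c
  rw [preact_eq, preact_eq]
  refine Finset.sum_congr rfl fun c' _ => integral_congr_ae ?_
  filter_upwards [h c'] with q hq
  rw [hq]

/-- The filters of a layer satisfy `FilterBound` with constants whose row and column sums are
normalized. -/
structure LayerBound (c : ℝ) {M' M : ℕ} (A : Fin M' → Fin M → ℝ≥0∞)
    (W : Fin M' → Fin M → ℂ × S1 → ℝ) : Prop where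
  pos : 0 < M'
  filter : ∀ c' k, FilterBound c (A c' k) (W c' k)
  row : ∀ k, ∑ c', A c' k ≤ 1
  col : ∀ c', (M' : ℝ≥0∞) / M * ∑ k, A c' k ≤ 1

/-- The feature map is Borel measurable and differs from the constant `κ` by an `L²` function. -/
structure IsAdmissible (Ω : Set ℂ) {M : ℕ} (κ : Fin M → ℝ) (x : ℂ → S1 → Fin M → ℝ) : Prop where
  measurable : MeasurableFeature x
  ne_top : featureNorm Ω (x - fun _ _ => κ) ≠ ∞

lemma measurableFeature_const {M : ℕ} (κ : Fin M → ℝ) :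
    MeasurableFeature (fun _ _ => κ : ℂ → S1 → Fin M → ℝ) := fun _ => measurable_const

lemma featureNorm_zero (Ω : Set ℂ) {M : ℕ} : featureNorm Ω (0 : ℂ → S1 → Fin M → ℝ) = 0 := by
  simp [featureNorm]

lemma isAdmissible_const (Ω : Set ℂ) {M : ℕ} (κ : Fin M → ℝ) :
    IsAdmissible Ω κ (fun _ _ => κ) :=
  ⟨measurableFeature_const κ, by rw [sub_self, featureNorm_zero]; simp⟩

variable {Ω : Set ℂ} {c : ℝ} {M' M : ℕ} {A : Fin M' → Fin M → ℝ≥0∞}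
  {W : Fin M' → Fin M → ℂ × S1 → ℝ} {κ : Fin M' → ℝ} {x y : ℂ → S1 → Fin M' → ℝ}
  {σ : ℝ → ℝ}

lemma IsAdmissible.integrable_mul (hΩ : volume Ω ≠ ∞) (hx : IsAdmissible Ω κ x) {A₀ : ℝ≥0∞}
    {V : ℂ × S1 → ℝ} (hV : FilterBound c A₀ V) (u : ℂ) (α : S1) (c' : Fin M') :
    Integrable (fun q : ℂ × S1 => (x q.1 q.2 c' - κ c') * V (filterArg u α q)) dPlaneS1 :=
  (memLp_of_featureNorm_ne_top hΩ (hx.measurable.sub (measurableFeature_const κ))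
    hx.ne_top c').integrable_mul
    (hV.memLp.comp_measurePreserving (measurePreserving_filterArg u α))

/-- The constant part of an admissible input contributes a constant to the linear part. -/
lemma LayerBound.preact_eq (hW : LayerBound c A W) (hΩ : volume Ω ≠ ∞) (hx : IsAdmissible Ω κ x)
    (u : ℂ) (α : S1) (k : Fin M) :
    preact W x u α k
      = ∑ c', ∫ q : ℂ × S1, (x q.1 q.2 c' - κ c') * W c' k (filterArg u α q) ∂dPlaneS1
        + ∑ c', κ c' * ∫ q, W c' k q ∂dPlaneS1 := by
  rw [RotDCF.preact_eq, ← Finset.sum_add_distrib]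
  refine Finset.sum_congr rfl fun c' _ => ?_
  have hmp := measurePreserving_filterArg u α
  have hWi : Integrable (fun q => W c' k (filterArg u α q)) dPlaneS1 :=
    hmp.integrable_comp_of_integrable (hW.filter c' k).integrable
  have hWint : ∫ q, W c' k (filterArg u α q) ∂dPlaneS1 = ∫ q, W c' k q ∂dPlaneS1 := by
    have h := integral_map (μ := dPlaneS1) hmp.aemeasurable
      (f := W c' k) (by rw [hmp.map_eq]; exact (hW.filter c' k).memLp.1)
    rw [← h, hmp.map_eq]
  rw [← hWint, ← integral_const_mul,
    ← integral_add (hx.integrable_mul hΩ (hW.filter c' k) u α c') (hWi.const_mul _)]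
  refine integral_congr_ae (ae_of_all _ fun q => ?_)
  simp only
  ring

/-- The output of a layer on the constant input `κ`. -/
noncomputable def layerConst (σ : ℝ → ℝ) (W : Fin M' → Fin M → ℂ × S1 → ℝ) (b : Fin M → ℝ)
    (κ : Fin M' → ℝ) (k : Fin M) : ℝ :=
  σ (∑ c', κ c' * ∫ q, W c' k q ∂dPlaneS1 + b k)

lemma LayerBound.layer_const (hW : LayerBound c A W) (b : Fin M → ℝ) :
    layer σ W b (fun _ _ => κ) = fun _ _ => layerConst σ W b κ := by
  funext u α k
  rw [layer, hW.preact_eq (Ω := ∅) (by simp) (isAdmissible_const ∅ κ)]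
  simp [layerConst]

lemma measurable_filterArg :
    Measurable fun r : (ℂ × S1) × (ℂ × S1) => filterArg r.1.1 r.1.2 r.2 :=
  (Continuous.prodMk (continuous_rot_comp (by fun_prop) (by fun_prop)) (by fun_prop)).measurable

lemma LayerBound.measurableFeature_layer (hW : LayerBound c A W) (hσ : Continuous σ)
    (b : Fin M → ℝ) (hx : MeasurableFeature x) : MeasurableFeature (layer σ W b x) := fun k => by
  refine hσ.measurable.comp (Measurable.add_const ?_ _)
  simp only [RotDCF.preact_eq]
  refine Finset.measurable_fun_sum _ fun c' _ => ?_
  have h : Measurable fun r : (ℂ × S1) × (ℂ × S1) =>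
      x r.2.1 r.2.2 c' * W c' k (filterArg r.1.1 r.1.2 r.2) :=
    ((hx c').comp measurable_snd).mul ((hW.filter c' k).measurable.comp measurable_filterArg)
  exact h.stronglyMeasurable.integral_prod_right'.measurable

lemma enorm_layer_sub_le (hσ : LipschitzWith 1 σ) (b : Fin M → ℝ) (u u' : ℂ) (α : S1) (k : Fin M) :
    ‖layer σ W b x u α k - layer σ W b y u' α k‖ₑ ≤ ‖preact W x u α k - preact W y u' α k‖ₑ := by
  have h := hσ.edist_le_mul (preact W x u α k + b k) (preact W y u' α k + b k)
  rw [edist_add_right, edist_eq_enorm_sub, edist_eq_enorm_sub, ENNReal.coe_one, one_mul] at h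
  exact h

lemma enorm_sum_integral_le {X : Type*} [MeasurableSpace X] {μ : Measure X} {ι : Type*}
    (s : Finset ι) (f g : ι → X → ℝ) :
    ‖∑ i ∈ s, ∫ q, f i q * g i q ∂μ‖ₑ ≤ ∑ i ∈ s, ∫⁻ q, ‖f i q‖ₑ * ‖g i q‖ₑ ∂μ := by
  refine (enorm_sum_le _ _).trans (Finset.sum_le_sum fun i _ => ?_)
  refine (enorm_integral_le_lintegral_enorm _).trans_eq ?_
  simp_rw [enorm_mul]

lemma antilipschitz_sub_const (u : ℂ) : AntilipschitzWith 1 fun v : ℂ => v - u :=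
  AntilipschitzWith.of_le_mul_dist fun x y => by simp

lemma antilipschitz_const_sub (v : ℂ) : AntilipschitzWith 1 fun u : ℂ => v - u :=
  AntilipschitzWith.of_le_mul_dist fun x y => by
    rw [dist_eq_norm, dist_eq_norm, sub_sub_sub_cancel_left, norm_sub_rev y x]
    simp

/-- Layers are non-expansive. -/
lemma LayerBound.featureNorm_layer_sub_le (hW : LayerBound c A W) (hΩ : volume Ω ≠ ∞)
    (hσ : LipschitzWith 1 σ) (b : Fin M → ℝ) (hx : IsAdmissible Ω κ x)
    (hy : IsAdmissible Ω κ y) :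
    featureNorm Ω (layer σ W b x - layer σ W b y) ≤ featureNorm Ω (x - y) := by
  have hWm := fun c' k => (hW.filter c' k).measurable
  rw [← one_mul (featureNorm Ω (x - y))]
  refine featureNorm_le_of_kernel Ω hW.pos hW.row hW.col
    (k := fun c' k p q => ‖W c' k (filterArg p.1 p.2 q)‖ₑ)
    (fun c' k => ((hWm c' k).comp measurable_filterArg).enorm) (fun c' k p => ?_)
    (fun c' k q => ?_) (hx.measurable.sub hy.measurable) fun u α k => ?_
  · rw [one_mul]
    have h := lintegral_filter_left_le (P := fun v => v - p.1) (by fun_prop)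
      (antilipschitz_sub_const p.1) (hWm c' k).enorm p.2
    rw [ENNReal.coe_one, one_pow, one_mul] at h
    exact h.trans (hW.filter c' k).lintegral_le
  · rw [one_mul]
    have h := lintegral_filter_right_le (P := fun u => q.1 - u) (by fun_prop)
      (antilipschitz_const_sub q.1) (hWm c' k).enorm q.2
    rw [ENNReal.coe_one, one_pow, one_mul] at h
    exact h.trans (hW.filter c' k).lintegral_le
  · refine (enorm_layer_sub_le hσ b u u α k).trans ?_
    rw [hW.preact_eq hΩ hx, hW.preact_eq hΩ hy, add_sub_add_right_eq_sub,
      ← Finset.sum_sub_distrib]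
    have e : ∀ c', (∫ q : ℂ × S1, (x q.1 q.2 c' - κ c') * W c' k (filterArg u α q) ∂dPlaneS1)
        - ∫ q : ℂ × S1, (y q.1 q.2 c' - κ c') * W c' k (filterArg u α q) ∂dPlaneS1
        = ∫ q : ℂ × S1, (x - y) q.1 q.2 c' * W c' k (filterArg u α q) ∂dPlaneS1 := fun c' => by
      rw [← integral_sub (hx.integrable_mul hΩ (hW.filter c' k) u α c')
        (hy.integrable_mul hΩ (hW.filter c' k) u α c')]
      refine integral_congr_ae (ae_of_all _ fun q => ?_)
      simp only [Pi.sub_apply]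
      ring
    simp_rw [e]
    exact enorm_sum_integral_le _ (fun c' (q : ℂ × S1) => (x - y) q.1 q.2 c')
      fun c' q => W c' k (filterArg u α q)

lemma LayerBound.featureNorm_layer_sub_const_le (hW : LayerBound c A W) (hΩ : volume Ω ≠ ∞)
    (hσ : LipschitzWith 1 σ) (b : Fin M → ℝ) (hx : IsAdmissible Ω κ x) :
    featureNorm Ω (layer σ W b x - fun _ _ => layerConst σ W b κ)
      ≤ featureNorm Ω (x - fun _ _ => κ) := by
  have h := hW.featureNorm_layer_sub_le hΩ hσ b hx (isAdmissible_const Ω κ)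
  rwa [hW.layer_const] at h

lemma LayerBound.isAdmissible_layer (hW : LayerBound c A W) (hΩ : volume Ω ≠ ∞)
    (hσ : LipschitzWith 1 σ) (b : Fin M → ℝ) (hx : IsAdmissible Ω κ x) :
    IsAdmissible Ω (layerConst σ W b κ) (layer σ W b x) :=
  ⟨hW.measurableFeature_layer hσ.continuous b hx.measurable,
    ne_top_of_le_ne_top hx.ne_top (hW.featureNorm_layer_sub_const_le hΩ hσ b hx)⟩

/-! ### Deformed feature maps -/

/-- The deformation `x(u, α, λ) ↦ x(u - τ(u), α, λ)` of a feature map. -/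
def deform (τ : ℂ → ℂ) {M : ℕ} (x : ℂ → S1 → Fin M → ℝ) : ℂ → S1 → Fin M → ℝ :=
  fun u => x (u - τ u)

section

variable {τ : ℂ → ℂ} {ε : NNReal}

lemma MeasurableFeature.deform (hτ : Continuous τ) (hx : MeasurableFeature x) :
    MeasurableFeature (deform τ x) := fun c' =>
  (hx c').comp (by fun_prop : Continuous fun p : ℂ × S1 => (p.1 - τ p.1, p.2)).measurable

lemma featureNorm_deform_le (hε : ε ≤ 1 / 5) (hL : LipschitzWith ε τ)
    (hx : MeasurableFeature x) :
    featureNorm Ω (deform τ x) ≤ ENNReal.ofReal (5 / 4) * featureNorm Ω x := by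
  have hτc := hL.continuous
  refine (ENNReal.pow_le_pow_left_iff two_ne_zero).1 ?_
  rw [mul_pow, featureNorm_sq, featureNorm_sq, mul_left_comm]
  refine mul_le_mul' le_rfl ?_
  rw [Finset.mul_sum]
  refine Finset.sum_le_sum fun c' _ => ?_
  rw [mul_left_comm]
  refine mul_le_mul' le_rfl ?_
  have hm : Measurable fun p : ℂ × S1 => ‖x p.1 p.2 c'‖ₑ ^ 2 := (hx c').enorm.pow_const 2
  have hg : Measurable fun p : ℂ × S1 => (p.1 - τ p.1, p.2) :=
    (by fun_prop : Continuous fun p : ℂ × S1 => (p.1 - τ p.1, p.2)).measurable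
  have h := lintegral_comp_deformation_le (T := fun _ v => v - τ v)
    (fun _ => antilipschitz_sub hε hL) (by fun_prop) hm
  rw [← lintegral_prod_swapped (f := fun p : ℂ × S1 => ‖x (p.1 - τ p.1) p.2 c'‖ₑ ^ 2)
    (hm.comp hg)] at h
  refine h.trans_eq ?_
  congr 2
  rw [← ENNReal.ofReal_coe_nnreal]
  norm_num

lemma IsAdmissible.deform (hε : ε ≤ 1 / 5) (hL : LipschitzWith ε τ) (hx : IsAdmissible Ω κ x) :
    IsAdmissible Ω κ (RotDCF.deform τ x) := by
  have h := featureNorm_deform_le (Ω := Ω) hε hL (hx.measurable.sub (measurableFeature_const κ))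
  have e : RotDCF.deform τ (x - fun _ _ => κ) = RotDCF.deform τ x - fun _ _ => κ := rfl
  rw [e] at h
  exact ⟨hx.measurable.deform hL.continuous, ne_top_of_le_ne_top
    (ENNReal.mul_ne_top ENNReal.ofReal_ne_top hx.ne_top) h⟩

/-- Layers almost commute with deformations. -/
lemma LayerBound.featureNorm_commutator_le (hW : LayerBound c A W) (hc : 0 < c)
    (hΩ : volume Ω ≠ ∞) (hσ : LipschitzWith 1 σ) (b : Fin M → ℝ) (hx : IsAdmissible Ω κ x)
    (hτ : ContDiff ℝ 1 τ) (hε : ε ≤ 1 / 5) (hτε : ∀ u, ‖fderiv ℝ τ u‖ ≤ ε)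
    (hL : LipschitzWith ε τ) :
    featureNorm Ω (layer σ W b (RotDCF.deform τ x) - RotDCF.deform τ (layer σ W b x))
      ≤ 8 * ε * featureNorm Ω (x - fun _ _ => κ) := by
  have hWm := fun c' k => (hW.filter c' k).measurable
  have hxd := hx.deform hε hL
  have hτc := hL.continuous
  have hg : Measurable fun q : ℂ × S1 => (q.1 - τ q.1, q.2) :=
    (by fun_prop : Continuous fun q : ℂ × S1 => (q.1 - τ q.1, q.2)).measurable
  have hJ : Measurable (jacobian τ) := (continuous_jacobian hτ).measurable
  have hδ : ENNReal.ofReal (5 / 4 * ε / c) * ((5 / 4 : NNReal) : ℝ≥0∞) ^ 2 * ENNReal.ofReal c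
      + ENNReal.ofReal (11 / 5 * ε) * ((5 / 4 : NNReal) : ℝ≥0∞) ^ 2
      = ENNReal.ofReal (345 / 64 * ε) := by
    rw [← ENNReal.ofReal_coe_nnreal (p := 5 / 4), ← ENNReal.ofReal_pow (NNReal.coe_nonneg _),
      ← ENNReal.ofReal_mul (by positivity), ← ENNReal.ofReal_mul (by positivity),
      ← ENNReal.ofReal_mul (by positivity), ← ENNReal.ofReal_add (by positivity) (by positivity)]
    congr 1
    push_cast
    field_simp
    ring
  have hpt : ∀ J w w' : ℝ, ‖w - J * w'‖ₑ ≤ ‖w' - w‖ₑ + ‖1 - J‖ₑ * ‖w'‖ₑ := fun J w w' => by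
    rw [← enorm_mul, show w - J * w' = -(w' - w) + (1 - J) * w' by ring]
    exact (enorm_add_le _ _).trans_eq (by rw [enorm_neg])
  have key : featureNorm Ω (layer σ W b (RotDCF.deform τ x) - RotDCF.deform τ (layer σ W b x))
      ≤ ENNReal.ofReal (345 / 64 * ε)
        * featureNorm Ω (RotDCF.deform τ (x - fun _ _ => κ)) := by
    refine featureNorm_le_of_kernel Ω hW.pos hW.row hW.col
      (k := fun c' k p q => ‖W c' k (filterArg p.1 p.2 q)
        - jacobian τ q.1 * W c' k (filterArg (p.1 - τ p.1) p.2 (q.1 - τ q.1, q.2))‖ₑ)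
      (fun c' k => ?_) (fun c' k p => ?_)
      (fun c' k q => ?_) ((hx.measurable.sub (measurableFeature_const κ)).deform hτc)
      fun u α k => ?_
    · have h1 : Measurable fun r : (ℂ × S1) × (ℂ × S1) =>
          filterArg (r.1.1 - τ r.1.1) r.1.2 (r.2.1 - τ r.2.1, r.2.2) :=
        measurable_filterArg.comp ((hg.comp measurable_fst).prodMk (hg.comp measurable_snd))
      exact (((hWm c' k).comp measurable_filterArg).sub
        ((hJ.comp (measurable_fst.comp measurable_snd)).mul ((hWm c' k).comp h1))).enorm
    · have hP : Continuous fun v => v - τ v - (p.1 - τ p.1) := by fun_prop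
      have hdef := isDeformation_commutator_left hε hL hc p.1
      have h1 := (hW.filter c' k).lintegral_sub_left_le hdef p.2
      have h2 := lintegral_filter_left_le hP hdef.antilipschitz₁ (hWm c' k).enorm p.2
      have hm : Measurable fun q : ℂ × S1 => ‖W c' k (rot p.2 (q.1 - τ q.1 - (p.1 - τ p.1)),
          q.2 - p.2)‖ₑ := ((hWm c' k).comp (measurable_rot_left hP p.2)).enorm
      calc _ ≤ ∫⁻ q : ℂ × S1, (‖W c' k (rot p.2 (q.1 - τ q.1 - (p.1 - τ p.1)), q.2 - p.2)
              - W c' k (rot p.2 (q.1 - p.1), q.2 - p.2)‖ₑ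
            + ENNReal.ofReal (11 / 5 * ε)
              * ‖W c' k (rot p.2 (q.1 - τ q.1 - (p.1 - τ p.1)), q.2 - p.2)‖ₑ) ∂dPlaneS1 :=
            lintegral_mono fun q => (hpt _ _ _).trans
              (add_le_add le_rfl (mul_le_mul' (enorm_one_sub_jacobian_le hε hτε q.1) le_rfl))
        _ ≤ _ := by
            rw [lintegral_add_right _ (hm.const_mul _), lintegral_const_mul _ hm]
            refine (add_le_add h1 (mul_le_mul' le_rfl h2)).trans ?_
            rw [← hδ, add_mul, ← mul_assoc]
            exact add_le_add le_rfl (mul_le_mul' le_rfl (hW.filter c' k).lintegral_le)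
    · have hP : Continuous fun u => q.1 - τ q.1 - (u - τ u) := by fun_prop
      have hdef := isDeformation_commutator_right hε hL hc q.1
      have h1 := (hW.filter c' k).lintegral_sub_right_le hdef q.2
      have h2 := lintegral_filter_right_le hP hdef.antilipschitz₁ (hWm c' k).enorm q.2
      have hm : Measurable fun p : ℂ × S1 => ‖W c' k (rot p.2 (q.1 - τ q.1 - (p.1 - τ p.1)),
          q.2 - p.2)‖ₑ := ((hWm c' k).comp (measurable_rot_right hP q.2)).enorm
      calc _ ≤ ∫⁻ p : ℂ × S1, (‖W c' k (rot p.2 (q.1 - τ q.1 - (p.1 - τ p.1)), q.2 - p.2)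
              - W c' k (rot p.2 (q.1 - p.1), q.2 - p.2)‖ₑ
            + ENNReal.ofReal (11 / 5 * ε)
              * ‖W c' k (rot p.2 (q.1 - τ q.1 - (p.1 - τ p.1)), q.2 - p.2)‖ₑ) ∂dPlaneS1 :=
            lintegral_mono fun p => (hpt _ _ _).trans
              (add_le_add le_rfl (mul_le_mul' (enorm_one_sub_jacobian_le hε hτε q.1) le_rfl))
        _ ≤ _ := by
            rw [lintegral_add_right _ (hm.const_mul _), lintegral_const_mul _ hm]
            refine (add_le_add h1 (mul_le_mul' le_rfl h2)).trans ?_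
            rw [← hδ, add_mul, ← mul_assoc]
            exact add_le_add le_rfl (mul_le_mul' le_rfl (hW.filter c' k).lintegral_le)
    · refine (enorm_layer_sub_le hσ b u (u - τ u) α k).trans ?_
      rw [hW.preact_eq hΩ hxd, hW.preact_eq hΩ hx, add_sub_add_right_eq_sub,
        ← Finset.sum_sub_distrib]
      have e : ∀ c', (∫ q : ℂ × S1, (RotDCF.deform τ x q.1 q.2 c' - κ c')
            * W c' k (filterArg u α q) ∂dPlaneS1)
          - ∫ q : ℂ × S1, (x q.1 q.2 c' - κ c') * W c' k (filterArg (u - τ u) α q) ∂dPlaneS1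
          = ∫ q : ℂ × S1, RotDCF.deform τ (x - fun _ _ => κ) q.1 q.2 c'
            * (W c' k (filterArg u α q) - jacobian τ q.1
              * W c' k (filterArg (u - τ u) α (q.1 - τ q.1, q.2))) ∂dPlaneS1 := fun c' => by
        obtain ⟨h1, h2⟩ := integral_eq_integral_jacobian_mul hτ hε hL
          (hx.integrable_mul hΩ (hW.filter c' k) (u - τ u) α c')
        rw [h2, ← integral_sub (hxd.integrable_mul hΩ (hW.filter c' k) u α c') h1]
        refine integral_congr_ae (ae_of_all _ fun q => ?_)
        simp only [Pi.sub_apply, RotDCF.deform]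
        ring
      simp_rw [e]
      exact enorm_sum_integral_le _
        (fun c' (q : ℂ × S1) => RotDCF.deform τ (x - fun _ _ => κ) q.1 q.2 c')
        fun c' q => W c' k (filterArg u α q) - jacobian τ q.1
          * W c' k (filterArg (u - τ u) α (q.1 - τ q.1, q.2))
  refine key.trans ?_
  refine (mul_le_mul' le_rfl (featureNorm_deform_le hε hL
    (hx.measurable.sub (measurableFeature_const κ)))).trans ?_
  rw [← mul_assoc, ← ENNReal.ofReal_mul (by positivity)]
  refine mul_le_mul' ?_ le_rfl
  rw [← ENNReal.ofReal_coe_nnreal, ← ENNReal.ofReal_ofNat, ← ENNReal.ofReal_mul (by norm_num)]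
  refine ENNReal.ofReal_le_ofReal ?_
  have := ε.coe_nonneg
  linarith

/-- The output of a layer moves little under a small displacement. -/
lemma LayerBound.featureNorm_displacement_le (hW : LayerBound c A W)
    (hΩ : volume Ω ≠ ∞) (hσ : LipschitzWith 1 σ) (b : Fin M → ℝ) (hx : IsAdmissible Ω κ x)
    (hε : ε ≤ 1 / 5) (hL : LipschitzWith ε τ) :
    featureNorm Ω (RotDCF.deform τ (layer σ W b x) - layer σ W b x)
      ≤ 2 * ENNReal.ofReal c * supNorm τ * featureNorm Ω (x - fun _ _ => κ) := by
  have hWm := fun c' k => (hW.filter c' k).measurable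
  have hτc := hL.continuous
  have hK : ((5 / 4 : NNReal) : ℝ≥0∞) ^ 2 ≤ 2 := by
    rw [← ENNReal.coe_pow, ← ENNReal.coe_ofNat, ENNReal.coe_le_coe, ← NNReal.coe_le_coe]
    norm_num
  refine featureNorm_le_of_kernel Ω hW.pos hW.row hW.col
    (k := fun c' k p q => ‖W c' k (filterArg (p.1 - τ p.1) p.2 q)
      - W c' k (filterArg p.1 p.2 q)‖ₑ)
    (fun c' k => ?_) (fun c' k p => ?_)
    (fun c' k q => ?_) (hx.measurable.sub (measurableFeature_const κ)) fun u α k => ?_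
  · have h1 : Measurable fun r : (ℂ × S1) × (ℂ × S1) => filterArg (r.1.1 - τ r.1.1) r.1.2 r.2 :=
      measurable_filterArg.comp
        (by fun_prop : Continuous fun r : (ℂ × S1) × (ℂ × S1) =>
          ((r.1.1 - τ r.1.1, r.1.2), r.2)).measurable
    exact (((hWm c' k).comp h1).sub ((hWm c' k).comp measurable_filterArg)).enorm
  · have h := (hW.filter c' k).lintegral_sub_left_le
      (isDeformation_displacement_left τ c p.1) p.2
    refine h.trans ?_
    rw [ENNReal.coe_one, one_pow, mul_one]
    refine mul_le_mul' ?_ le_rfl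
    calc supNorm τ * ENNReal.ofReal c = 1 * ENNReal.ofReal c * supNorm τ := by ring
      _ ≤ _ := mul_le_mul' (mul_le_mul' one_le_two le_rfl) le_rfl
  · have h := (hW.filter c' k).lintegral_sub_right_le
      (isDeformation_displacement_right hε hL c q.1) q.2
    refine h.trans (mul_le_mul' ?_ le_rfl)
    calc supNorm τ * ((5 / 4 : NNReal) : ℝ≥0∞) ^ 2 * ENNReal.ofReal c
        = ((5 / 4 : NNReal) : ℝ≥0∞) ^ 2 * ENNReal.ofReal c * supNorm τ := by ring
      _ ≤ _ := mul_le_mul' (mul_le_mul' hK le_rfl) le_rfl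
  · refine (enorm_layer_sub_le hσ b (u - τ u) u α k).trans ?_
    rw [hW.preact_eq hΩ hx, hW.preact_eq hΩ hx, add_sub_add_right_eq_sub,
      ← Finset.sum_sub_distrib]
    have e : ∀ c', (∫ q : ℂ × S1, (x q.1 q.2 c' - κ c') * W c' k (filterArg (u - τ u) α q) ∂dPlaneS1)
        - ∫ q : ℂ × S1, (x q.1 q.2 c' - κ c') * W c' k (filterArg u α q) ∂dPlaneS1
        = ∫ q : ℂ × S1, (x - fun _ _ => κ : ℂ → S1 → Fin M' → ℝ) q.1 q.2 c'
          * (W c' k (filterArg (u - τ u) α q) - W c' k (filterArg u α q)) ∂dPlaneS1 := fun c' => by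
      rw [← integral_sub (hx.integrable_mul hΩ (hW.filter c' k) _ α c')
        (hx.integrable_mul hΩ (hW.filter c' k) u α c')]
      refine integral_congr_ae (ae_of_all _ fun q => ?_)
      simp only [Pi.sub_apply]
      ring
    simp_rw [e]
    exact enorm_sum_integral_le _ (fun c' (q : ℂ × S1) =>
      (x - fun _ _ => κ : ℂ → S1 → Fin M' → ℝ) q.1 q.2 c')
      fun c' q => W c' k (filterArg (u - τ u) α q) - W c' k (filterArg u α q)

end

/-! ### The layers of a network -/

/-- The filters of the layer `l + 1`, as functions on `ℝ² × S¹`. -/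
def Net.filter (N : Net) : (l : ℕ) → Fin (N.M l) → Fin (N.M (l + 1)) → ℂ × S1 → ℝ
  | 0 => fun c' c p => N.W₁ c' c p.1
  | n + 1 => N.W n

lemma Net.output_succ (N : Net) (x : ℂ → Fin (N.M 0) → ℝ) (l : ℕ) :
    N.output x (l + 1) = layer N.σ (N.filter l) (N.b (l + 1)) (N.output x l) := by
  cases l with
  | zero =>
    funext u α c
    simp only [Net.output, Net.firstLayer, layer, preact, Net.filter]
    congr 2
    refine Finset.sum_congr rfl fun c' _ => ?_
    have h := integral_fun_fst (μ := (volume : Measure ℂ)) (ν := dS1)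
      fun v => x (u + v) c' * N.W₁ c' c (rot α v)
    simpa using h.symm
  | succ n => rfl

lemma layerBound_of_boundOf_le {c : ℝ} {M' M : ℕ} (hM' : 0 < M') {w : Fin M' → Fin M → ℝ≥0∞}
    (hw : boundOf w ≤ 1) {W : Fin M' → Fin M → ℂ × S1 → ℝ}
    (hW : ∀ c' k, FilterBound c (ENNReal.ofReal π * w c' k) (W c' k)) :
    LayerBound c (fun c' k => ENNReal.ofReal π * w c' k) W := by
  refine ⟨hM', hW, fun k => ?_, fun c' => ?_⟩
  · rw [← Finset.mul_sum]
    refine le_trans (mul_le_mul' le_rfl ?_) hw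
    exact (le_iSup (fun k => ∑ c', w c' k) k).trans (le_max_left _ _)
  · rw [← Finset.mul_sum, mul_left_comm]
    refine le_trans (mul_le_mul' le_rfl ?_) hw
    exact (le_iSup (fun c' => (M' : ℝ≥0∞) / M * ∑ k, w c' k) c').trans (le_max_right _ _)

/-- The filters of a normalized layer have Borel representatives that satisfy `LayerBound`. -/
lemma Net.exists_layerBound (N : Net) (l : ℕ) (h : N.A (l + 1) ≤ 1) :
    ∃ W A, LayerBound ((2 : ℝ) ^ (-N.j (l + 1))) A W
      ∧ ∀ x, N.output x (l + 1) = layer N.σ W (N.b (l + 1)) (N.output x l) := by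
  have hout : ∀ W, (∀ c' c, W c' c =ᵐ[dPlaneS1] N.filter l c' c) → ∀ x,
      N.output x (l + 1) = layer N.σ W (N.b (l + 1)) (N.output x l) := fun W hW x => by
    rw [N.output_succ]
    unfold layer
    rw [preact_congr_filter hW]
  cases l with
  | zero =>
    choose W h1 h2 using fun c' c =>
      exists_filterBound_planar (N.j 1) (N.a₁ c' c) (N.W₁_eq c' c)
    exact ⟨W, _, layerBound_of_boundOf_le (N.M_pos 0) h h2, hout W h1⟩
  | succ n =>
    choose W h1 h2 using fun c' c =>
      exists_filterBound_joint (N.j (n + 2)) (N.a n c' c) (N.W_eq n c' c)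
    exact ⟨W, _, layerBound_of_boundOf_le (N.M_pos _) h h2, hout W h1⟩

lemma Net.output_congr (N : Net) {x y : ℂ → Fin (N.M 0) → ℝ}
    (h : ∀ c, (fun u => x u c) =ᵐ[volume] fun u => y u c) (l : ℕ) :
    N.output x (l + 1) = N.output y (l + 1) := by
  induction l with
  | zero =>
    rw [N.output_succ, N.output_succ]
    unfold layer
    rw [preact_congr_input (N.filter 0) (x := N.output x 0) (x' := N.output y 0) fun c' =>
      Measure.quasiMeasurePreserving_fst.ae (h c')]
  | succ n ih => rw [N.output_succ, ih, ← N.output_succ]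

/-! ### Rotation equivariance -/

lemma measurableEmbedding_rot (t : S1) : MeasurableEmbedding (rot t) :=
  (rotation (AddCircle.toCircle t)).toHomeomorph.measurableEmbedding

lemma rotAround_add (u₀ : ℂ) (t : S1) (u v : ℂ) :
    rotAround u₀ t (u + v) = rotAround u₀ t u + rot t v := by
  rw [rotAround, rotAround, add_assoc, ← rot_add]
  ring_nf

lemma preact_Trho {M' M : ℕ} (W : Fin M' → Fin M → ℂ × S1 → ℝ) (u₀ : ℂ) (t : S1)
    (x : ℂ → S1 → Fin M' → ℝ) (u : ℂ) (α : S1) (c : Fin M) :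
    preact W (Trho u₀ t x) u α c = preact W x (rotAround u₀ t u) (α - t) c := by
  refine Finset.sum_congr rfl fun c' _ => ?_
  rw [← (measurePreserving_rot_sub t).integral_comp
    ((measurableEmbedding_rot t).prodMap (Homeomorph.subRight t).measurableEmbedding)
    fun p => x (rotAround u₀ t u + p.1) p.2 c' * W c' c (rot (α - t) p.1, p.2 - (α - t))]
  refine integral_congr_ae (ae_of_all _ fun p => ?_)
  simp only [Trho, rotAround_add, rot_rot, sub_add_cancel, sub_sub_sub_cancel_right]

lemma Net.output_Drho (N : Net) (u₀ : ℂ) (t : S1) (x : ℂ → Fin (N.M 0) → ℝ) (l : ℕ) :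
    N.output (Drho u₀ t x) l = Trho u₀ t (N.output x l) := by
  induction l with
  | zero => rfl
  | succ n ih =>
    funext u α c
    rw [N.output_succ, N.output_succ, ih]
    simp only [layer, Trho]
    rw [← preact_Trho]

lemma featureNorm_Trho (Ω : Set ℂ) (u₀ : ℂ) (t : S1) {M : ℕ} (x : ℂ → S1 → Fin M → ℝ) :
    featureNorm Ω (Trho u₀ t x) = featureNorm Ω x := by
  have h1 : MeasurePreserving (fun p : ℂ × S1 => (rotAround u₀ t p.1, p.2 - t))
      dPlaneS1 dPlaneS1 :=
    ((measurePreserving_add_left volume u₀).comp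
      ((measurePreserving_rot t).comp (measurePreserving_sub_right volume u₀))).prod
      (measurePreserving_sub_right dS1 t)
  have h2 : MeasurableEmbedding fun p : ℂ × S1 => (rotAround u₀ t p.1, p.2 - t) :=
    ((Homeomorph.addLeft u₀).measurableEmbedding.comp
      ((measurableEmbedding_rot t).comp (Homeomorph.subRight u₀).measurableEmbedding)).prodMap
      (Homeomorph.subRight t).measurableEmbedding
  simp only [featureNorm, Trho]
  congr 3
  funext c
  rw [← h1.lintegral_comp_emb h2 fun p => ‖x p.1 p.2 c‖ₑ ^ 2]

/-! ### Inputs -/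

lemma inputNorm_congr (Ω : Set ℂ) {M : ℕ} {x y : ℂ → Fin M → ℝ}
    (h : ∀ c, (fun u => x u c) =ᵐ[volume] fun u => y u c) : inputNorm Ω x = inputNorm Ω y := by
  simp only [inputNorm]
  congr 3
  funext c
  congr 1
  refine lintegral_congr_ae ?_
  filter_upwards [h c] with u hu
  rw [hu]

lemma featureNorm_eq_inputNorm (Ω : Set ℂ) {M : ℕ} {x : ℂ → Fin M → ℝ}
    (hx : ∀ c, Measurable fun u => x u c) :
    featureNorm Ω (fun u _ c => x u c) = inputNorm Ω x := by
  simp only [inputNorm, featureNorm]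
  congr 3
  funext c
  congr 1
  exact (measurePreserving_fst (μ := (volume : Measure ℂ)) (ν := dS1)).lintegral_comp
    ((hx c).enorm.pow_const 2)

lemma inputNorm_ne_top {Ω : Set ℂ} (hΩ : volume Ω ≠ 0) {M : ℕ} (hM : 0 < M) {x : ℂ → Fin M → ℝ}
    (hx : ∀ c, MemLp (fun u => x u c) 2 volume) : inputNorm Ω x ≠ ∞ := by
  refine ENNReal.rpow_ne_top_of_nonneg (by norm_num) (ENNReal.mul_ne_top (by simpa using hM.ne') ?_)
  refine (ENNReal.sum_ne_top).2 fun c _ => ENNReal.mul_ne_top (by simpa using hΩ) ?_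
  rw [← eLpNorm_two_sq]
  exact ENNReal.pow_ne_top (hx c).eLpNorm_ne_top

lemma ae_eq_comp_sub {τ : ℂ → ℂ} {ε : NNReal} (hε : ε ≤ 1 / 5) (hL : LipschitzWith ε τ)
    {f g : ℂ → ℝ} (h : f =ᵐ[volume] g) :
    (fun u => f (u - τ u)) =ᵐ[volume] fun u => g (u - τ u) := by
  have hτc := hL.continuous
  have hm : Measurable fun u => u - τ u :=
    (by fun_prop : Continuous fun u => u - τ u).measurable
  have hq : Measure.QuasiMeasurePreserving (fun u => u - τ u) volume volume := by
    refine ⟨hm, ?_⟩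
    exact (Measure.absolutelyContinuous_of_le_smul
      (map_volume_le_of_antilipschitz (antilipschitz_sub hε hL) hm))
  exact hq.ae h

/-! ### Stability under deformations -/

/-- The layers of a network are `L²` up to constants, and commute with `τ` up to an error that
grows linearly in the depth. -/
lemma Net.exists_admissible_output (N : Net) {L : ℕ} (hσ : LipschitzWith 1 N.σ)
    (hA : ∀ l, 1 ≤ l → l ≤ L → N.A l ≤ 1) {τ : ℂ → ℂ} (hτ : ContDiff ℝ 1 τ) {ε : NNReal}
    (hε : ε ≤ 1 / 5) (hτε : ∀ u, ‖fderiv ℝ τ u‖ ≤ ε) (hL : LipschitzWith ε τ) {Ω : Set ℂ}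
    (hΩ : volume Ω ≠ ∞) {x : ℂ → Fin (N.M 0) → ℝ} (hx : ∀ c, Measurable fun u => x u c)
    (hxΩ : inputNorm Ω x ≠ ∞) (l : ℕ) (hl : l ≤ L) :
    ∃ κ, IsAdmissible Ω κ (N.output x l) ∧ IsAdmissible Ω κ (N.output (Dtau τ x) l)
      ∧ featureNorm Ω (N.output x l - fun _ _ => κ) ≤ inputNorm Ω x
      ∧ featureNorm Ω (N.output (Dtau τ x) l - deform τ (N.output x l))
        ≤ l * (8 * ε) * inputNorm Ω x := by
  induction l with
  | zero =>
    have h0 : (N.output x 0 - fun _ _ => (0 : Fin (N.M 0) → ℝ)) = N.output x 0 := by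
      funext u α c
      simp
    have hn : featureNorm Ω (N.output x 0) = inputNorm Ω x := featureNorm_eq_inputNorm Ω hx
    have hadm : IsAdmissible Ω 0 (N.output x 0) :=
      ⟨fun c => (hx c).comp measurable_fst, by rw [h0, hn]; exact hxΩ⟩
    refine ⟨0, hadm, hadm.deform hε hL, by rw [h0, hn], ?_⟩
    rw [show N.output (Dtau τ x) 0 = deform τ (N.output x 0) from rfl, sub_self, featureNorm_zero]
    exact zero_le
  | succ n ih =>
    obtain ⟨κ, hadm, hadmτ, hle, hcomm⟩ := ih (by omega)
    obtain ⟨W, A, hW, hout⟩ := N.exists_layerBound n (hA (n + 1) (by omega) hl)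
    rw [hout, hout]
    have hadmd := hadm.deform hε hL
    refine ⟨_, hW.isAdmissible_layer hΩ hσ _ hadm, hW.isAdmissible_layer hΩ hσ _ hadmτ,
      (hW.featureNorm_layer_sub_const_le hΩ hσ _ hadm).trans hle, ?_⟩
    refine (featureNorm_triangle Ω (hW.measurableFeature_layer hσ.continuous _ hadmτ.measurable)
      (hW.measurableFeature_layer hσ.continuous (N.b (n + 1)) hadmd.measurable)
      ((hW.measurableFeature_layer hσ.continuous _ hadm.measurable).deform hL.continuous)).trans ?_
    refine (add_le_add ((hW.featureNorm_layer_sub_le hΩ hσ _ hadmτ hadmd).trans hcomm)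
      ((hW.featureNorm_commutator_le (by positivity) hΩ hσ _ hadm hτ hε hτε hL).trans
        (mul_le_mul' le_rfl hle))).trans_eq ?_
    push_cast
    ring

lemma norm_fderiv_le_of_supGrad {τ : ℂ → ℂ} (h : supGrad τ ≠ ∞) (u : ℂ) :
    ‖fderiv ℝ τ u‖₊ ≤ (supGrad τ).toNNReal := by
  rw [← ENNReal.coe_le_coe, ENNReal.coe_toNNReal h]
  exact le_iSup (fun u => ‖fderiv ℝ τ u‖ₑ) u

/-- Stability under deformations, for Borel measurable inputs. -/
lemma Net.featureNorm_output_Dtau_sub_le (N : Net) {l : ℕ} (hσ : LipschitzWith 1 N.σ)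
    (hA : ∀ k, 1 ≤ k → k ≤ l + 1 → N.A k ≤ 1) {τ : ℂ → ℂ} (hτ : ContDiff ℝ 1 τ) {ε : NNReal}
    (hε : ε ≤ 1 / 5) (hτε : ∀ u, ‖fderiv ℝ τ u‖ ≤ ε) (hL : LipschitzWith ε τ) {Ω : Set ℂ}
    (hΩ : volume Ω ≠ ∞) {x : ℂ → Fin (N.M 0) → ℝ} (hx : ∀ c, Measurable fun u => x u c)
    (hxΩ : inputNorm Ω x ≠ ∞) :
    featureNorm Ω (N.output (Dtau τ x) (l + 1) - N.output x (l + 1))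
      ≤ (2 * 4 * ((l + 1 : ℕ) : ℝ≥0∞) * ε
          + 2 * ENNReal.ofReal ((2 : ℝ) ^ (-N.j (l + 1))) * supNorm τ) * inputNorm Ω x := by
  obtain ⟨κ, hadm, -, hle, -⟩ :=
    N.exists_admissible_output hσ hA hτ hε hτε hL hΩ hx hxΩ l (by omega)
  obtain ⟨κ', hadm', hadmτ', -, hcomm⟩ :=
    N.exists_admissible_output hσ hA hτ hε hτε hL hΩ hx hxΩ (l + 1) le_rfl
  obtain ⟨W, A, hW, hout⟩ := N.exists_layerBound l (hA (l + 1) (by omega) le_rfl)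
  have hdisp : featureNorm Ω (deform τ (N.output x (l + 1)) - N.output x (l + 1))
      ≤ 2 * ENNReal.ofReal ((2 : ℝ) ^ (-N.j (l + 1))) * supNorm τ * inputNorm Ω x := by
    rw [hout]
    exact (hW.featureNorm_displacement_le hΩ hσ _ hadm hε hL).trans (mul_le_mul' le_rfl hle)
  refine (featureNorm_triangle Ω hadmτ'.measurable (hadm'.measurable.deform hL.continuous)
    hadm'.measurable).trans ((add_le_add hcomm hdisp).trans_eq ?_)
  rw [← add_mul]
  congr 2
  ring

end RotDCF

theorem theorem3p2 (N : RotDCF.Net) (L : ℕ) (hL : 1 ≤ L)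
    (hA1 : LipschitzWith 1 N.σ)
    (hA2 : ∀ l, 1 ≤ l → l ≤ L → N.A l ≤ 1)
    (τ : ℂ → ℂ) (hτ : ContDiff ℝ 2 τ)
    (hA3 : RotDCF.supGrad τ < 1 / 5)
    (u₀ : ℂ) (t : RotDCF.S1)
    (Ω : Set ℂ) (hΩ0 : 0 < volume Ω) (hΩ : volume Ω < ∞)
    (x : ℂ → Fin (N.M 0) → ℝ) (hx : ∀ c, MemLp (fun u => x u c) 2 volume) :
    RotDCF.featureNorm Ω
        (N.output (RotDCF.Drho u₀ t (RotDCF.Dtau τ x)) L - RotDCF.Trho u₀ t (N.output x L))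
      ≤ (2 * 4 * (L : ℝ≥0∞) * RotDCF.supGrad τ
          + 2 * ENNReal.ofReal ((2 : ℝ) ^ (-N.j L)) * RotDCF.supNorm τ)
        * RotDCF.inputNorm Ω x := by
  obtain ⟨l, rfl⟩ : ∃ l, L = l + 1 := ⟨L - 1, by omega⟩
  have htop : RotDCF.supGrad τ ≠ ∞ := (hA3.trans (by simp)).ne
  have hε : (RotDCF.supGrad τ).toNNReal ≤ 1 / 5 := by
    rw [← ENNReal.coe_le_coe, ENNReal.coe_toNNReal htop]
    exact hA3.le.trans_eq (by rw [ENNReal.coe_div (by norm_num)]; norm_num)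
  have hlip : LipschitzWith (RotDCF.supGrad τ).toNNReal τ :=
    lipschitzWith_of_nnnorm_fderiv_le (𝕜 := ℝ) (hτ.differentiable two_ne_zero)
      (RotDCF.norm_fderiv_le_of_supGrad htop)
  obtain ⟨y, hy, hxy⟩ : ∃ y : ℂ → Fin (N.M 0) → ℝ, (∀ c, Measurable fun u => y u c)
      ∧ ∀ c, (fun u => x u c) =ᵐ[volume] fun u => y u c :=
    ⟨fun u c => (hx c).1.mk (fun u => x u c) u,
      fun c => (hx c).1.stronglyMeasurable_mk.measurable, fun c => (hx c).1.ae_eq_mk⟩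
  have hb := N.featureNorm_output_Dtau_sub_le hA1 hA2 (hτ.of_le one_le_two) hε
    (RotDCF.norm_fderiv_le_of_supGrad htop) hlip hΩ.ne hy
    (RotDCF.inputNorm_ne_top hΩ0.ne' (N.M_pos 0) fun c => (memLp_congr_ae (hxy c)).1 (hx c))
  have e1 : N.output (RotDCF.Dtau τ x) (l + 1) = N.output (RotDCF.Dtau τ y) (l + 1) :=
    N.output_congr (fun c => RotDCF.ae_eq_comp_sub hε hlip (hxy c)) l
  rw [← N.output_congr hxy, ← RotDCF.inputNorm_congr Ω hxy, ← e1, ENNReal.coe_toNNReal htop] at hb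
  have e2 : N.output (RotDCF.Drho u₀ t (RotDCF.Dtau τ x)) (l + 1)
      - RotDCF.Trho u₀ t (N.output x (l + 1))
      = RotDCF.Trho u₀ t (N.output (RotDCF.Dtau τ x) (l + 1) - N.output x (l + 1)) := by
    rw [N.output_Drho]
    rfl
  rw [e2, RotDCF.featureNorm_Trho]
  exact hb
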